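/- Consider the real RAM with unit-cost operations: its memory consists of real cells and integer cells with indirect addressing, its operations on reals are $+,-,\times,/,\sqrt{\ }$ and comparison (with rational constants), and its operations on integer indices are addition, subtraction, halving and comparison. There are a single deterministic program for this machine and an absolute constant $K$ with the following property. For every real $\epsilon$ with $0<\epsilon\le 1$, every $n\ge 1$ and every family $\mathcal{D}=(D_1,\dots,D_n)$ of $n$ closed disks in the Euclidean plane (radius $0$ is permitted), the program, given $n$, $\epsilon$ and the coordinates of the centers and the radii of the disks in $\mathcal D$ as input, halts after at most $K\,\frac{n}{\epsilon}\log(n+1)$ steps, and outputs two closed disks $C_1,C_2$ of equal radius $r$ such that 1. every $D_i$ is contained in $C_1$ or contained in $C_2$ (that is, $(C_1,C_2)$ is a solution of the restricted covering problem for $\mathcal{D}$), and 2. $r\le(1+\epsilon)\,r'$ whenever $C_1',C_2'$ are two closed disks of equal radius $r'$ such that every $D_i$ is contained in $C_1'$ or contained in $C_2'$. In other words, a $(1+\epsilon)$-approximation for the restricted covering problem can be computed in $O((n/\epsilon)\log n)$ time. -/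

import Mathlib

/-! ### A real random access machine

A state consists of zero-initialised arrays of natural numbers (indices, counters) and of real
numbers. A program is a fixed structured program, so it refers to finitely many arrays only; the
cells of each array are addressed indirectly, by computed indices. The operations on reals are
`+`, `-`, `*`, `/`, square root and comparison (no floor, no trigonometric functions, and only
rational literals); the operations on indices are `+`, truncated `-`, halving and comparison.
Every operation, memory access, literal, comparison, assignment and branching costs one step. -/

namespace RealRAM

structure State where
  nat : ℕ → ℕ → ℕ
  real : ℕ → ℕ → ℝ

/-- Write `v` to cell `i` of the natural number array `a`. -/
def State.setNat (s : State) (a i v : ℕ) : State :=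
  { s with nat := fun a' i' => if a' = a ∧ i' = i then v else s.nat a' i' }

/-- Write `v` to cell `i` of the real array `a`. -/
def State.setReal (s : State) (a i : ℕ) (v : ℝ) : State :=
  { s with real := fun a' i' => if a' = a ∧ i' = i then v else s.real a' i' }

/-- Index expressions; `cell a e` reads cell `e` of the natural number array `a`. -/
inductive NExp where
  | lit (k : ℕ)
  | cell (a : ℕ) (e : NExp)
  | add (e f : NExp)
  | sub (e f : NExp)
  | half (e : NExp)

def NExp.eval (s : State) : NExp → ℕ
  | .lit k => k
  | .cell a e => s.nat a (e.eval s)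
  | .add e f => e.eval s + f.eval s
  | .sub e f => e.eval s - f.eval s
  | .half e => e.eval s / 2

def NExp.cost : NExp → ℕ
  | .lit _ => 1
  | .cell _ e => e.cost + 1
  | .add e f => e.cost + f.cost + 1
  | .sub e f => e.cost + f.cost + 1
  | .half e => e.cost + 1

/-- Real expressions; `cell a e` reads cell `e` of the real array `a`. -/
inductive RExp where
  | lit (q : ℚ)
  | cell (a : ℕ) (e : NExp)
  | add (e f : RExp)
  | sub (e f : RExp)
  | mul (e f : RExp)
  | div (e f : RExp)
  | sqrt (e : RExp)

/-- Division by zero and the square root of a negative number return `0`. -/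
noncomputable def RExp.eval (s : State) : RExp → ℝ
  | .lit q => (q : ℝ)
  | .cell a e => s.real a (e.eval s)
  | .add e f => e.eval s + f.eval s
  | .sub e f => e.eval s - f.eval s
  | .mul e f => e.eval s * f.eval s
  | .div e f => e.eval s / f.eval s
  | .sqrt e => Real.sqrt (e.eval s)

def RExp.cost : RExp → ℕ
  | .lit _ => 1
  | .cell _ e => e.cost + 1
  | .add e f => e.cost + f.cost + 1
  | .sub e f => e.cost + f.cost + 1
  | .mul e f => e.cost + f.cost + 1
  | .div e f => e.cost + f.cost + 1
  | .sqrt e => e.cost + 1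

/-- Tests. -/
inductive BExp where
  | natLt (e f : NExp)
  | realLt (e f : RExp)
  | not (b : BExp)
  | and (b c : BExp)

def BExp.eval (s : State) : BExp → Prop
  | .natLt e f => e.eval s < f.eval s
  | .realLt e f => e.eval s < f.eval s
  | .not b => ¬ b.eval s
  | .and b c => b.eval s ∧ c.eval s

def BExp.cost : BExp → ℕ
  | .natLt e f => e.cost + f.cost + 1
  | .realLt e f => e.cost + f.cost + 1
  | .not b => b.cost + 1
  | .and b c => b.cost + c.cost + 1

/-- Programs; `setNat a i e` and `setReal a i e` assign the value of `e` to cell `i` of array `a`. -/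
inductive Prog where
  | skip
  | setNat (a : ℕ) (i e : NExp)
  | setReal (a : ℕ) (i : NExp) (e : RExp)
  | seq (p q : Prog)
  | cond (b : BExp) (p q : Prog)
  | loop (b : BExp) (p : Prog)

/-- `Exec p s t s'`: started in state `s`, the program `p` halts after exactly `t` steps in
state `s'`. -/
inductive Exec : Prog → State → ℕ → State → Prop
  | skip (s : State) : Exec .skip s 1 s
  | setNat (a : ℕ) (i e : NExp) (s : State) :
      Exec (.setNat a i e) s (i.cost + e.cost + 1) (s.setNat a (i.eval s) (e.eval s))
  | setReal (a : ℕ) (i : NExp) (e : RExp) (s : State) :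
      Exec (.setReal a i e) s (i.cost + e.cost + 1) (s.setReal a (i.eval s) (e.eval s))
  | seq {p q : Prog} {s s' s'' : State} {t u : ℕ} :
      Exec p s t s' → Exec q s' u s'' → Exec (.seq p q) s (t + u) s''
  | condTrue {b : BExp} {p q : Prog} {s s' : State} {t : ℕ} :
      b.eval s → Exec p s t s' → Exec (.cond b p q) s (b.cost + t + 1) s'
  | condFalse {b : BExp} {p q : Prog} {s s' : State} {t : ℕ} :
      ¬ b.eval s → Exec q s t s' → Exec (.cond b p q) s (b.cost + t + 1) s'
  | loopTrue {b : BExp} {p : Prog} {s s' s'' : State} {t u : ℕ} :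
      b.eval s → Exec p s t s' → Exec (.loop b p) s' u s'' →
      Exec (.loop b p) s (b.cost + t + u + 1) s''
  | loopFalse {b : BExp} {p : Prog} {s : State} :
      ¬ b.eval s → Exec (.loop b p) s (b.cost + 1) s

end RealRAM

/-! ### The restricted two-center covering problem for disks -/

namespace TwoCenter

abbrev Plane := EuclideanSpace ℝ (Fin 2)

/-- A closed disk in the plane, given by its center and its radius; radius `0` is permitted. -/
structure Disk where
  center : Plane
  radius : ℝ
  radius_nonneg : 0 ≤ radius

/-- The set of points of a disk. -/
def Disk.carrier (D : Disk) : Set Plane := Metric.closedBall D.center D.radius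

/-- `C₁` and `C₂` are congruent, and each input disk is contained in `C₁` or contained in `C₂`. -/
def IsRestrictedCover {n : ℕ} (D : Fin n → Disk) (C₁ C₂ : Disk) : Prop :=
  C₁.radius = C₂.radius ∧ ∀ i, (D i).carrier ⊆ C₁.carrier ∨ (D i).carrier ⊆ C₂.carrier

/-- A solution of the restricted covering problem whose radius is at most `ρ` times the radius of
any solution (hence at most `ρ` times the optimal radius). -/
def IsApproxRestrictedCover {n : ℕ} (ρ : ℝ) (D : Fin n → Disk) (C₁ C₂ : Disk) : Prop :=
  IsRestrictedCover D C₁ C₂ ∧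
    ∀ C₁' C₂' : Disk, IsRestrictedCover D C₁' C₂' → C₁.radius ≤ ρ * C₁'.radius

open RealRAM

/-- The initial state: `n` is in cell `0` of natural number array `0`, `ε` is in cell `0` of real
array `0`, the two coordinates of the centers and the radii are in the cells `0, …, n - 1` of the
real arrays `1`, `2` and `3`; everything else is `0`. -/
noncomputable def input {n : ℕ} (ε : ℝ) (D : Fin n → Disk) : State where
  nat a i := if a = 0 ∧ i = 0 then n else 0
  real a i :=
    if a = 0 ∧ i = 0 then ε
    else if h : i < n then
      if a = 1 then (D ⟨i, h⟩).center 0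
      else if a = 2 then (D ⟨i, h⟩).center 1
      else if a = 3 then (D ⟨i, h⟩).radius
      else 0
    else 0

/-- The final state `s` holds the answer `C₁`, `C₂` in the cells `0, …, 5` of real array `4`. -/
def IsOutput (s : State) (C₁ C₂ : Disk) : Prop :=
  C₁.center 0 = s.real 4 0 ∧ C₁.center 1 = s.real 4 1 ∧ C₁.radius = s.real 4 2 ∧
  C₂.center 0 = s.real 4 3 ∧ C₂.center 1 = s.real 4 4 ∧ C₂.radius = s.real 4 5

end TwoCenter

/-! ### Total correctness with running time for the real RAM -/

namespace RealRAM

/-! For a direction `u` and a radius `R`, let a split be a cover in which the disks assigned to the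
first circle come strictly before the others in the order of the projections of the centers onto
`u`. Three facts carry the theorem: few directions suffice, one direction can be tested in `O(n
log(1/ε))` steps without sorting, and the tests can be amortised over all directions.

Directions. If the line of the two optimal centers is turned slightly, a disk that thereby changes
sides still fits after a small enlargement of the radius (`wedge`), so `O(1/ε)` directions from a
net suffice (`exists_split_of_net`). For few disks there is an exact choice: only the order of the
projections matters, and it can be realised by the bisector of two differences of centers, which
gives `n ^ 4` directions (`exists_split_of_pairs`).

Test. The ellipsoid method searches for a center whose disk of radius `R` covers a long initial
segment. At each query point the violated disk of smallest projection is found by a linear scan. For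
any coverable initial segment `S`, either that disk belongs to `S` and gives a valid cut, or the
query point already covers all of `S`. Hence a single run that remembers the query point with the
largest violated projection serves all `S` at once (`ellipseStep_runs`, `ellipseRun_runs`). Each cut
multiplies the determinant by `7/9`, while an ellipse containing a disk of radius `ρ` has
determinant at least `ρ ^ 2` (`sq_le_det_of_disk`), so `O(log(1/ε))` cuts are enough when there is
relative slack of order `ε`. A second run with `-u` treats the complement of `S`, and a scan checks
the two centers (`tryDir_runs`).

Amortisation. Starting from a 2-approximation, the current radius is divided by `1 + η` as long as
the current direction allows it; otherwise the next direction is taken. A failure stays valid for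
smaller radii, so the number of tests is at most the number of directions plus the number of
improvements (`pass_runs`). Many disks (`n ^ 8 * ε > 1`) use the net and one pass with `η` of order
`ε`, in time `O((n/ε) log(1/ε))`, where `log(1/ε) = O(log n)`. Few disks use the bisectors and halve
`η` from `1` down to order `ε`, in time `O(n ^ 5 log²(1/ε))`, which is `O(n/ε)` since `n ^ 4 ≤ ε ^
(-1/2)` (`levels_runs`, `time_bound`). -/

open Classical in
/-- The effect of a loop-free program. -/
noncomputable def Prog.eff : Prog → State → State
  | .skip, s => s
  | .setNat a i e, s => s.setNat a (i.eval s) (e.eval s)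
  | .setReal a i e, s => s.setReal a (i.eval s) (e.eval s)
  | .seq p q, s => q.eff (p.eff s)
  | .cond b p q, s => if b.eval s then p.eff s else q.eff s
  | .loop _ _, s => s

/-- An upper bound for the running time of a loop-free program. -/
def Prog.maxCost : Prog → ℕ
  | .skip => 1
  | .setNat _ i e => i.cost + e.cost + 1
  | .setReal _ i e => i.cost + e.cost + 1
  | .seq p q => p.maxCost + q.maxCost
  | .cond b p q => b.cost + (p.maxCost + q.maxCost) + 1
  | .loop _ _ => 0

def Prog.loopFree : Prog → Bool
  | .skip => true
  | .setNat _ _ _ => true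
  | .setReal _ _ _ => true
  | .seq p q => p.loopFree && q.loopFree
  | .cond _ p q => p.loopFree && q.loopFree
  | .loop _ _ => false

/-- The natural number arrays a program may write to. -/
def Prog.natWrites : Prog → List ℕ
  | .skip => []
  | .setNat a _ _ => [a]
  | .setReal _ _ _ => []
  | .seq p q => p.natWrites ++ q.natWrites
  | .cond _ p q => p.natWrites ++ q.natWrites
  | .loop _ p => p.natWrites

/-- The real arrays a program may write to. -/
def Prog.realWrites : Prog → List ℕ
  | .skip => []
  | .setNat _ _ _ => []
  | .setReal a _ _ => [a]
  | .seq p q => p.realWrites ++ q.realWrites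
  | .cond _ p q => p.realWrites ++ q.realWrites
  | .loop _ p => p.realWrites

/-- The states `s` and `s'` agree on all arrays that `p` does not write to. -/
def Frame (p : Prog) (s s' : State) : Prop :=
  (∀ a, a ∉ p.natWrites → s'.nat a = s.nat a) ∧ ∀ a, a ∉ p.realWrites → s'.real a = s.real a

/-- The write sets are syntactic, so for a concrete program non-membership is settled by `decide`.
Specifications therefore mention only the arrays that change, and every other value is carried along
by the frame. -/
theorem Exec.frame {p : Prog} {s s' : State} {t : ℕ} (h : Exec p s t s') : Frame p s s' := by
  induction h with
  | skip s => exact ⟨fun _ _ => rfl, fun _ _ => rfl⟩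
  | setNat a i e s =>
    refine ⟨fun b hb => ?_, fun _ _ => rfl⟩
    funext j
    simp only [Prog.natWrites, List.mem_singleton] at hb
    simp [State.setNat, hb]
  | setReal a i e s =>
    refine ⟨fun _ _ => rfl, fun b hb => ?_⟩
    funext j
    simp only [Prog.realWrites, List.mem_singleton] at hb
    simp [State.setReal, hb]
  | seq _ _ ih₁ ih₂ =>
    constructor
    · intro a ha
      simp only [Prog.natWrites, List.mem_append, not_or] at ha
      rw [ih₂.1 a ha.2, ih₁.1 a ha.1]
    · intro a ha
      simp only [Prog.realWrites, List.mem_append, not_or] at ha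
      rw [ih₂.2 a ha.2, ih₁.2 a ha.1]
  | condTrue _ _ ih =>
    constructor
    · intro a ha
      simp only [Prog.natWrites, List.mem_append, not_or] at ha
      exact ih.1 a ha.1
    · intro a ha
      simp only [Prog.realWrites, List.mem_append, not_or] at ha
      exact ih.2 a ha.1
  | condFalse _ _ ih =>
    constructor
    · intro a ha
      simp only [Prog.natWrites, List.mem_append, not_or] at ha
      exact ih.1 a ha.2
    · intro a ha
      simp only [Prog.realWrites, List.mem_append, not_or] at ha
      exact ih.2 a ha.2
  | loopTrue _ _ _ ih₁ ih₂ =>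
    constructor
    · intro a ha
      rw [ih₂.1 a ha, ih₁.1 a ha]
    · intro a ha
      rw [ih₂.2 a ha, ih₁.2 a ha]
  | loopFalse _ => exact ⟨fun _ _ => rfl, fun _ _ => rfl⟩

/-- Started in `s`, the program `p` halts within `T` steps in a state satisfying `Q`. -/
def Runs (p : Prog) (s : State) (T : ℕ) (Q : State → Prop) : Prop :=
  ∃ t s', Exec p s t s' ∧ t ≤ T ∧ Q s'

theorem Runs.mono {p : Prog} {s : State} {T T' : ℕ} {Q Q' : State → Prop} (h : Runs p s T Q)
    (hT : T ≤ T') (hQ : ∀ s', Frame p s s' → Q s' → Q' s') : Runs p s T' Q' := by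
  obtain ⟨t, s', he, ht, hq⟩ := h
  exact ⟨t, s', he, ht.trans hT, hQ s' he.frame hq⟩

theorem Runs.seq {p q : Prog} {s : State} {T U : ℕ} {Q R : State → Prop} (h : Runs p s T Q)
    (h' : ∀ s', Frame p s s' → Q s' → Runs q s' U R) : Runs (.seq p q) s (T + U) R := by
  obtain ⟨t, s', he, ht, hq⟩ := h
  obtain ⟨u, s'', he', hu, hr⟩ := h' s' he.frame hq
  exact ⟨t + u, s'', .seq he he', by omega, hr⟩

theorem exec_eff {p : Prog} (hp : p.loopFree = true) (s : State) :
    ∃ t ≤ p.maxCost, Exec p s t (p.eff s) := by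
  induction p generalizing s with
  | skip => exact ⟨1, le_rfl, .skip s⟩
  | setNat a i e => exact ⟨_, le_rfl, .setNat a i e s⟩
  | setReal a i e => exact ⟨_, le_rfl, .setReal a i e s⟩
  | seq p q ihp ihq =>
    simp only [Prog.loopFree, Bool.and_eq_true] at hp
    obtain ⟨t, ht, h⟩ := ihp hp.1 s
    obtain ⟨u, hu, h'⟩ := ihq hp.2 (p.eff s)
    exact ⟨t + u, by simp only [Prog.maxCost]; omega, .seq h h'⟩
  | cond b p q ihp ihq =>
    simp only [Prog.loopFree, Bool.and_eq_true] at hp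
    by_cases hb : b.eval s
    · obtain ⟨t, ht, h⟩ := ihp hp.1 s
      refine ⟨b.cost + t + 1, by simp only [Prog.maxCost]; omega, ?_⟩
      simp only [Prog.eff, hb, if_true]
      exact .condTrue hb h
    · obtain ⟨t, ht, h⟩ := ihq hp.2 s
      refine ⟨b.cost + t + 1, by simp only [Prog.maxCost]; omega, ?_⟩
      simp only [Prog.eff, hb, if_false]
      exact .condFalse hb h
  | loop b p => simp [Prog.loopFree] at hp

theorem Runs.straight {p : Prog} (hp : p.loopFree = true) {s : State} {Q : State → Prop}
    (hQ : Q (p.eff s)) : Runs p s p.maxCost Q := by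
  obtain ⟨t, ht, h⟩ := exec_eff hp s
  exact ⟨t, _, h, ht, hQ⟩

theorem Runs.cond {b : BExp} {p q : Prog} {s : State} {T U : ℕ} {Q : State → Prop}
    (hp : b.eval s → Runs p s T Q) (hq : ¬ b.eval s → Runs q s U Q) :
    Runs (.cond b p q) s (b.cost + (T + U) + 1) Q := by
  by_cases hb : b.eval s
  · obtain ⟨t, s', he, ht, h⟩ := hp hb
    exact ⟨_, s', .condTrue hb he, by omega, h⟩
  · obtain ⟨t, s', he, ht, h⟩ := hq hb
    exact ⟨_, s', .condFalse hb he, by omega, h⟩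

theorem Frame.refl (p : Prog) (s : State) : Frame p s s := ⟨fun _ _ => rfl, fun _ _ => rfl⟩

theorem Frame.trans {p : Prog} {s s' s'' : State} (h : Frame p s s') (h' : Frame p s' s'') :
    Frame p s s'' :=
  ⟨fun a ha => (h'.1 a ha).trans (h.1 a ha), fun a ha => (h'.2 a ha).trans (h.2 a ha)⟩

/-- A loop terminates if `I m` bounds the number of remaining iterations by `m`. -/
theorem Runs.loop {b : BExp} {p : Prog} {B : ℕ} {Q : State → Prop} {s₀ : State}
    (I : ℕ → State → Prop) (m : ℕ) (h₀ : I m s₀)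
    (hstep : ∀ m s, Frame p s₀ s → I m s → b.eval s → ∃ m', m = m' + 1 ∧ Runs p s B (I m'))
    (hend : ∀ m s, Frame p s₀ s → I m s → ¬ b.eval s → Q s) :
    Runs (.loop b p) s₀ ((m + 1) * (B + b.cost + 1)) Q := by
  suffices H : ∀ m s, Frame p s₀ s → I m s →
      Runs (.loop b p) s ((m + 1) * (B + b.cost + 1)) Q from H m s₀ (.refl _ _) h₀
  clear h₀ m
  intro m
  induction m with
  | zero =>
    intro s hF h
    by_cases hb : b.eval s
    · obtain ⟨m', hm, -⟩ := hstep 0 s hF h hb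
      omega
    · exact ⟨_, s, .loopFalse hb, by omega, hend 0 s hF h hb⟩
  | succ m ih =>
    intro s hF h
    by_cases hb : b.eval s
    · obtain ⟨m', hm, t, s', he, ht, hI⟩ := hstep _ s hF h hb
      obtain rfl : m = m' := by omega
      obtain ⟨u, s'', he', hu, hq⟩ := ih s' (hF.trans he.frame) hI
      refine ⟨_, s'', .loopTrue hb he he', ?_, hq⟩
      rw [add_one_mul (m + 1)]
      omega
    · refine ⟨_, s, .loopFalse hb, ?_, hend _ s hF h hb⟩
      rw [add_one_mul]
      omega

@[simp] theorem setNat_nat (s : State) (a i v a' i' : ℕ) :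
    (s.setNat a i v).nat a' i' = if a' = a ∧ i' = i then v else s.nat a' i' := rfl

@[simp] theorem setNat_real (s : State) (a i v : ℕ) : (s.setNat a i v).real = s.real := rfl

@[simp] theorem setReal_real (s : State) (a i : ℕ) (v : ℝ) (a' i' : ℕ) :
    (s.setReal a i v).real a' i' = if a' = a ∧ i' = i then v else s.real a' i' := rfl

@[simp] theorem setReal_nat (s : State) (a i : ℕ) (v : ℝ) : (s.setReal a i v).nat = s.nat := rfl

infixr:60 ";;" => Prog.seq

/-- Cell `0` of a natural number array, used as a variable. -/
abbrev nv (a : ℕ) : NExp := .cell a (.lit 0)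

/-- Cell `0` of a real array, used as a variable. -/
abbrev rv (a : ℕ) : RExp := .cell a (.lit 0)

/-- The cell of the real array `a` whose index is the natural number variable `i`. -/
abbrev ra (a i : ℕ) : RExp := .cell a (nv i)

abbrev setN (a : ℕ) (e : NExp) : Prog := .setNat a (.lit 0) e

abbrev setR (a : ℕ) (e : RExp) : Prog := .setReal a (.lit 0) e

abbrev incr (a : ℕ) : Prog := setN a (.add (nv a) (.lit 1))

/-- Execute `p` while the counter in the array `a` is below the variable in the array `b`. -/
abbrev forLoop (a b : ℕ) (p : Prog) : Prog := .loop (.natLt (nv a) (nv b)) p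

/-- The remaining-iteration count of `Runs.loop` is `n - i`. The overhead `6` per round is the cost
`5` of the guard plus one step for the branching. -/
theorem Runs.forLoop {a b : ℕ} {p : Prog} {B n : ℕ} {s₀ : State} (J : ℕ → State → Prop)
    (ha : s₀.nat a 0 = 0) (hb : s₀.nat b 0 = n) (hp : b ∉ p.natWrites) (h₀ : J 0 s₀)
    (hstep : ∀ i s, Frame p s₀ s → i < n → s.nat a 0 = i → J i s →
      Runs p s B fun s' => s'.nat a 0 = i + 1 ∧ J (i + 1) s') :
    Runs (forLoop a b p) s₀ ((n + 1) * (B + 6)) (J n) := by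
  refine (Runs.loop (B := B) (Q := J n) (fun m s => ∃ i, i + m = n ∧ s.nat a 0 = i ∧ J i s) n
    ⟨0, by omega, ha, h₀⟩ ?_ ?_).mono le_rfl fun _ _ h => h
  · rintro m s hF ⟨i, him, hai, hJ⟩ hlt
    have hbs : s.nat b 0 = n := by rw [hF.1 b hp, hb]
    simp only [BExp.eval, NExp.eval, hai, hbs] at hlt
    obtain ⟨m', rfl⟩ : ∃ m', m = m' + 1 := ⟨m - 1, by omega⟩
    refine ⟨m', rfl, (hstep i s hF hlt hai hJ).mono le_rfl ?_⟩
    rintro s' - ⟨h1, h2⟩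
    exact ⟨i + 1, by omega, h1, h2⟩
  · rintro m s hF ⟨i, him, hai, hJ⟩ hlt
    have hbs : s.nat b 0 = n := by rw [hF.1 b hp, hb]
    simp only [BExp.eval, NExp.eval, hai, hbs] at hlt
    obtain rfl : i = n := by omega
    exact hJ

end RealRAM

namespace TwoCenter

/-! ### Euclidean distance in coordinates -/

/-- The point with the given coordinates. -/
noncomputable def pt (x y : ℝ) : Plane := !₂[x, y]

/-- The Euclidean distance of two points given by their coordinates. -/
noncomputable def dd (x y x' y' : ℝ) : ℝ :=
  Real.sqrt ((x - x') * (x - x') + (y - y') * (y - y'))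

theorem dd_eq_dist (x y x' y' : ℝ) : dd x y x' y' = dist (pt x y) (pt x' y') := by
  simp [dd, pt, EuclideanSpace.dist_eq, Real.dist_eq, pow_two]

theorem dd_eq_norm (x y x' y' : ℝ) : dd x y x' y' = ‖pt x y - pt x' y'‖ := by
  rw [dd_eq_dist, dist_eq_norm]

theorem dd_nonneg (x y x' y' : ℝ) : 0 ≤ dd x y x' y' := Real.sqrt_nonneg _

theorem dd_self (x y : ℝ) : dd x y x y = 0 := by simp [dd]

theorem dd_comm (x y x' y' : ℝ) : dd x y x' y' = dd x' y' x y := by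
  rw [dd_eq_dist, dd_eq_dist, dist_comm]

theorem dd_triangle (x y x' y' x'' y'' : ℝ) :
    dd x y x'' y'' ≤ dd x y x' y' + dd x' y' x'' y'' := by
  simp only [dd_eq_dist]
  exact dist_triangle _ _ _

theorem dd_sq (x y x' y' : ℝ) : dd x y x' y' ^ 2 = (x - x') ^ 2 + (y - y') ^ 2 := by
  rw [dd, Real.sq_sqrt (by nlinarith [sq_nonneg (x - x'), sq_nonneg (y - y')])]
  ring

theorem inner_pt (x y x' y' : ℝ) : inner ℝ (pt x y) (pt x' y') = x * x' + y * y' := by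
  simp [pt, PiLp.inner_apply]
  ring

/-! ### Covers and splits in coordinates -/

/-- Every disk, given by the coordinates of the center and the radius, is contained in one of the
disks of radius `R` with centers `(x₁, y₁)` and `(x₂, y₂)`. -/
def Cover (n : ℕ) (cx cy r : ℕ → ℝ) (x₁ y₁ x₂ y₂ R : ℝ) : Prop :=
  ∀ i < n, dd x₁ y₁ (cx i) (cy i) + r i ≤ R ∨ dd x₂ y₂ (cx i) (cy i) + r i ≤ R

/-- The disks are covered by two disks of radius `R` in such a way that the centers are separated
by a line orthogonal to `(ux, uy)`. -/
def Split (n : ℕ) (cx cy r : ℕ → ℝ) (ux uy R : ℝ) : Prop :=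
  ∃ (S : ℕ → Prop) (x₁ y₁ x₂ y₂ : ℝ),
    (∀ i < n, ∀ j < n, S i → ¬ S j → ux * cx i + uy * cy i < ux * cx j + uy * cy j) ∧
    (∀ i < n, S i → dd x₁ y₁ (cx i) (cy i) + r i ≤ R) ∧
    ∀ i < n, ¬ S i → dd x₂ y₂ (cx i) (cy i) + r i ≤ R

/-- If a point on the `p₁`-side of a slightly rotated bisector of `p₁` and `p₂` belongs to
one of the two disks, then it belongs to the slightly enlarged disk around `p₁`. -/
theorem wedge {E : Type*} [NormedAddCommGroup E] [InnerProductSpace ℝ E] (p₁ p₂ x u v : E)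
    (l h R r : ℝ) (hl : 0 ≤ l) (hp : p₂ - p₁ = l • u) (hu : 1 ≤ ‖u‖) (hv : ‖v - u‖ ≤ h)
    (hh : h ≤ 1 / 3) (hr : 0 ≤ r) (hc : ‖p₁ - x‖ + r ≤ R ∨ ‖p₂ - x‖ + r ≤ R)
    (hx : inner ℝ (x - (1 / 2 : ℝ) • (p₁ + p₂)) v ≤ 0) : ‖p₁ - x‖ + r ≤ (1 + 6 * h) * R := by
  have hh0 : 0 ≤ h := (norm_nonneg _).trans hv
  have hR : 0 ≤ R := by
    rcases hc with hc | hc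
    · linarith [norm_nonneg (p₁ - x)]
    · linarith [norm_nonneg (p₂ - x)]
  have hRh : 0 ≤ h * R := mul_nonneg hh0 hR
  by_cases hc1 : ‖p₁ - x‖ + r ≤ R
  · linarith
  have hc2 : ‖p₂ - x‖ + r ≤ R := by tauto
  have hlt : ‖p₂ - x‖ < ‖p₁ - x‖ := by linarith
  set X := x - (1 / 2 : ℝ) • (p₁ + p₂) with hX
  have e1 : p₁ - x = -(X + (1 / 2 : ℝ) • (l • u)) := by rw [← hp, hX]; module
  have e2 : p₂ - x = -(X - (1 / 2 : ℝ) • (l • u)) := by rw [← hp, hX]; module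
  clear_value X
  -- Polarisation about the midpoint: the difference of the squared distances is linear in `X`, so
  -- only the small component of `u` that `v` misses can make `p₁` the farther center.
  have hdiff : ‖p₁ - x‖ ^ 2 - ‖p₂ - x‖ ^ 2 = 2 * l * inner ℝ X u := by
    rw [e1, e2, norm_neg, norm_neg, norm_add_sq_real, norm_sub_sq_real, inner_smul_right,
      inner_smul_right]
    ring
  have hin : inner ℝ X u ≤ ‖X‖ * h := by
    have h1 : inner ℝ X u = inner ℝ X v + inner ℝ X (u - v) := by rw [← inner_add_right]; simp
    have h2 := real_inner_le_norm X (u - v)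
    rw [norm_sub_rev u v] at h2
    have h3 := mul_le_mul_of_nonneg_left hv (norm_nonneg X)
    linarith
  have hd : ‖p₂ - p₁‖ = l * ‖u‖ := by rw [hp, norm_smul, Real.norm_of_nonneg hl]
  have hdtri : l * ‖u‖ ≤ ‖p₁ - x‖ + ‖p₂ - x‖ := by
    rw [← hd]
    have : p₂ - p₁ = (p₂ - x) - (p₁ - x) := by abel
    rw [this]
    linarith [norm_sub_le (p₂ - x) (p₁ - x)]
  have hlu : l ≤ l * ‖u‖ := le_mul_of_one_le_right hl hu
  -- If the centers are at most `4 * R` apart, then `X` has norm at most `3 * R`; dividing the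
  -- difference of squares by the sum of the distances, which is at least `l`, leaves `6 * h * R`.
  -- If they are farther apart, a point of the disk around `p₂` lies strictly on the `p₂`-side even
  -- of the rotated bisector.
  rcases le_or_gt (l * ‖u‖) (4 * R) with hd4 | hd4
  · have hXn : ‖X‖ ≤ 3 * R := by
      have : X = -(p₂ - x) + (1 / 2 : ℝ) • (l • u) := by rw [e2]; abel
      rw [this]
      refine (norm_add_le _ _).trans ?_
      rw [norm_neg, norm_smul, ← hp, hd]
      norm_num
      linarith
    have hpos : 0 < ‖p₁ - x‖ + ‖p₂ - x‖ := by linarith [norm_nonneg (p₂ - x)]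
    have h1 : (‖p₁ - x‖ - ‖p₂ - x‖) * (‖p₁ - x‖ + ‖p₂ - x‖) ≤
        (6 * h * R) * (‖p₁ - x‖ + ‖p₂ - x‖) := by
      calc (‖p₁ - x‖ - ‖p₂ - x‖) * (‖p₁ - x‖ + ‖p₂ - x‖) = 2 * l * inner ℝ X u := by
            rw [← hdiff]; ring
        _ ≤ 2 * l * (3 * R * h) := by
            refine mul_le_mul_of_nonneg_left (hin.trans ?_) (by linarith)
            exact mul_le_mul_of_nonneg_right hXn hh0
        _ = (6 * h * R) * l := by ring
        _ ≤ _ := mul_le_mul_of_nonneg_left (hlu.trans hdtri) (by nlinarith)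
    have h2 := le_of_mul_le_mul_right h1 hpos
    linarith
  -- Here the product of `X` with `v` exceeds `R * (‖u‖ - 3 * h)`, which is nonnegative because `h ≤
  -- 1 / 3` and `‖u‖ ≥ 1`.
  · exfalso
    have hXe : X = -(p₂ - x) + (1 / 2 : ℝ) • (l • u) := by rw [e2]; abel
    have h1 : inner ℝ X v = inner ℝ (-(p₂ - x)) v + 1 / 2 * (l * inner ℝ u v) := by
      rw [hXe, inner_add_left, inner_smul_left, inner_smul_left]
      simp
    have h2 : -(‖p₂ - x‖ * ‖v‖) ≤ inner ℝ (-(p₂ - x)) v := by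
      rw [inner_neg_left]
      linarith [real_inner_le_norm (p₂ - x) v]
    have h3 : ‖v‖ ≤ ‖u‖ + h := by
      have : v = u + (v - u) := by abel
      rw [this]
      linarith [norm_add_le u (v - u)]
    have h4 : ‖u‖ * (‖u‖ - h) ≤ inner ℝ u v := by
      have e : inner ℝ u v = inner ℝ u u + inner ℝ u (v - u) := by rw [← inner_add_right]; simp
      have h5 := real_inner_le_norm (-u) (v - u)
      rw [inner_neg_left, norm_neg] at h5
      have h6 := mul_le_mul_of_nonneg_left hv (norm_nonneg u)
      rw [e, real_inner_self_eq_norm_sq]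
      nlinarith
    have h5 : ‖p₂ - x‖ * ‖v‖ ≤ R * (‖u‖ + h) :=
      mul_le_mul (by linarith) h3 (norm_nonneg _) hR
    have h6 := mul_le_mul_of_nonneg_left h4 hl
    have h7 : 0 < ‖u‖ - h := by linarith
    nlinarith [mul_pos (sub_pos.2 hd4) h7]

theorem wedge_coord (x₁ y₁ x₂ y₂ x y ux uy vx vy l h R r : ℝ) (hl : 0 ≤ l)
    (hpx : x₂ - x₁ = l * ux) (hpy : y₂ - y₁ = l * uy) (hu : 1 ≤ ux ^ 2 + uy ^ 2)
    (hv : (vx - ux) ^ 2 + (vy - uy) ^ 2 ≤ h ^ 2) (hh0 : 0 ≤ h)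
    (hh : h ≤ 1 / 3) (hr : 0 ≤ r) (hc : dd x₁ y₁ x y + r ≤ R ∨ dd x₂ y₂ x y + r ≤ R)
    (hx : (x - (x₁ + x₂) / 2) * vx + (y - (y₁ + y₂) / 2) * vy ≤ 0) :
    dd x₁ y₁ x y + r ≤ (1 + 6 * h) * R := by
  have hpt : ∀ a b c d : ℝ, pt a b - pt c d = pt (a - c) (b - d) := by
    intro a b c d
    ext i
    fin_cases i <;> simp [pt]
  have hn : ∀ a b : ℝ, ‖pt a b‖ = Real.sqrt (a ^ 2 + b ^ 2) := by
    intro a b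
    simp [pt, EuclideanSpace.norm_eq]
  rw [dd_eq_norm] at hc ⊢
  rw [dd_eq_norm] at hc
  refine wedge (pt x₁ y₁) (pt x₂ y₂) (pt x y) (pt ux uy) (pt vx vy) l h R r hl ?_ ?_ ?_ hh hr hc ?_
  · rw [hpt, hpx, hpy]
    ext i
    fin_cases i <;> simp [pt]
  · rw [hn]
    exact Real.one_le_sqrt.2 hu
  · rw [hpt, hn]
    exact Real.sqrt_le_iff.2 ⟨hh0, hv⟩
  · have : pt x y - (1 / 2 : ℝ) • (pt x₁ y₁ + pt x₂ y₂) =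
        pt (x - (x₁ + x₂) / 2) (y - (y₁ + y₂) / 2) := by
      ext i
      fin_cases i <;> simp [pt] <;> ring
    rw [this, inner_pt]
    exact hx

/-- The disks are divided by the line through the midpoint of the two centers orthogonal to the
perturbed direction. The wedge estimate applies to each side, the second time with centers and
directions reversed. -/
theorem split_of_close (n : ℕ) (cx cy r : ℕ → ℝ) (hr : ∀ i < n, 0 ≤ r i)
    (x₁ y₁ x₂ y₂ R ux uy vx vy l h : ℝ) (hcov : Cover n cx cy r x₁ y₁ x₂ y₂ R) (hl : 0 ≤ l)
    (hpx : x₂ - x₁ = l * ux) (hpy : y₂ - y₁ = l * uy) (hu : 1 ≤ ux ^ 2 + uy ^ 2)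
    (hv : (vx - ux) ^ 2 + (vy - uy) ^ 2 ≤ h ^ 2) (hh0 : 0 ≤ h) (hh : h ≤ 1 / 3) :
    Split n cx cy r vx vy ((1 + 6 * h) * R) := by
  refine ⟨fun i => (cx i - (x₁ + x₂) / 2) * vx + (cy i - (y₁ + y₂) / 2) * vy ≤ 0,
    x₁, y₁, x₂, y₂, ?_, ?_, ?_⟩
  · intro i _ j _ hi hj
    simp only [not_le] at hj
    nlinarith
  · intro i hi hS
    exact wedge_coord x₁ y₁ x₂ y₂ _ _ ux uy vx vy l h R _ hl hpx hpy hu hv hh0 hh (hr i hi)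
      (hcov i hi) hS
  · intro i hi hS
    refine wedge_coord x₂ y₂ x₁ y₁ _ _ (-ux) (-uy) (-vx) (-vy) l h R _ hl (by linarith)
      (by linarith) (by linarith) (by linarith) hh0 hh (hr i hi) (hcov i hi).symm ?_
    simp only [not_le] at hS
    nlinarith

theorem Cover.symm {n : ℕ} {cx cy r : ℕ → ℝ} {x₁ y₁ x₂ y₂ R : ℝ}
    (h : Cover n cx cy r x₁ y₁ x₂ y₂ R) : Cover n cx cy r x₂ y₂ x₁ y₁ R :=
  fun i hi => (h i hi).symm

/-- The directions `(1, s)` and `(s, 1)`, with `s` in an `h`-net of `[-1, 1]`, are good. -/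
theorem exists_split_of_net (n : ℕ) (cx cy r : ℕ → ℝ) (hr : ∀ i < n, 0 ≤ r i)
    (x₁ y₁ x₂ y₂ R h : ℝ) (hcov : Cover n cx cy r x₁ y₁ x₂ y₂ R) (hh0 : 0 ≤ h) (hh : h ≤ 1 / 3)
    (net : Set ℝ) (hnet : ∀ s : ℝ, -1 ≤ s → s ≤ 1 → ∃ s' ∈ net, |s' - s| ≤ h) :
    ∃ s ∈ net, Split n cx cy r 1 s ((1 + 6 * h) * R) ∨ Split n cx cy r s 1 ((1 + 6 * h) * R) := by
  -- Exchanging the two covering disks makes the dominant coordinate of the difference of their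
  -- centers nonnegative, so that the difference is a nonnegative multiple of `(1, s)` or `(s, 1)`
  -- with `|s| ≤ 1`.
  wlog hpos : (|y₂ - y₁| ≤ |x₂ - x₁| ∧ 0 ≤ x₂ - x₁) ∨ (|x₂ - x₁| ≤ |y₂ - y₁| ∧ 0 ≤ y₂ - y₁)
    generalizing x₁ y₁ x₂ y₂
  · refine this x₂ y₂ x₁ y₁ hcov.symm ?_
    rw [abs_sub_comm y₁, abs_sub_comm x₁]
    rcases le_total |y₂ - y₁| |x₂ - x₁| with h1 | h1
    · left
      refine ⟨h1, ?_⟩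
      by_contra h2
      exact hpos (Or.inl ⟨h1, by linarith⟩)
    · right
      refine ⟨h1, ?_⟩
      by_contra h2
      exact hpos (Or.inr ⟨h1, by linarith⟩)
  have key : ∀ a b : ℝ, |b| ≤ |a| → 0 ≤ a → ∃ s, -1 ≤ s ∧ s ≤ 1 ∧ b = a * s := by
    intro a b hab ha
    rw [abs_of_nonneg ha] at hab
    obtain ⟨h1, h2⟩ := abs_le.1 hab
    rcases ha.eq_or_lt with rfl | ha
    · exact ⟨0, by norm_num, by norm_num, by linarith⟩
    · exact ⟨b / a, by rw [le_div_iff₀ ha]; linarith, by rw [div_le_iff₀ ha]; linarith,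
        by field_simp⟩
  rcases hpos with ⟨h1, h2⟩ | ⟨h1, h2⟩
  · obtain ⟨s, hs1, hs2, hs⟩ := key _ _ h1 h2
    obtain ⟨s', hs', hd⟩ := hnet s hs1 hs2
    refine ⟨s', hs', Or.inl ?_⟩
    refine split_of_close n cx cy r hr x₁ y₁ x₂ y₂ R 1 s 1 s' (x₂ - x₁) h hcov h2 (by ring) hs
      (by nlinarith) ?_ hh0 hh
    have := sq_le_sq' (abs_le.1 hd).1 (abs_le.1 hd).2
    linarith
  · obtain ⟨s, hs1, hs2, hs⟩ := key _ _ h1 h2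
    obtain ⟨s', hs', hd⟩ := hnet s hs1 hs2
    refine ⟨s', hs', Or.inr ?_⟩
    refine split_of_close n cx cy r hr x₁ y₁ x₂ y₂ R s 1 s' 1 (y₂ - y₁) h hcov h2 hs (by ring)
      (by nlinarith) ?_ hh0 hh
    have := sq_le_sq' (abs_le.1 hd).1 (abs_le.1 hd).2
    linarith

/-! ### Directions for small families -/

/-- A finite family of vectors in an open half plane has positive scalar product with the bisector
of the angle that it spans. -/
theorem exists_bisector {ι : Type*} (V : Finset ι) (vx vy : ι → ℝ) (ux uy : ℝ)
    (hV : ∀ v ∈ V, 0 < ux * vx v + uy * vy v) (hne : V.Nonempty) :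
    ∃ a ∈ V, ∃ b ∈ V, ∀ v ∈ V,
      0 < (dd 0 0 (vx b) (vy b) * vx a + dd 0 0 (vx a) (vy a) * vx b) * vx v +
          (dd 0 0 (vx b) (vy b) * vy a + dd 0 0 (vx a) (vy a) * vy b) * vy v := by
  -- The quotient is the tangent of the angle measured from `u`, so `a` and `b` are the two extreme
  -- vectors of the family.
  obtain ⟨a, ha, hamin⟩ := V.exists_min_image
    (fun v => (ux * vy v - uy * vx v) / (ux * vx v + uy * vy v)) hne
  obtain ⟨b, hb, hbmax⟩ := V.exists_max_image
    (fun v => (ux * vy v - uy * vx v) / (ux * vx v + uy * vy v)) hne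
  refine ⟨a, ha, b, hb, fun v hv => ?_⟩
  have hpa := hV a ha
  have hpb := hV b hb
  have hpv := hV v hv
  have h1 := hamin v hv
  have h2 := hbmax v hv
  simp only [div_le_div_iff₀ hpa hpv, div_le_div_iff₀ hpv hpb] at h1 h2
  have hu : 0 < ux ^ 2 + uy ^ 2 := by
    by_contra h
    have hx : ux = 0 := by nlinarith [sq_nonneg ux, sq_nonneg uy]
    have hy : uy = 0 := by nlinarith [sq_nonneg ux, sq_nonneg uy]
    simp [hx, hy] at hpa
  -- `cross a v ≥ 0` and `cross v b ≥ 0`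
  have c1 : 0 ≤ vx a * vy v - vy a * vx v := by
    have : (ux ^ 2 + uy ^ 2) * (vx a * vy v - vy a * vx v) =
      (ux * vy v - uy * vx v) * (ux * vx a + uy * vy a) -
      (ux * vy a - uy * vx a) * (ux * vx v + uy * vy v) := by ring
    by_contra hc
    linarith [mul_pos hu (neg_pos.2 (not_le.1 hc))]
  have c2 : 0 ≤ vx v * vy b - vy v * vx b := by
    have : (ux ^ 2 + uy ^ 2) * (vx v * vy b - vy v * vx b) =
      (ux * vy b - uy * vx b) * (ux * vx v + uy * vy v) -
      (ux * vy v - uy * vx v) * (ux * vx b + uy * vy b) := by ring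
    by_contra hc
    linarith [mul_pos hu (neg_pos.2 (not_le.1 hc))]
  set A := dd 0 0 (vx a) (vy a) with hA
  set B := dd 0 0 (vx b) (vy b) with hB
  have hA2 : A ^ 2 = vx a ^ 2 + vy a ^ 2 := by rw [hA, dd_sq]; ring
  have hB2 : B ^ 2 = vx b ^ 2 + vy b ^ 2 := by rw [hB, dd_sq]; ring
  have hA0 : 0 < A := by
    refine lt_of_le_of_ne (dd_nonneg _ _ _ _) fun h => ?_
    rw [← h] at hA2
    have hx : vx a = 0 := by nlinarith [sq_nonneg (vx a), sq_nonneg (vy a)]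
    have hy : vy a = 0 := by nlinarith [sq_nonneg (vx a), sq_nonneg (vy a)]
    simp [hx, hy] at hpa
  have hB0 : 0 < B := by
    refine lt_of_le_of_ne (dd_nonneg _ _ _ _) fun h => ?_
    rw [← h] at hB2
    have hx : vx b = 0 := by nlinarith [sq_nonneg (vx b), sq_nonneg (vy b)]
    have hy : vy b = 0 := by nlinarith [sq_nonneg (vx b), sq_nonneg (vy b)]
    simp [hx, hy] at hpb
  set P := vx a * vx b + vy a * vy b with hP
  set C := vx a * vy b - vy a * vx b with hC
  have hAB : (A * B) ^ 2 = P ^ 2 + C ^ 2 := by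
    rw [mul_pow, hA2, hB2, hP, hC]; ring
  -- `A * B + P` is positive unless `a` and `b` are opposite
  have hABpos := mul_pos hA0 hB0
  have hPle : -P ≤ A * B := by
    refine le_of_sq_le_sq ?_ hABpos.le
    rw [hAB, neg_sq]
    linarith [sq_nonneg C]
  have hpos : 0 < A * B + P := by
    refine lt_of_le_of_ne (by linarith) fun h => ?_
    have hPe : P = -(A * B) := by linarith
    have hC0 : C = 0 := by
      rw [hPe, neg_sq] at hAB
      exact pow_eq_zero_iff two_ne_zero |>.1 (by linarith)
    have hPneg : P < 0 := by linarith
    have e : (ux * vx a + uy * vy a) * B ^ 2 = (ux * vx b + uy * vy b) * P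
        + C * (ux * vy b - uy * vx b) := by
      rw [hB2, hP, hC]; ring
    rw [hC0] at e
    linarith [mul_pos hpa (pow_pos hB0 2), mul_pos hpb (neg_pos.2 hPneg)]
  -- the bisector
  set wx := B * vx a + A * vx b with hwx
  set wy := B * vy a + A * vy b with hwy
  have hwa : wx * vx a + wy * vy a = A * (A * B + P) := by
    rw [hwx, hwy, hP]; linear_combination (-B) * hA2
  have hwb : wx * vx b + wy * vy b = B * (A * B + P) := by
    rw [hwx, hwy, hP]; linear_combination (-A) * hB2
  rcases (show 0 ≤ C by
    have e : (ux * vx v + uy * vy v) * C = (ux * vx a + uy * vy a) * (vx v * vy b - vy v * vx b)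
      + (ux * vx b + uy * vy b) * (vx a * vy v - vy a * vx v) := by rw [hC]; ring
    by_contra hc
    linarith [mul_pos hpv (neg_pos.2 (not_le.1 hc)), mul_nonneg hpa.le c2,
      mul_nonneg hpb.le c1]).eq_or_lt with hC0 | hC0
  · -- `a`, `b`, `v` are parallel
    have e : (ux * vx v + uy * vy v) * C = (ux * vx a + uy * vy a) * (vx v * vy b - vy v * vx b)
      + (ux * vx b + uy * vy b) * (vx a * vy v - vy a * vx v) := by rw [hC]; ring
    have hv0 : vx a * vy v - vy a * vx v = 0 := by
      rw [← hC0] at e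
      have := mul_nonneg hpa.le c2
      have h3 := mul_nonneg hpb.le c1
      have h4 : (ux * vx b + uy * vy b) * (vx a * vy v - vy a * vx v) = 0 := by linarith
      rcases mul_eq_zero.1 h4 with h | h
      · linarith
      · exact h
    have e2 : (ux * vx a + uy * vy a) * (wx * vx v + wy * vy v) =
        (ux * vx v + uy * vy v) * (wx * vx a + wy * vy a)
        + (vx a * vy v - vy a * vx v) * (ux * wy - uy * wx) := by ring
    rw [hv0, hwa, zero_mul, add_zero] at e2
    have : 0 < (ux * vx a + uy * vy a) * (wx * vx v + wy * vy v) := by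
      rw [e2]; exact mul_pos hpv (mul_pos hA0 hpos)
    exact pos_of_mul_pos_right this hpa.le
  -- With `C` the cross product of `a` and `b`, the vector `C * v` is a combination of `a` and `b`
  -- with coefficients `cross v b` and `cross a v`, which are nonnegative and not both zero. The
  -- bisector has positive product with both `a` and `b`.
  · have e : C * (wx * vx v + wy * vy v) = (vx v * vy b - vy v * vx b) * (wx * vx a + wy * vy a)
        + (vx a * vy v - vy a * vx v) * (wx * vx b + wy * vy b) := by rw [hC]; ring
    rw [hwa, hwb] at e
    have h3 : 0 < (vx v * vy b - vy v * vx b) + (vx a * vy v - vy a * vx v) := by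
      rcases c1.eq_or_lt with h | h
      · rcases c2.eq_or_lt with h' | h'
        · exfalso
          have e : (ux * vx v + uy * vy v) * C =
            (ux * vx a + uy * vy a) * (vx v * vy b - vy v * vx b)
            + (ux * vx b + uy * vy b) * (vx a * vy v - vy a * vx v) := by rw [hC]; ring
          rw [← h, ← h', mul_zero, mul_zero, add_zero] at e
          exact (mul_pos hpv hC0).ne' e
        · linarith
      · linarith
    have h4 : 0 < C * (wx * vx v + wy * vy v) := by
      rw [e]
      rcases c1.eq_or_lt with h | h
      · rw [← h] at h3 ⊢
        have := mul_pos (show 0 < vx v * vy b - vy v * vx b by linarith)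
          (mul_pos hA0 hpos)
        linarith
      · have h5 := mul_pos h (mul_pos hB0 hpos)
        have h6 := mul_nonneg c2 (mul_pos hA0 hpos).le
        linarith
    exact pos_of_mul_pos_right h4 hC0.le

/-- The bisectors of pairs of differences of centers are good directions. -/
theorem exists_split_of_pairs (n : ℕ) (hn : 1 ≤ n) (cx cy r : ℕ → ℝ) (x₁ y₁ x₂ y₂ R : ℝ)
    (hcov : Cover n cx cy r x₁ y₁ x₂ y₂ R) :
    ∃ i < n, ∃ j < n, ∃ k < n, ∃ l < n,
      Split n cx cy r
        (dd (cx k) (cy k) (cx l) (cy l) * (cx i - cx j) +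
          dd (cx i) (cy i) (cx j) (cy j) * (cx k - cx l))
        (dd (cx k) (cy k) (cx l) (cy l) * (cy i - cy j) +
          dd (cx i) (cy i) (cx j) (cy j) * (cy k - cy l)) R := by
  classical
  set ux := x₂ - x₁
  set uy := y₂ - y₁
  -- A direction `w` that orders strictly every pair of centers ordered strictly by `u` inherits the
  -- split at the perpendicular bisector of the two covering centers.
  have main : ∀ wx wy : ℝ, (∀ i < n, ∀ j < n, 0 < ux * (cx i - cx j) + uy * (cy i - cy j) →
      0 < wx * (cx i - cx j) + wy * (cy i - cy j)) → Split n cx cy r wx wy R := by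
    intro wx wy hw
    have hnear : ∀ i < n, (ux * (cx i - (x₁ + x₂) / 2) + uy * (cy i - (y₁ + y₂) / 2)) * 2 =
        dd x₁ y₁ (cx i) (cy i) ^ 2 - dd x₂ y₂ (cx i) (cy i) ^ 2 := by
      intro i _
      rw [dd_sq, dd_sq]
      ring
    refine ⟨fun i => ux * (cx i - (x₁ + x₂) / 2) + uy * (cy i - (y₁ + y₂) / 2) ≤ 0,
      x₁, y₁, x₂, y₂, ?_, ?_, ?_⟩
    · intro i hi j hj hSi hSj
      simp only [not_le] at hSj
      have := hw j hj i hi (by linarith)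
      linarith
    · intro i hi hS
      have h1 : dd x₁ y₁ (cx i) (cy i) ≤ dd x₂ y₂ (cx i) (cy i) := by
        refine le_of_sq_le_sq ?_ (dd_nonneg _ _ _ _)
        linarith [hnear i hi]
      rcases hcov i hi with h | h <;> linarith
    · intro i hi hS
      simp only [not_le] at hS
      have h1 : dd x₂ y₂ (cx i) (cy i) ≤ dd x₁ y₁ (cx i) (cy i) := by
        refine le_of_sq_le_sq ?_ (dd_nonneg _ _ _ _)
        linarith [hnear i hi]
      rcases hcov i hi with h | h <;> linarith
  set V : Finset (ℕ × ℕ) := ((Finset.range n) ×ˢ (Finset.range n)).filter fun v =>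
    0 < ux * (cx v.1 - cx v.2) + uy * (cy v.1 - cy v.2) with hV
  rcases V.eq_empty_or_nonempty with hE | hne
  · refine ⟨0, hn, 0, hn, 0, hn, 0, hn, main _ _ fun i hi j hj hpos => ?_⟩
    have : (i, j) ∈ V := by simp [hV, hi, hj]; linarith
    simp [hE] at this
  · obtain ⟨a, ha, b, hb, hab⟩ := exists_bisector V (fun v => cx v.1 - cx v.2)
      (fun v => cy v.1 - cy v.2) ux uy (fun v hv => (Finset.mem_filter.1 hv).2) hne
    simp only [hV, Finset.mem_filter, Finset.mem_product, Finset.mem_range] at ha hb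
    refine ⟨a.1, ha.1.1, a.2, ha.1.2, b.1, hb.1.1, b.2, hb.1.2, main _ _ fun i hi j hj hpos => ?_⟩
    have hmem : (i, j) ∈ V := by simp [hV, hi, hj]; linarith
    have h := hab _ hmem
    have e : ∀ p q p' q' : ℝ, dd 0 0 (p - p') (q - q') = dd p q p' q' := by
      intro p q p' q'
      unfold dd
      congr 1
      ring
    rw [e, e] at h
    exact h

/-! ### The farthest point heuristic -/

/-- Pigeonhole: among disk `i`, disk `0` and the farthest disk `b`, two lie in the same covering
disk. If these are `0` and `b`, the maximality of `b` bounds the reach of `i` from the center of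
`0`. -/
theorem two_approx (n : ℕ) (cx cy r : ℕ → ℝ) (hr : ∀ i < n, 0 ≤ r i) (b i : ℕ)
    (hn : 0 < n) (hb : b < n) (hi : i < n)
    (hmax : ∀ j < n, dd (cx j) (cy j) (cx 0) (cy 0) + r j ≤ dd (cx b) (cy b) (cx 0) (cy 0) + r b)
    (x₁ y₁ x₂ y₂ R : ℝ) (hcov : Cover n cx cy r x₁ y₁ x₂ y₂ R) :
    min (dd (cx i) (cy i) (cx 0) (cy 0)) (dd (cx i) (cy i) (cx b) (cy b)) + r i ≤ 2 * R := by
  have key : ∀ j < n, ∀ k < n, ∀ x y : ℝ, dd x y (cx j) (cy j) + r j ≤ R →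
      dd x y (cx k) (cy k) + r k ≤ R → dd (cx j) (cy j) (cx k) (cy k) + r j ≤ 2 * R := by
    intro j hj k hk x y h1 h2
    have h3 := dd_triangle (cx j) (cy j) x y (cx k) (cy k)
    rw [dd_comm (cx j) (cy j) x y] at h3
    linarith [hr k hk]
  have h0 := min_le_left (dd (cx i) (cy i) (cx 0) (cy 0)) (dd (cx i) (cy i) (cx b) (cy b))
  have h1 := min_le_right (dd (cx i) (cy i) (cx 0) (cy 0)) (dd (cx i) (cy i) (cx b) (cy b))
  have hm := hmax i hi
  rcases hcov i hi with hci | hci <;> rcases hcov 0 hn with hc0 | hc0 <;>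
    rcases hcov b hb with hcb | hcb
  all_goals first
    | linarith [key i hi 0 hn _ _ hci hc0]
    | linarith [key i hi b hb _ _ hci hcb]
    | linarith [key b hb 0 hn _ _ hcb hc0]

/-! ### The ellipsoid method in the plane -/

/-- `(px, py)` lies in the image of the unit disk under `z ↦ (qx, qy) + (a, b; c, d) z`. -/
def InEllipse (qx qy a b c d px py : ℝ) : Prop :=
  ∃ z w : ℝ, z ^ 2 + w ^ 2 ≤ 1 ∧ px = qx + a * z + b * w ∧ py = qy + c * z + d * w

theorem inEllipse_disk {qx qy R px py : ℝ} (hR : 0 < R) (h : dd px py qx qy ≤ R) :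
    InEllipse qx qy R 0 0 R px py := by
  refine ⟨(px - qx) / R, (py - qy) / R, ?_, by field_simp; ring, by field_simp; ring⟩
  have h1 := pow_le_pow_left₀ (dd_nonneg _ _ _ _) h 2
  rw [dd_sq] at h1
  rw [div_pow, div_pow, ← add_div, div_le_one (by positivity)]
  exact h1

/-- In rotated coordinates the retained half of the unit disk is `y ≤ 0`. It lies in the ellipse
with center `y = -1 / 3` and semi-axes `2 / 3` and `7 / 6`. The optimal second semi-axis is `2 /
√3`; the slightly larger rational value still gives the area factor `7 / 9 < 1`. The unit vector
`(α, β)` is the normal of the cut pulled back by the matrix. -/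
theorem InEllipse.cut {qx qy a b c d px py gx gy α β ν : ℝ} (h : InEllipse qx qy a b c d px py)
    (hν : 0 < ν) (hαβ : α ^ 2 + β ^ 2 = 1) (hα : a * gx + c * gy = ν * α)
    (hβ : b * gx + d * gy = ν * β) (hg : gx * (px - qx) + gy * (py - qy) ≤ 0) :
    InEllipse (qx - (a * α + b * β) / 3) (qy - (c * α + d * β) / 3)
      (2 / 3 * (a * α + b * β)) (7 / 6 * (b * α - a * β))
      (2 / 3 * (c * α + d * β)) (7 / 6 * (d * α - c * β)) px py := by
  obtain ⟨z, w, hzw, rfl, rfl⟩ := h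
  set y := α * z + β * w with hy
  set x := α * w - β * z with hx
  have e1 : y ^ 2 + x ^ 2 = z ^ 2 + w ^ 2 := by
    rw [hy, hx]; linear_combination (z ^ 2 + w ^ 2) * hαβ
  have hz : z = α * y - β * x := by rw [hy, hx]; linear_combination (-z) * hαβ
  have hw : w = β * y + α * x := by rw [hy, hx]; linear_combination (-w) * hαβ
  have hy0 : y ≤ 0 := by
    have : ν * y ≤ 0 := by
      have e : gx * (qx + a * z + b * w - qx) + gy * (qy + c * z + d * w - qy) = ν * y := by
        rw [hy]; linear_combination z * hα + w * hβ
      rw [← e]; exact hg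
    by_contra hc
    exact absurd this (not_le.2 (mul_pos hν (not_le.1 hc)))
  have hy1 : -1 ≤ y := by nlinarith [sq_nonneg x]
  refine ⟨3 / 2 * y + 1 / 2, 6 / 7 * x, ?_, ?_, ?_⟩
  · nlinarith [mul_nonneg (neg_nonneg.2 hy0) (show 0 ≤ y + 1 by linarith), sq_nonneg x]
  · rw [hz, hw]; ring
  · rw [hz, hw]; ring

theorem det_cut {a b c d α β : ℝ} (hαβ : α ^ 2 + β ^ 2 = 1) :
    (2 / 3 * (a * α + b * β)) * (7 / 6 * (d * α - c * β)) -
      (7 / 6 * (b * α - a * β)) * (2 / 3 * (c * α + d * β)) = 7 / 9 * (a * d - b * c) := by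
  linear_combination (7 / 9 * (a * d - b * c)) * hαβ

/-- No area is needed. Half the difference of the preimages of the endpoints of a horizontal and of
a vertical diameter gives two vectors of the unit disk, mapped to `(ρ, 0)` and `(0, ρ)`. Their
determinant is at most `1` in absolute value, and determinants multiply. -/
theorem sq_le_det_of_disk {qx qy a b c d x y ρ : ℝ} (hρ : 0 ≤ ρ)
    (h : ∀ px py, dd px py x y ≤ ρ → InEllipse qx qy a b c d px py) :
    ρ ^ 2 ≤ |a * d - b * c| := by
  have hd1 : ∀ t, |t| ≤ ρ → dd (x + t) y x y ≤ ρ := by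
    intro t ht
    simp only [dd, add_sub_cancel_left, sub_self, mul_zero, add_zero, Real.sqrt_mul_self_eq_abs]
    exact ht
  have hd2 : ∀ t, |t| ≤ ρ → dd x (y + t) x y ≤ ρ := by
    intro t ht
    simp only [dd, add_sub_cancel_left, sub_self, mul_zero, zero_add, Real.sqrt_mul_self_eq_abs]
    exact ht
  obtain ⟨z₁, w₁, h₁, e₁, f₁⟩ := h _ _ (hd1 ρ (abs_of_nonneg hρ).le)
  obtain ⟨z₂, w₂, h₂, e₂, f₂⟩ := h _ _ (hd1 (-ρ) (by rw [abs_neg, abs_of_nonneg hρ]))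
  obtain ⟨z₃, w₃, h₃, e₃, f₃⟩ := h _ _ (hd2 ρ (abs_of_nonneg hρ).le)
  obtain ⟨z₄, w₄, h₄, e₄, f₄⟩ := h _ _ (hd2 (-ρ) (by rw [abs_neg, abs_of_nonneg hρ]))
  set z := (z₁ - z₂) / 2 with hz
  set w := (w₁ - w₂) / 2 with hw
  set z' := (z₃ - z₄) / 2 with hz'
  set w' := (w₃ - w₄) / 2 with hw'
  have n1 : z ^ 2 + w ^ 2 ≤ 1 := by
    rw [hz, hw]; nlinarith [sq_nonneg (z₁ + z₂), sq_nonneg (w₁ + w₂)]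
  have n2 : z' ^ 2 + w' ^ 2 ≤ 1 := by
    rw [hz', hw']; nlinarith [sq_nonneg (z₃ + z₄), sq_nonneg (w₃ + w₄)]
  have g1 : a * z + b * w = ρ := by rw [hz, hw]; linarith
  have g2 : c * z + d * w = 0 := by rw [hz, hw]; linarith
  have g3 : a * z' + b * w' = 0 := by rw [hz', hw']; linarith
  have g4 : c * z' + d * w' = ρ := by rw [hz', hw']; linarith
  clear_value z w z' w'
  have hdet : ρ ^ 2 = (a * d - b * c) * (z * w' - w * z') := by
    calc ρ ^ 2 = (a * z + b * w) * (c * z' + d * w') - (a * z' + b * w') * (c * z + d * w) := by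
          rw [g1, g2, g3, g4]; ring
      _ = _ := by ring
  have hle : |z * w' - w * z'| ≤ 1 := by
    rw [abs_le]
    constructor
    · nlinarith only [n1, n2, sq_nonneg (z + w'), sq_nonneg (w - z')]
    · nlinarith only [n1, n2, sq_nonneg (z - w'), sq_nonneg (w + z')]
  calc ρ ^ 2 = |a * d - b * c| * |z * w' - w * z'| := by
        rw [← abs_mul, ← hdet, abs_of_nonneg (sq_nonneg ρ)]
    _ ≤ _ := mul_le_of_le_one_right (abs_nonneg _) hle

/-- A point closer to `(x, y)` than `(qx, qy)` lies on the same side of `(qx, qy)` as `(x, y)`. -/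
theorem cut_valid {qx qy x y px py : ℝ} (h : dd px py x y ≤ dd qx qy x y) :
    (qx - x) * (px - qx) + (qy - y) * (py - qy) ≤ 0 := by
  have h1 := pow_le_pow_left₀ (dd_nonneg _ _ _ _) h 2
  rw [dd_sq, dd_sq] at h1
  nlinarith [sq_nonneg (px - qx), sq_nonneg (py - qy)]

open RealRAM

set_option linter.unusedSimpArgs false

/-! ### The program

The variables of the program are the cells `0` of the following arrays.

Natural number arrays: `0` number of disks, `1` loop counter, `2` flag of the scan, `3` index found,
`4` flag, `5` iteration counter, `6` number of iterations, `7` flag of the test, `8` current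
direction, `9` number of directions, `10`-`13` loop counters.

Real arrays: `0` accuracy, `1`-`3` input, `4` output, `5`-`6` center of the ellipse, `7` radius
in the scan, `8`-`9` direction, `10` projection, `11`-`14` matrix of the ellipse, `15`-`16` best
center, `17` its value, `18`-`19` first center, `20` best radius, `21` radius to be tested,
`22`-`25` best centers, `26` step size, `27` precision, `28`-`29` the directions, `30`-`34`
temporary, `35` the number of disks. -/

/-- The distance of two points. -/
def distE (x y x' y' : RExp) : RExp :=
  .sqrt (.add (.mul (.sub x x') (.sub x x')) (.mul (.sub y y') (.sub y y')))

@[simp] theorem distE_eval (s : State) (x y x' y' : RExp) :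
    (distE x y x' y').eval s = dd (x.eval s) (y.eval s) (x'.eval s) (y'.eval s) := rfl

/-- The radius needed to cover disk number `i` from the point `(x, y)`. -/
def reachE (x y : RExp) : RExp := .add (distE x y (ra 1 1) (ra 2 1)) (ra 3 1)

/-! ### Scanning for the first violated disk in the order of the projections. -/

def projE : RExp := .add (.mul (rv 8) (ra 1 1)) (.mul (rv 9) (ra 2 1))

def scanStep : Prog :=
  .cond (.and (.realLt (rv 7) (reachE (rv 5) (rv 6)))
      (.not (.and (.natLt (.lit 0) (nv 2)) (.not (.realLt projE (rv 10))))))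
    (setN 2 (.lit 1) ;; setN 3 (nv 1) ;; setR 10 projE) .skip ;; incr 1

/-- Find the disk with the smallest projection among those not covered from the current point. -/
def scan : Prog := (setN 1 (.lit 0) ;; setN 2 (.lit 0)) ;; forLoop 1 0 scanStep

/-- The result of a scan of the first `n` disks. -/
def ScanResult (n : ℕ) (cx cy r : ℕ → ℝ) (qx qy R ux uy : ℝ) (s : State) : Prop :=
  (s.nat 2 0 = 0 ∧ ∀ i < n, dd qx qy (cx i) (cy i) + r i ≤ R) ∨
  (s.nat 2 0 = 1 ∧ s.nat 3 0 < n ∧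
    R < dd qx qy (cx (s.nat 3 0)) (cy (s.nat 3 0)) + r (s.nat 3 0) ∧
    s.real 10 0 = ux * cx (s.nat 3 0) + uy * cy (s.nat 3 0) ∧
    ∀ i < n, R < dd qx qy (cx i) (cy i) + r i → s.real 10 0 ≤ ux * cx i + uy * cy i)

theorem scan_runs : ∃ C, ∀ s : State, Runs scan s (C * (s.nat 0 0 + 1))
    (ScanResult (s.nat 0 0) (s.real 1) (s.real 2) (s.real 3) (s.real 5 0) (s.real 6 0)
      (s.real 7 0) (s.real 8 0) (s.real 9 0)) := by
  refine ⟨scanStep.maxCost + 6 + (setN 1 (.lit 0) ;; setN 2 (.lit 0)).maxCost, fun s => ?_⟩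
  refine Runs.mono (Runs.seq (Runs.straight rfl (Q := fun s' => s'.nat 1 0 = 0 ∧ s'.nat 2 0 = 0)
    (by simp [Prog.eff, NExp.eval])) (R := ScanResult (s.nat 0 0) (s.real 1) (s.real 2) (s.real 3)
      (s.real 5 0) (s.real 6 0) (s.real 7 0) (s.real 8 0) (s.real 9 0))
    (U := (s.nat 0 0 + 1) * (scanStep.maxCost + 6)) ?_) ?_ fun _ _ h => h
  · rintro s₁ hF ⟨h1, h2⟩
    refine Runs.forLoop (fun i => ScanResult i (s.real 1) (s.real 2) (s.real 3)
      (s.real 5 0) (s.real 6 0) (s.real 7 0) (s.real 8 0) (s.real 9 0)) h1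
      (by rw [hF.1 0 (by decide)]) (by decide) (Or.inl ⟨h2, by simp⟩) ?_
    intro i s₂ hF₂ hi hi1 hJ
    have e1 : s₂.real 1 = s.real 1 := by rw [hF₂.2 1 (by decide), hF.2 1 (by decide)]
    have e2 : s₂.real 2 = s.real 2 := by rw [hF₂.2 2 (by decide), hF.2 2 (by decide)]
    have e3 : s₂.real 3 = s.real 3 := by rw [hF₂.2 3 (by decide), hF.2 3 (by decide)]
    have e5 : s₂.real 5 = s.real 5 := by rw [hF₂.2 5 (by decide), hF.2 5 (by decide)]
    have e6 : s₂.real 6 = s.real 6 := by rw [hF₂.2 6 (by decide), hF.2 6 (by decide)]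
    have e7 : s₂.real 7 = s.real 7 := by rw [hF₂.2 7 (by decide), hF.2 7 (by decide)]
    have e8 : s₂.real 8 = s.real 8 := by rw [hF₂.2 8 (by decide), hF.2 8 (by decide)]
    have e9 : s₂.real 9 = s.real 9 := by rw [hF₂.2 9 (by decide), hF.2 9 (by decide)]
    refine Runs.straight rfl ?_
    simp only [scanStep, Prog.eff, BExp.eval, NExp.eval, RExp.eval, reachE, projE, distE_eval, setNat_nat,
      setNat_real, Nat.reduceEqDiff, false_and, and_self, and_true, if_true, if_false, OfNat.one_ne_ofNat, OfNat.ofNat_ne_one, e1, e2, e3, e5, e6, e7, e8, e9, hi1]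
    generalize s.real 1 = cx, s.real 2 = cy, s.real 3 = r, s.real 5 0 = qx, s.real 6 0 = qy,
      s.real 7 0 = R, s.real 8 0 = ux, s.real 9 0 = uy at *
    split_ifs with hc
    · obtain ⟨hc1, hc2⟩ := hc
      refine ⟨by simp [hi1], Or.inr ?_⟩
      simp only [setNat_nat, setReal_nat, setReal_real, setNat_real]
      simp [hi1]
      refine ⟨hc1, fun j hj hjR => ?_⟩
      rcases Nat.lt_or_eq_of_le hj with hj | rfl
      · rcases hJ with ⟨h0, hJ⟩ | ⟨h0, hv, hv2, hv3, hJ⟩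
        · exact absurd (hJ j hj) (not_le.2 hjR)
        · have := hJ j hj hjR
          simp only [h0, not_and, not_not] at hc2
          linarith [hc2 one_pos]
      · exact le_rfl
    · refine ⟨by simp [hi1], ?_⟩
      rcases hJ with ⟨h0, hJ⟩ | ⟨h0, hv, hv2, hv3, hJ⟩
      · left
        refine ⟨by simpa using h0, fun j hj => ?_⟩
        rcases Nat.lt_succ_iff_lt_or_eq.1 hj with hj | rfl
        · exact hJ j hj
        · by_contra hlt
          exact hc ⟨not_le.1 hlt, by simp [h0]⟩
      · right
        simp only [setNat_nat, setNat_real]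
        simp only [OfNat.ofNat_ne_one, false_and, if_false]
        refine ⟨by simpa using h0, by simp; omega, by simpa using hv2, by simpa using hv3, ?_⟩
        intro j hj hjR
        rcases Nat.lt_succ_iff_lt_or_eq.1 hj with hj | rfl
        · exact hJ j hj hjR
        · by_contra hlt
          refine hc ⟨hjR, ?_⟩
          rintro ⟨_, h⟩
          exact h (not_le.1 hlt)
  · nlinarith

/-! ### The ellipsoid method for covering initial segments. -/

theorem ellipse_step {qx qy a b c d x y ρ cx cy r R D A B ν α β : ℝ} (hρ : 0 ≤ ρ)
    (hE : ∀ px py, dd px py x y ≤ ρ → InEllipse qx qy a b c d px py)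
    (hdet : a * d - b * c = D) (hD : 0 < D) (hviol : R < dd qx qy cx cy + r)
    (hfit : dd x y cx cy + r + ρ ≤ R)
    (hA : A = a * (qx - cx) + c * (qy - cy)) (hB : B = b * (qx - cx) + d * (qy - cy))
    (hν : ν = Real.sqrt (A * A + B * B)) (hα : α = A / ν) (hβ : β = B / ν) :
    (∀ px py, dd px py x y ≤ ρ →
      InEllipse (qx - (a * α + b * β) / 3) (qy - (c * α + d * β) / 3)
      (2 / 3 * (a * α + b * β)) (7 / 6 * (b * α - a * β))
      (2 / 3 * (c * α + d * β)) (7 / 6 * (d * α - c * β)) px py) ∧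
    (2 / 3 * (a * α + b * β)) * (7 / 6 * (d * α - c * β)) -
      (7 / 6 * (b * α - a * β)) * (2 / 3 * (c * α + d * β)) = 7 / 9 * D := by
  have hAB : 0 ≤ A * A + B * B := by nlinarith [mul_self_nonneg A, mul_self_nonneg B]
  have hν2 : ν ^ 2 = A * A + B * B := by rw [hν, Real.sq_sqrt hAB]
  have hν0 : 0 < ν := by
    rw [hν]
    -- A vanishing normal would place the query point at the center of the violated disk, because
    -- the matrix is invertible. But then the disk would be covered, since its radius is at most
    -- `R`.
    refine Real.sqrt_pos.2 (lt_of_le_of_ne hAB fun h => ?_)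
    have hA0 : A = 0 := by nlinarith [mul_self_nonneg A, mul_self_nonneg B]
    have hB0 : B = 0 := by nlinarith [mul_self_nonneg A, mul_self_nonneg B]
    have h1 : D * (qx - cx) = 0 := by
      rw [← hdet]; linear_combination d * (hA0 - hA) - c * (hB0 - hB)
    have h2 : D * (qy - cy) = 0 := by
      rw [← hdet]; linear_combination a * (hB0 - hB) - b * (hA0 - hA)
    have h3 : qx = cx := by
      rcases mul_eq_zero.1 h1 with h | h <;> linarith
    have h4 : qy = cy := by
      rcases mul_eq_zero.1 h2 with h | h <;> linarith
    rw [h3, h4, dd_self] at hviol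
    linarith [dd_nonneg x y cx cy]
  have hαβ : α ^ 2 + β ^ 2 = 1 := by
    rw [hα, hβ, div_pow, div_pow, ← add_div, hν2]
    rw [div_eq_one_iff_eq (by rw [← hν2]; positivity)]
    ring
  refine ⟨fun px py hp => ?_, by rw [det_cut hαβ, hdet]⟩
  refine (hE px py hp).cut hν0 hαβ (gx := qx - cx) (gy := qy - cy) ?_ ?_ (cut_valid ?_)
  · rw [hα, mul_div_cancel₀ _ hν0.ne', hA]
  · rw [hβ, mul_div_cancel₀ _ hν0.ne', hB]
  -- Every point of the `ρ`-disk around the target covers the violated disk with radius `R`, hence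
  -- is closer to its center than the query point is.
  · linarith [dd_triangle px py x y cx cy]

/-- Remember the current center if its value exceeds the best one so far. -/
def keepBest : Prog :=
  .cond (.and (.natLt (.lit 0) (nv 4)) (.not (.realLt (rv 17) (rv 10)))) .skip
    (setN 4 (.lit 1) ;; setR 17 (rv 10) ;; setR 15 (rv 5) ;; setR 16 (rv 6))

/-- Replace the current ellipse by one that covers its half in the direction of disk number `v`. -/
def cutEllipse : Prog :=
  setR 30 (.add (.mul (rv 11) (.sub (rv 5) (ra 1 3))) (.mul (rv 13) (.sub (rv 6) (ra 2 3)))) ;;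
  setR 31 (.add (.mul (rv 12) (.sub (rv 5) (ra 1 3))) (.mul (rv 14) (.sub (rv 6) (ra 2 3)))) ;;
  setR 32 (.sqrt (.add (.mul (rv 30) (rv 30)) (.mul (rv 31) (rv 31)))) ;;
  setR 30 (.div (rv 30) (rv 32)) ;;
  setR 31 (.div (rv 31) (rv 32)) ;;
  setR 33 (.add (.mul (rv 11) (rv 30)) (.mul (rv 12) (rv 31))) ;;
  setR 34 (.add (.mul (rv 13) (rv 30)) (.mul (rv 14) (rv 31))) ;;
  setR 5 (.sub (rv 5) (.div (rv 33) (.lit 3))) ;;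
  setR 6 (.sub (rv 6) (.div (rv 34) (.lit 3))) ;;
  setR 12 (.mul (.lit (7 / 6)) (.sub (.mul (rv 12) (rv 30)) (.mul (rv 11) (rv 31)))) ;;
  setR 14 (.mul (.lit (7 / 6)) (.sub (.mul (rv 14) (rv 30)) (.mul (rv 13) (rv 31)))) ;;
  setR 11 (.mul (.lit (2 / 3)) (rv 33)) ;;
  setR 13 (.mul (.lit (2 / 3)) (rv 34)) ;;
  incr 5

def ellipseStep : Prog :=
  scan ;;
  .cond (.natLt (.lit 0) (nv 2)) (keepBest ;; cutEllipse)
    (setR 15 (rv 5) ;; setR 16 (rv 6) ;; setN 5 (nv 6))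

def ellipseInit : Prog :=
  setR 5 (ra 1 3) ;; setR 6 (ra 2 3) ;; setR 11 (rv 21) ;; setR 12 (.lit 0) ;; setR 13 (.lit 0) ;;
  setR 14 (rv 21) ;; setR 7 (rv 21) ;; setN 4 (.lit 0) ;; setN 5 (.lit 0)

/-- Search for a center from which the disks of radius `R` cover as many disks as possible, in
the order of their projections. -/
def ellipseRun : Prog :=
  setR 7 (.lit (-1)) ;; scan ;; ellipseInit ;; forLoop 5 6 ellipseStep

/-- `S` is an initial segment of the disks in the order of the projections, and can be covered by
a disk of radius `R - ρ` with center `(x, y)`. -/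
def Target (n : ℕ) (cx cy r : ℕ → ℝ) (ux uy R ρ : ℝ) (S : ℕ → Prop) (x y : ℝ) : Prop :=
  (∀ i < n, ∀ j < n, S i → ¬ S j → ux * cx i + uy * cy i < ux * cx j + uy * cy j) ∧
  ∀ i < n, S i → dd x y (cx i) (cy i) + r i + ρ ≤ R

/-- The best center so far does not cover only disks with projection at least its value. -/
def BestValid (n : ℕ) (cx cy r : ℕ → ℝ) (ux uy R : ℝ) (s : State) : Prop :=
  0 < s.nat 4 0 → ∀ i < n, R < dd (s.real 15 0) (s.real 16 0) (cx i) (cy i) + r i →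
    s.real 17 0 ≤ ux * cx i + uy * cy i

/-- The progress of the ellipsoid method towards covering `S`. -/
def Progress (n : ℕ) (cx cy r : ℕ → ℝ) (ux uy R ρ : ℝ) (S : ℕ → Prop) (x y : ℝ) (T : ℕ)
    (s : State) : Prop :=
  (T ≤ s.nat 5 0 ∧ ∀ i < n, dd (s.real 15 0) (s.real 16 0) (cx i) (cy i) + r i ≤ R) ∨
  (0 < s.nat 4 0 ∧ ∃ v < n, ¬ S v ∧ ux * cx v + uy * cy v ≤ s.real 17 0) ∨
  (s.real 11 0 * s.real 14 0 - s.real 12 0 * s.real 13 0 = R ^ 2 * (7 / 9) ^ (s.nat 5 0) ∧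
    ∀ px py, dd px py x y ≤ ρ → InEllipse (s.real 5 0) (s.real 6 0) (s.real 11 0) (s.real 12 0)
      (s.real 13 0) (s.real 14 0) px py)

theorem keepBest_runs (n : ℕ) (cx cy r : ℕ → ℝ) (ux uy R : ℝ) (s : State)
    (hbest : BestValid n cx cy r ux uy R s)
    (hmp : ∀ i < n, R < dd (s.real 5 0) (s.real 6 0) (cx i) (cy i) + r i →
      s.real 10 0 ≤ ux * cx i + uy * cy i) :
    Runs keepBest s keepBest.maxCost fun s' => BestValid n cx cy r ux uy R s' ∧
      0 < s'.nat 4 0 ∧ s.real 10 0 ≤ s'.real 17 0 ∧ (0 < s.nat 4 0 → s.real 17 0 ≤ s'.real 17 0) := by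
  refine Runs.cond (fun h => Runs.straight rfl ?_) fun h => Runs.straight rfl ?_
  · simp only [BExp.eval, NExp.eval, RExp.eval] at h
    exact ⟨hbest, h.1, not_lt.1 h.2, fun _ => le_rfl⟩
  · simp only [BExp.eval, NExp.eval, RExp.eval, not_and, not_not] at h
    simp only [Prog.eff, NExp.eval, RExp.eval]
    refine ⟨fun _ => ?_, by simp, by simp, fun h0 => ?_⟩
    · simpa using hmp
    · simpa using (h h0).le

theorem cutEllipse_runs (s : State) (a b c d qx qy x y A B ν α β : ℝ) (h11 : s.real 11 0 = a)
    (h12 : s.real 12 0 = b) (h13 : s.real 13 0 = c) (h14 : s.real 14 0 = d)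
    (h5 : s.real 5 0 = qx) (h6 : s.real 6 0 = qy) (hx : s.real 1 (s.nat 3 0) = x)
    (hy : s.real 2 (s.nat 3 0) = y)
    (hA : A = a * (qx - x) + c * (qy - y)) (hB : B = b * (qx - x) + d * (qy - y))
    (hν : ν = Real.sqrt (A * A + B * B)) (hα : α = A / ν) (hβ : β = B / ν) :
    Runs cutEllipse s cutEllipse.maxCost fun s' => s'.nat 5 0 = s.nat 5 0 + 1 ∧
      s'.real 5 0 = qx - (a * α + b * β) / 3 ∧ s'.real 6 0 = qy - (c * α + d * β) / 3 ∧
      s'.real 11 0 = 2 / 3 * (a * α + b * β) ∧ s'.real 12 0 = 7 / 6 * (b * α - a * β) ∧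
      s'.real 13 0 = 2 / 3 * (c * α + d * β) ∧ s'.real 14 0 = 7 / 6 * (d * α - c * β) := by
  refine Runs.straight rfl ?_
  simp [cutEllipse, Prog.eff, NExp.eval, RExp.eval, h11, h12, h13, h14, h5, h6, hx, hy,
    ← hA, ← hB, ← hν, ← hα, ← hβ]

/-- The step does not depend on `S`, and preserves `Progress` for all targets simultaneously: a cut
is harmless for every target containing the violated disk, and for every other target the query
point is good enough to be recorded. If nothing is violated, setting the counter to `T` ends the
loop. -/
theorem ellipseStep_runs : ∃ C, ∀ (s : State) (n T : ℕ) (cx cy r : ℕ → ℝ) (ux uy R : ℝ), 0 < R →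
    s.nat 0 0 = n → s.nat 6 0 = T → s.real 1 = cx → s.real 2 = cy → s.real 3 = r →
    s.real 7 0 = R → s.real 8 0 = ux → s.real 9 0 = uy → s.nat 5 0 < T →
    BestValid n cx cy r ux uy R s →
    Runs ellipseStep s (C * (n + 1)) fun s' =>
      (s'.nat 5 0 = s.nat 5 0 + 1 ∨ s'.nat 5 0 = T) ∧ BestValid n cx cy r ux uy R s' ∧
      ∀ ρ S x y, 0 ≤ ρ → Target n cx cy r ux uy R ρ S x y →
        Progress n cx cy r ux uy R ρ S x y T s → Progress n cx cy r ux uy R ρ S x y T s' := by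
  obtain ⟨C, hC⟩ := scan_runs
  refine ⟨C + ((BExp.natLt (.lit 0) (nv 2)).cost + (keepBest.maxCost + cutEllipse.maxCost +
    (setR 15 (rv 5) ;; setR 16 (rv 6) ;; setN 5 (nv 6)).maxCost) + 1), ?_⟩
  intro s n T cx cy r ux uy R hR h0 h6 h1 h2 h3 h7 h8 h9 h5 hbest
  have hscan := hC s
  rw [h0, h1, h2, h3, h7, h8, h9] at hscan
  refine Runs.mono (Runs.seq hscan (R := fun s' =>
      (s'.nat 5 0 = s.nat 5 0 + 1 ∨ s'.nat 5 0 = T) ∧ BestValid n cx cy r ux uy R s' ∧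
      ∀ ρ S x y, 0 ≤ ρ → Target n cx cy r ux uy R ρ S x y →
        Progress n cx cy r ux uy R ρ S x y T s → Progress n cx cy r ux uy R ρ S x y T s')
    (U := (BExp.natLt (.lit 0) (nv 2)).cost + (keepBest.maxCost + cutEllipse.maxCost +
    (setR 15 (rv 5) ;; setR 16 (rv 6) ;; setN 5 (nv 6)).maxCost) + 1) ?_) ?_ fun _ _ h => h
  · intro s₁ hF hs
    have n4 : s₁.nat 4 = s.nat 4 := hF.1 4 (by decide)
    have n5 : s₁.nat 5 = s.nat 5 := hF.1 5 (by decide)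
    have n6 : s₁.nat 6 = s.nat 6 := hF.1 6 (by decide)
    have r1 : s₁.real 1 = s.real 1 := hF.2 1 (by decide)
    have r2 : s₁.real 2 = s.real 2 := hF.2 2 (by decide)
    have r5 : s₁.real 5 = s.real 5 := hF.2 5 (by decide)
    have r6 : s₁.real 6 = s.real 6 := hF.2 6 (by decide)
    have r11 : s₁.real 11 = s.real 11 := hF.2 11 (by decide)
    have r12 : s₁.real 12 = s.real 12 := hF.2 12 (by decide)
    have r13 : s₁.real 13 = s.real 13 := hF.2 13 (by decide)
    have r14 : s₁.real 14 = s.real 14 := hF.2 14 (by decide)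
    have r15 : s₁.real 15 = s.real 15 := hF.2 15 (by decide)
    have r16 : s₁.real 16 = s.real 16 := hF.2 16 (by decide)
    have r17 : s₁.real 17 = s.real 17 := hF.2 17 (by decide)
    refine Runs.cond ?_ ?_
    · intro hb
      simp only [BExp.eval, NExp.eval] at hb
      rcases hs with ⟨hs, -⟩ | ⟨-, hv, hviol, hmp, hmin⟩
      · omega
      have hbest₁ : BestValid n cx cy r ux uy R s₁ := by
        unfold BestValid
        rw [n4, r15, r16, r17]
        exact hbest
      rw [← r5, ← r6] at hmin
      refine Runs.seq (keepBest_runs n cx cy r ux uy R s₁ hbest₁ hmin) ?_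
      rintro s₂ hF₂ ⟨hbest₂, hg, hm, hm'⟩
      have m3 : s₂.nat 3 = s₁.nat 3 := hF₂.1 3 (by decide)
      refine Runs.mono (cutEllipse_runs s₂ (s.real 11 0) (s.real 12 0) (s.real 13 0) (s.real 14 0)
        (s.real 5 0) (s.real 6 0) (cx (s₁.nat 3 0)) (cy (s₁.nat 3 0)) _ _ _ _ _
        (by rw [hF₂.2 11 (by decide), r11]) (by rw [hF₂.2 12 (by decide), r12])
        (by rw [hF₂.2 13 (by decide), r13]) (by rw [hF₂.2 14 (by decide), r14])
        (by rw [hF₂.2 5 (by decide), r5]) (by rw [hF₂.2 6 (by decide), r6])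
        (by rw [m3, hF₂.2 1 (by decide), r1, h1]) (by rw [m3, hF₂.2 2 (by decide), r2, h2])
        rfl rfl rfl rfl rfl) le_rfl ?_
      rintro s₃ hF₃ ⟨f5, g5, g6, g11, g12, g13, g14⟩
      have f5' : s₃.nat 5 0 = s.nat 5 0 + 1 := by rw [f5, hF₂.1 5 (by decide), n5]
      have k4 : s₃.nat 4 = s₂.nat 4 := hF₃.1 4 (by decide)
      have k15 : s₃.real 15 = s₂.real 15 := hF₃.2 15 (by decide)
      have k16 : s₃.real 16 = s₂.real 16 := hF₃.2 16 (by decide)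
      have k17 : s₃.real 17 = s₂.real 17 := hF₃.2 17 (by decide)
      refine ⟨Or.inl f5', ?_, ?_⟩
      · unfold BestValid
        rw [k4, k15, k16, k17]
        exact hbest₂
      · rintro ρ S x y hρ hT (⟨hle, -⟩ | ⟨hg0, v, hvn, hvS, hvm⟩ | ⟨hdet, hE⟩)
        · omega
        · right; left
          rw [k4, k17]
          refine ⟨hg, v, hvn, hvS, hvm.trans ?_⟩
          rw [← r17]
          exact hm' (by rw [n4]; exact hg0)
        -- The violated disk with the smallest projection is in `S`, and the cut keeps the target;
        -- or it is outside `S`, and its projection, now a lower bound for the recorded value,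
        -- witnesses that the best center covers `S`.
        · by_cases hSv : S (s₁.nat 3 0)
          · right; right
            have := ellipse_step hρ hE hdet (by positivity) hviol (hT.2 _ hv hSv)
              rfl rfl rfl rfl rfl
            rw [g5, g6, g11, g12, g13, g14, f5']
            refine ⟨?_, this.1⟩
            rw [this.2]
            ring
          · right; left
            rw [k4, k17]
            exact ⟨hg, _, hv, hSv, by rw [← hmp]; exact hm⟩
    · intro hb
      simp only [BExp.eval, NExp.eval] at hb
      rcases hs with ⟨-, hs⟩ | ⟨hs, -⟩
      · refine Runs.straight rfl ?_
        simp only [Prog.eff, NExp.eval, RExp.eval]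
        have hcov : ∀ i < n, dd (s₁.real 5 0) (s₁.real 6 0) (cx i) (cy i) + r i ≤ R := by
          rw [r5, r6]; exact hs
        refine ⟨Or.inr (by simp [n6, h6]), ?_, ?_⟩
        · intro _ i hi hlt
          exfalso
          simp at hlt
          exact absurd (hcov i hi) (not_le.2 hlt)
        · intro ρ S x y _ _ _
          left
          refine ⟨by simp [n6, h6], ?_⟩
          simpa using hcov
      · omega
  · rw [add_mul]
    exact Nat.add_le_add_left (Nat.le_mul_of_pos_right _ (Nat.succ_pos _)) _

theorem ellipseRun_runs : ∃ C, ∀ (s : State) (n T : ℕ) (cx cy r : ℕ → ℝ) (ux uy R : ℝ), 0 < R →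
    (∀ i < n, 0 ≤ r i) → s.nat 0 0 = n → s.nat 6 0 = T → s.real 1 = cx → s.real 2 = cy →
    s.real 3 = r → s.real 21 0 = R → s.real 8 0 = ux → s.real 9 0 = uy →
    Runs ellipseRun s (C * ((n + 1) * (T + 1))) fun s' =>
      ∀ ρ S x y, 0 ≤ ρ → R ^ 2 * (7 / 9) ^ T < ρ ^ 2 → Target n cx cy r ux uy R ρ S x y →
        ∀ i < n, S i → dd (s'.real 15 0) (s'.real 16 0) (cx i) (cy i) + r i ≤ R := by
  obtain ⟨C, hC⟩ := scan_runs
  obtain ⟨C', hC'⟩ := ellipseStep_runs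
  refine ⟨(setR 7 (.lit (-1))).maxCost + C + ellipseInit.maxCost + C' + 6, ?_⟩
  intro s n T cx cy r ux uy R hR hr h0 h6 h1 h2 h3 h21 h8 h9
  -- With radius `-1` every disk is violated, so the first scan returns the disk of smallest
  -- projection whatever the point scanned from. It belongs to every nonempty initial segment, hence
  -- the disk of radius `R` around its center contains the `ρ`-disk around every target.
  refine Runs.mono (Runs.seq (Runs.straight rfl (Q := fun s' => s'.real 7 0 = -1)
    (by simp [Prog.eff, NExp.eval, RExp.eval])) (R := fun s' =>
      ∀ ρ S x y, 0 ≤ ρ → R ^ 2 * (7 / 9) ^ T < ρ ^ 2 → Target n cx cy r ux uy R ρ S x y →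
        ∀ i < n, S i → dd (s'.real 15 0) (s'.real 16 0) (cx i) (cy i) + r i ≤ R)
    (U := C * (n + 1) + (ellipseInit.maxCost + (T + 1) * (C' * (n + 1) + (BExp.natLt (nv 5) (nv 6)).cost + 1))) ?_) ?_
    fun _ _ h => h
  · intro s₁ hF₁ h7
    have hscan := hC s₁
    have z0 : s₁.nat 0 = s.nat 0 := hF₁.1 0 (by decide)
    have z6 : s₁.nat 6 = s.nat 6 := hF₁.1 6 (by decide)
    have z1 : s₁.real 1 = s.real 1 := hF₁.2 1 (by decide)
    have z2 : s₁.real 2 = s.real 2 := hF₁.2 2 (by decide)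
    have z3 : s₁.real 3 = s.real 3 := hF₁.2 3 (by decide)
    have z8 : s₁.real 8 = s.real 8 := hF₁.2 8 (by decide)
    have z9 : s₁.real 9 = s.real 9 := hF₁.2 9 (by decide)
    have z21 : s₁.real 21 = s.real 21 := hF₁.2 21 (by decide)
    rw [z0, z1, z2, z3, z8, z9, h0, h1, h2, h3, h7, h8, h9] at hscan
    refine Runs.seq hscan ?_
    intro s₂ hF₂ hs₂
    have y0 : s₂.nat 0 0 = n := by rw [hF₂.1 0 (by decide), z0, h0]
    have y6 : s₂.nat 6 0 = T := by rw [hF₂.1 6 (by decide), z6, h6]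
    have y1 : s₂.real 1 = cx := by rw [hF₂.2 1 (by decide), z1, h1]
    have y2 : s₂.real 2 = cy := by rw [hF₂.2 2 (by decide), z2, h2]
    have y3 : s₂.real 3 = r := by rw [hF₂.2 3 (by decide), z3, h3]
    have y8 : s₂.real 8 0 = ux := by rw [hF₂.2 8 (by decide), z8, h8]
    have y9 : s₂.real 9 0 = uy := by rw [hF₂.2 9 (by decide), z9, h9]
    have y21 : s₂.real 21 0 = R := by rw [hF₂.2 21 (by decide), z21, h21]
    refine Runs.seq (Runs.straight (p := ellipseInit) rfl (Q := fun s' => s'.real 5 0 = cx (s₂.nat 3 0) ∧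
      s'.real 6 0 = cy (s₂.nat 3 0) ∧ s'.real 11 0 = R ∧ s'.real 12 0 = 0 ∧ s'.real 13 0 = 0 ∧
      s'.real 14 0 = R ∧ s'.real 7 0 = R ∧ s'.nat 4 0 = 0 ∧ s'.nat 5 0 = 0)
      (by simp [ellipseInit, Prog.eff, NExp.eval, RExp.eval, y1, y2, y21])) ?_
    rintro s₃ hF₃ ⟨g5, g6, g11, g12, g13, g14, g7, g4, f5⟩
    have x0 : s₃.nat 0 0 = n := by rw [hF₃.1 0 (by decide), y0]
    have x6 : s₃.nat 6 0 = T := by rw [hF₃.1 6 (by decide), y6]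
    have x1 : s₃.real 1 = cx := by rw [hF₃.2 1 (by decide), y1]
    have x2 : s₃.real 2 = cy := by rw [hF₃.2 2 (by decide), y2]
    have x3 : s₃.real 3 = r := by rw [hF₃.2 3 (by decide), y3]
    have x8 : s₃.real 8 0 = ux := by rw [hF₃.2 8 (by decide), y8]
    have x9 : s₃.real 9 0 = uy := by rw [hF₃.2 9 (by decide), y9]
    refine Runs.loop (B := C' * (n + 1)) (fun m s => s.nat 5 0 ≤ T ∧ T ≤ s.nat 5 0 + m ∧ BestValid n cx cy r ux uy R s ∧
      ∀ ρ S x y, 0 ≤ ρ → Target n cx cy r ux uy R ρ S x y → (∃ i < n, S i) →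
        Progress n cx cy r ux uy R ρ S x y T s) T ?_ ?_ ?_
    · refine ⟨by omega, by omega, fun h => by omega, ?_⟩
      rintro ρ S x y hρ hT ⟨i, hi, hSi⟩
      right; right
      rw [g5, g6, g11, g12, g13, g14, f5]
      refine ⟨by ring, fun px py hp => inEllipse_disk hR ?_⟩
      rcases hs₂ with ⟨-, hs₂⟩ | ⟨-, hv, -, hmp, hmin⟩
      · exfalso
        linarith [hs₂ i hi, hr i hi, dd_nonneg (s₁.real 5 0) (s₁.real 6 0) (cx i) (cy i)]
      · have hSv : S (s₂.nat 3 0) := by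
          by_contra hc
          have h1 := hT.1 i hi _ hv hSi hc
          have h2 := hmin i hi
            (by linarith [hr i hi, dd_nonneg (s₁.real 5 0) (s₁.real 6 0) (cx i) (cy i)])
          linarith
        have := hT.2 _ hv hSv
        linarith [dd_triangle px py x y (cx (s₂.nat 3 0)) (cy (s₂.nat 3 0)), hr _ hv]
    · rintro m s₄ hF₄ ⟨hle, hm, hbest, hprog⟩ hb
      simp only [BExp.eval, NExp.eval] at hb
      have w6 : s₄.nat 6 0 = T := by rw [hF₄.1 6 (by decide), x6]
      rw [w6] at hb
      refine ⟨m - 1, by omega, ?_⟩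
      refine Runs.mono (hC' s₄ n T cx cy r ux uy R hR (by rw [hF₄.1 0 (by decide), x0]) w6
        (by rw [hF₄.2 1 (by decide), x1]) (by rw [hF₄.2 2 (by decide), x2])
        (by rw [hF₄.2 3 (by decide), x3]) (by rw [hF₄.2 7 (by decide), g7])
        (by rw [hF₄.2 8 (by decide), x8]) (by rw [hF₄.2 9 (by decide), x9]) hb hbest) le_rfl ?_
      rintro s₅ - ⟨hor, hbest', hprog'⟩
      exact ⟨by omega, by omega, hbest', fun ρ S x y hρ hT hne =>
        hprog' ρ S x y hρ hT (hprog ρ S x y hρ hT hne)⟩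
    · rintro m s₄ hF₄ ⟨hle, hm, hbest, hprog⟩ hb
      simp only [BExp.eval, NExp.eval] at hb
      have w6 : s₄.nat 6 0 = T := by rw [hF₄.1 6 (by decide), x6]
      rw [w6] at hb
      intro ρ S x y hρ hlt hT i hi hSi
      rcases hprog ρ S x y hρ hT ⟨i, hi, hSi⟩ with ⟨-, h⟩ | ⟨hg, v, hv, hSv, hvm⟩ | ⟨hdet, hE⟩
      · exact h i hi
      · by_contra hc
        have h1 := hbest hg i hi (not_le.1 hc)
        have h2 := hT.1 i hi v hv hSi hSv
        linarith
      -- After `T` cuts the determinant is below `ρ ^ 2`, too small to contain the `ρ`-disk around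
      -- the target; only the two successful alternatives survive.
      · exfalso
        have h1 := sq_le_det_of_disk hρ hE
        have h5 : s₄.nat 5 0 = T := by omega
        rw [hdet, h5, abs_of_nonneg (by positivity)] at h1
        linarith
  · simp only [BExp.cost, NExp.cost]
    generalize (setR 7 (.lit (-1))).maxCost = c₁, ellipseInit.maxCost = c₂
    have h1 : (n + 1) ≤ (n + 1) * (T + 1) := Nat.le_mul_of_pos_right _ (by omega)
    have h2 : (T + 1) ≤ (n + 1) * (T + 1) := Nat.le_mul_of_pos_left _ (by omega)
    have h3 := Nat.mul_le_mul_left C h1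
    have h4 := Nat.mul_le_mul_left c₁ (h1.trans' (by omega : 1 ≤ n + 1))
    have h5 := Nat.mul_le_mul_left c₂ (h1.trans' (by omega : 1 ≤ n + 1))
    nlinarith

/-! ### Testing one direction with one radius. -/

def checkStep : Prog :=
  .cond (.and (.realLt (rv 21) (reachE (rv 18) (rv 19))) (.realLt (rv 21) (reachE (rv 15) (rv 16))))
    (setN 7 (.lit 1)) .skip ;; incr 1

/-- Test whether the two centers found form a cover. -/
def check : Prog := (setN 1 (.lit 0) ;; setN 7 (.lit 0)) ;; forLoop 1 0 checkStep

def loadDir : Prog :=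
  setR 8 (ra 28 8) ;; setR 9 (ra 29 8) ;; setR 21 (.div (rv 20) (.add (.lit 1) (rv 26)))

def flipDir : Prog :=
  setR 18 (rv 15) ;; setR 19 (rv 16) ;; setR 8 (.sub (.lit 0) (rv 8)) ;;
  setR 9 (.sub (.lit 0) (rv 9))

def accept : Prog :=
  setR 20 (rv 21) ;; setR 22 (rv 18) ;; setR 23 (rv 19) ;; setR 24 (rv 15) ;; setR 25 (rv 16)

/-- Try to improve the best radius by the factor `1 + η` with a split in the current direction;
go on to the next direction in case of failure. -/
def tryDir : Prog :=
  loadDir ;; ellipseRun ;; flipDir ;; ellipseRun ;; check ;;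
  .cond (.natLt (.lit 0) (nv 7)) (incr 8) accept

theorem check_runs : ∃ C, ∀ s : State, Runs check s (C * (s.nat 0 0 + 1)) fun s' =>
    (s'.nat 7 0 = 0 ↔ Cover (s.nat 0 0) (s.real 1) (s.real 2) (s.real 3) (s.real 18 0)
      (s.real 19 0) (s.real 15 0) (s.real 16 0) (s.real 21 0)) := by
  refine ⟨checkStep.maxCost + 6 + (setN 1 (.lit 0) ;; setN 7 (.lit 0)).maxCost, fun s => ?_⟩
  refine Runs.mono (Runs.seq (Runs.straight rfl (Q := fun s' => s'.nat 1 0 = 0 ∧ s'.nat 7 0 = 0)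
    (by simp [Prog.eff, NExp.eval])) (R := fun s' =>
    (s'.nat 7 0 = 0 ↔ Cover (s.nat 0 0) (s.real 1) (s.real 2) (s.real 3) (s.real 18 0)
      (s.real 19 0) (s.real 15 0) (s.real 16 0) (s.real 21 0)))
    (U := (s.nat 0 0 + 1) * (checkStep.maxCost + 6)) ?_) ?_ fun _ _ h => h
  · rintro s₁ hF ⟨h1, h7⟩
    refine Runs.forLoop (fun i s' => (s'.nat 7 0 = 0 ↔ Cover i (s.real 1) (s.real 2) (s.real 3)
      (s.real 18 0) (s.real 19 0) (s.real 15 0) (s.real 16 0) (s.real 21 0))) h1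
      (by rw [hF.1 0 (by decide)]) (by decide) (by simp [h7, Cover]) ?_
    intro i s₂ hF₂ hi hi1 hJ
    have e1 : s₂.real 1 = s.real 1 := by rw [hF₂.2 1 (by decide), hF.2 1 (by decide)]
    have e2 : s₂.real 2 = s.real 2 := by rw [hF₂.2 2 (by decide), hF.2 2 (by decide)]
    have e3 : s₂.real 3 = s.real 3 := by rw [hF₂.2 3 (by decide), hF.2 3 (by decide)]
    have e15 : s₂.real 15 = s.real 15 := by rw [hF₂.2 15 (by decide), hF.2 15 (by decide)]
    have e16 : s₂.real 16 = s.real 16 := by rw [hF₂.2 16 (by decide), hF.2 16 (by decide)]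
    have e18 : s₂.real 18 = s.real 18 := by rw [hF₂.2 18 (by decide), hF.2 18 (by decide)]
    have e19 : s₂.real 19 = s.real 19 := by rw [hF₂.2 19 (by decide), hF.2 19 (by decide)]
    have e21 : s₂.real 21 = s.real 21 := by rw [hF₂.2 21 (by decide), hF.2 21 (by decide)]
    have hsucc : Cover (i + 1) (s.real 1) (s.real 2) (s.real 3) (s.real 18 0) (s.real 19 0)
        (s.real 15 0) (s.real 16 0) (s.real 21 0) ↔ Cover i (s.real 1) (s.real 2) (s.real 3)
        (s.real 18 0) (s.real 19 0) (s.real 15 0) (s.real 16 0) (s.real 21 0) ∧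
        (dd (s.real 18 0) (s.real 19 0) (s.real 1 i) (s.real 2 i) + s.real 3 i ≤ s.real 21 0 ∨
        dd (s.real 15 0) (s.real 16 0) (s.real 1 i) (s.real 2 i) + s.real 3 i ≤ s.real 21 0) :=
      Nat.forall_lt_succ_right
    refine Runs.mono (Runs.seq (Runs.cond (Q := fun s' => s'.nat 1 0 = i ∧ (s'.nat 7 0 = 0 ↔
      Cover (i + 1) (s.real 1) (s.real 2) (s.real 3) (s.real 18 0) (s.real 19 0) (s.real 15 0)
      (s.real 16 0) (s.real 21 0))) (fun h => Runs.straight rfl ?_)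
      (fun h => Runs.straight rfl ?_)) (R := fun s' => s'.nat 1 0 = i + 1 ∧ (s'.nat 7 0 = 0 ↔
      Cover (i + 1) (s.real 1) (s.real 2) (s.real 3) (s.real 18 0) (s.real 19 0) (s.real 15 0)
      (s.real 16 0) (s.real 21 0))) (fun s₃ hF₃ h => Runs.straight (p := incr 1) rfl ?_))
      le_rfl fun _ _ h => h
    · simp only [BExp.eval, NExp.eval, RExp.eval, reachE, distE_eval, e1, e2, e3, e15, e16, e18,
        e19, e21, hi1] at h
      rw [hsucc]
      simp only [Prog.eff, NExp.eval]
      refine ⟨by simp [hi1], by simp, ?_⟩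
      rintro ⟨-, h' | h'⟩
      · exact absurd h' (not_le.2 h.1)
      · exact absurd h' (not_le.2 h.2)
    · simp only [BExp.eval, NExp.eval, RExp.eval, reachE, distE_eval, e1, e2, e3, e15, e16, e18,
        e19, e21, hi1] at h
      rw [hsucc]
      refine ⟨hi1, ?_⟩
      simp only [Prog.eff]
      rw [hJ, iff_self_and]
      intro _
      rw [← not_lt, ← not_lt, ← not_and_or]
      exact h
    · simpa [Prog.eff, NExp.eval, h.1] using h.2
  · generalize (setN 1 (.lit 0) ;; setN 7 (.lit 0)).maxCost = c
    nlinarith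

/-- The best cover found so far. -/
def BestCover (n : ℕ) (cx cy r : ℕ → ℝ) (s : State) : Prop :=
  0 < s.real 20 0 ∧
    Cover n cx cy r (s.real 22 0) (s.real 23 0) (s.real 24 0) (s.real 25 0) (s.real 20 0)

/-- A split of radius at most `(1 - θ) * R`, where `R = Rs / (1 + η)`, leaves slack `θ * R` for both
parts, so both ellipsoid runs would succeed and the check would pass. A failed check thus excludes
all such splits; a successful one is a certificate in itself. -/
theorem tryDir_runs : ∃ C, ∀ (s : State) (n T : ℕ) (cx cy r : ℕ → ℝ) (ux uy Rs η θ : ℝ), 0 < Rs →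
    0 < η → 0 < θ → (7 / 9 : ℝ) ^ T < θ ^ 2 →
    (∀ i < n, 0 ≤ r i) → s.nat 0 0 = n → s.nat 6 0 = T → s.real 1 = cx → s.real 2 = cy →
    s.real 3 = r → s.real 20 0 = Rs → s.real 26 0 = η → s.real 28 (s.nat 8 0) = ux →
    s.real 29 (s.nat 8 0) = uy →
    Runs tryDir s (C * ((n + 1) * (T + 1))) fun s' =>
      (s'.nat 8 0 = s.nat 8 0 + 1 ∧ s'.real 20 = s.real 20 ∧ s'.real 22 = s.real 22 ∧
        s'.real 23 = s.real 23 ∧ s'.real 24 = s.real 24 ∧ s'.real 25 = s.real 25 ∧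
        ∀ R, R ≤ (1 - θ) * (Rs / (1 + η)) → ¬ Split n cx cy r ux uy R) ∨
      (s'.nat 8 0 = s.nat 8 0 ∧ s'.real 20 0 = Rs / (1 + η) ∧ BestCover n cx cy r s') := by
  obtain ⟨C, hC⟩ := ellipseRun_runs
  obtain ⟨C', hC'⟩ := check_runs
  refine ⟨loadDir.maxCost + C + flipDir.maxCost + C + C' +
    ((BExp.natLt (.lit 0) (nv 7)).cost + ((incr 8).maxCost + accept.maxCost) + 1), ?_⟩
  intro s n T cx cy r ux uy Rs η θ hRs hη hθ hT hr h0 h6 h1 h2 h3 h20 h26 h28 h29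
  set R := Rs / (1 + η) with hR
  have hR0 : 0 < R := by positivity
  clear_value R
  set Q : State → Prop := fun s' =>
      (s'.nat 8 0 = s.nat 8 0 + 1 ∧ s'.real 20 = s.real 20 ∧ s'.real 22 = s.real 22 ∧
        s'.real 23 = s.real 23 ∧ s'.real 24 = s.real 24 ∧ s'.real 25 = s.real 25 ∧
        ∀ R', R' ≤ (1 - θ) * R → ¬ Split n cx cy r ux uy R') ∨
      (s'.nat 8 0 = s.nat 8 0 ∧ s'.real 20 0 = R ∧ BestCover n cx cy r s') with hQ
  refine Runs.mono (Runs.seq (Runs.straight rfl (Q := fun s' => s'.real 8 0 = ux ∧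
    s'.real 9 0 = uy ∧ s'.real 21 0 = R) ?_) (R := Q) (U := C * ((n + 1) * (T + 1)) +
      (flipDir.maxCost + (C * ((n + 1) * (T + 1)) + (C' * (n + 1) +
      ((BExp.natLt (.lit 0) (nv 7)).cost + ((incr 8).maxCost + accept.maxCost) + 1))))) ?_) ?_
      fun _ _ h => h
  · simp [loadDir, Prog.eff, NExp.eval, RExp.eval, h28, h29, h20, h26, hR]
  · rintro s₁ hF₁ ⟨a8, a9, a21⟩
    have a0 : s₁.nat 0 0 = n := by rw [hF₁.1 0 (by decide), h0]
    have a6 : s₁.nat 6 0 = T := by rw [hF₁.1 6 (by decide), h6]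
    have a1 : s₁.real 1 = cx := by rw [hF₁.2 1 (by decide), h1]
    have a2 : s₁.real 2 = cy := by rw [hF₁.2 2 (by decide), h2]
    have a3 : s₁.real 3 = r := by rw [hF₁.2 3 (by decide), h3]
    refine Runs.seq (hC s₁ n T cx cy r ux uy R hR0 hr a0 a6 a1 a2 a3 a21 a8 a9) ?_
    intro s₂ hF₂ hrun₂
    have b0 : s₂.nat 0 0 = n := by rw [hF₂.1 0 (by decide), a0]
    have b6 : s₂.nat 6 0 = T := by rw [hF₂.1 6 (by decide), a6]
    have b1 : s₂.real 1 = cx := by rw [hF₂.2 1 (by decide), a1]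
    have b2 : s₂.real 2 = cy := by rw [hF₂.2 2 (by decide), a2]
    have b3 : s₂.real 3 = r := by rw [hF₂.2 3 (by decide), a3]
    have b8 : s₂.real 8 0 = ux := by rw [hF₂.2 8 (by decide), a8]
    have b9 : s₂.real 9 0 = uy := by rw [hF₂.2 9 (by decide), a9]
    have b21 : s₂.real 21 0 = R := by rw [hF₂.2 21 (by decide), a21]
    refine Runs.seq (Runs.straight rfl (Q := fun s' => s'.real 8 0 = -ux ∧
      s'.real 9 0 = -uy ∧ s'.real 18 0 = s₂.real 15 0 ∧ s'.real 19 0 = s₂.real 16 0)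
      (by simp [flipDir, Prog.eff, NExp.eval, RExp.eval, b8, b9])) ?_
    rintro s₃ hF₃ ⟨c8, c9, c18, c19⟩
    have c0 : s₃.nat 0 0 = n := by rw [hF₃.1 0 (by decide), b0]
    have c6 : s₃.nat 6 0 = T := by rw [hF₃.1 6 (by decide), b6]
    have c1 : s₃.real 1 = cx := by rw [hF₃.2 1 (by decide), b1]
    have c2 : s₃.real 2 = cy := by rw [hF₃.2 2 (by decide), b2]
    have c3 : s₃.real 3 = r := by rw [hF₃.2 3 (by decide), b3]
    have c21 : s₃.real 21 0 = R := by rw [hF₃.2 21 (by decide), b21]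
    refine Runs.seq (hC s₃ n T cx cy r (-ux) (-uy) R hR0 hr c0 c6 c1 c2 c3 c21 c8 c9) ?_
    intro s₄ hF₄ hrun₄
    have d0 : s₄.nat 0 0 = n := by rw [hF₄.1 0 (by decide), c0]
    have d1 : s₄.real 1 = cx := by rw [hF₄.2 1 (by decide), c1]
    have d2 : s₄.real 2 = cy := by rw [hF₄.2 2 (by decide), c2]
    have d3 : s₄.real 3 = r := by rw [hF₄.2 3 (by decide), c3]
    have d21 : s₄.real 21 0 = R := by rw [hF₄.2 21 (by decide), c21]
    have d18 : s₄.real 18 0 = s₂.real 15 0 := by rw [hF₄.2 18 (by decide), c18]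
    have d19 : s₄.real 19 0 = s₂.real 16 0 := by rw [hF₄.2 19 (by decide), c19]
    have hchk := hC' s₄
    rw [d0, d1, d2, d3, d21] at hchk
    refine Runs.seq hchk ?_
    intro s₅ hF₅ hiff
    have e8 : s₅.nat 8 = s.nat 8 := by
      rw [hF₅.1 8 (by decide), hF₄.1 8 (by decide), hF₃.1 8 (by decide), hF₂.1 8 (by decide),
        hF₁.1 8 (by decide)]
    have hfr : ∀ a, a ∉ check.realWrites → a ∉ ellipseRun.realWrites → a ∉ flipDir.realWrites →
        a ∉ loadDir.realWrites → s₅.real a = s.real a := by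
      intro a g1 g2 g3 g4
      rw [hF₅.2 a g1, hF₄.2 a g2, hF₃.2 a g3, hF₂.2 a g2, hF₁.2 a g4]
    refine Runs.cond (fun h => Runs.straight (p := incr 8) rfl ?_)
      (fun h => Runs.straight (p := accept) rfl ?_)
    · simp only [BExp.eval, NExp.eval] at h
      left
      have hncov : ¬ Cover n cx cy r (s₄.real 18 0) (s₄.real 19 0) (s₄.real 15 0) (s₄.real 16 0)
        R := fun hc => by have := hiff.2 hc; omega
      refine ⟨by simp [Prog.eff, NExp.eval, e8], ?_, ?_, ?_, ?_, ?_, ?_⟩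
      · exact hfr 20 (by decide) (by decide) (by decide) (by decide)
      · exact hfr 22 (by decide) (by decide) (by decide) (by decide)
      · exact hfr 23 (by decide) (by decide) (by decide) (by decide)
      · exact hfr 24 (by decide) (by decide) (by decide) (by decide)
      · exact hfr 25 (by decide) (by decide) (by decide) (by decide)
      · rintro R' hR' ⟨S, x₁, y₁, x₂, y₂, hS, hS1, hS2⟩
        refine hncov fun i hi => ?_
        have hρ : 0 ≤ θ * R := by positivity
        have hlt : R ^ 2 * (7 / 9) ^ T < (θ * R) ^ 2 := by
          rw [mul_pow, mul_comm]
          exact mul_lt_mul_of_pos_right hT (by positivity)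
        by_cases hSi : S i
        · left
          rw [d18, d19]
          exact hrun₂ (θ * R) S x₁ y₁ hρ hlt ⟨hS, fun j hj hSj => by
            linarith [hS1 j hj hSj]⟩ i hi hSi
        · right
          -- In the direction `-u` the complement of `S` is the initial segment.
          refine hrun₄ (θ * R) (fun j => ¬ S j) x₂ y₂ hρ hlt ⟨fun j hj k hk hSj hSk => ?_,
            fun j hj hSj => by linarith [hS2 j hj hSj]⟩ i hi hSi
          have := hS k hk j hj (not_not.1 hSk) hSj
          linarith
    · simp only [BExp.eval, NExp.eval] at h
      right
      have hcov := hiff.1 (by omega)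
      have f21 : s₅.real 21 0 = R := by rw [hF₅.2 21 (by decide), d21]
      have f15 : s₅.real 15 = s₄.real 15 := hF₅.2 15 (by decide)
      have f16 : s₅.real 16 = s₄.real 16 := hF₅.2 16 (by decide)
      have f18 : s₅.real 18 = s₄.real 18 := hF₅.2 18 (by decide)
      have f19 : s₅.real 19 = s₄.real 19 := hF₅.2 19 (by decide)
      refine ⟨by simp [accept, Prog.eff, e8], by simp [accept, Prog.eff, NExp.eval, RExp.eval, f21],
        ?_⟩
      simp only [BestCover, accept, Prog.eff, NExp.eval, RExp.eval]
      simp [f21, f15, f16, f18, f19, hR0]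
      exact hcov
  · generalize loadDir.maxCost = u₁, flipDir.maxCost = u₂,
      (BExp.natLt (.lit 0) (nv 7)).cost + ((incr 8).maxCost + accept.maxCost) + 1 = u₃
    have g1 : (n + 1) ≤ (n + 1) * (T + 1) := Nat.le_mul_of_pos_right _ (by omega)
    have g2 := Nat.mul_le_mul_left C' g1
    have g3 := Nat.mul_le_mul_left (u₁ + u₂ + u₃) (g1.trans' (by omega : 1 ≤ n + 1))
    nlinarith

/-- Improve the best radius until no direction admits an improvement by the factor `1 + η`. -/
def pass : Prog := setN 8 (.lit 0) ;; .loop (.natLt (nv 8) (nv 9)) tryDir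

/-- Each iteration either advances the direction or improves the radius. There are at most `N`
advances, and at most `M` improvements since the initial radius is within `1 + M * η` of every
cover; in the invariant, `c` counts the improvements. -/
theorem pass_runs : ∃ C, ∀ (s : State) (n T N M : ℕ) (cx cy r ux uy : ℕ → ℝ) (η θ : ℝ),
    0 < η → 0 < θ → θ ≤ 1 → (7 / 9 : ℝ) ^ T < θ ^ 2 →
    (∀ i < n, 0 ≤ r i) → s.nat 0 0 = n → s.nat 6 0 = T → s.nat 9 0 = N → s.real 1 = cx →
    s.real 2 = cy → s.real 3 = r → s.real 26 0 = η → s.real 28 = ux → s.real 29 = uy →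
    BestCover n cx cy r s →
    (∀ x₁ y₁ x₂ y₂ R, Cover n cx cy r x₁ y₁ x₂ y₂ R → s.real 20 0 ≤ (1 + M * η) * R) →
    Runs pass s (C * ((N + M + 1) * ((n + 1) * (T + 1)))) fun s' =>
      BestCover n cx cy r s' ∧
      ∀ k < N, ∀ R, R ≤ (1 - θ) * (s'.real 20 0 / (1 + η)) → ¬ Split n cx cy r (ux k) (uy k) R := by
  obtain ⟨C, hC⟩ := tryDir_runs
  refine ⟨(setN 8 (.lit 0)).maxCost + (C + (BExp.natLt (nv 8) (nv 9)).cost + 1), ?_⟩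
  intro s n T N M cx cy r ux uy η θ hη hθ hθ1 hT hr h0 h6 h9 h1 h2 h3 h26 h28 h29 hbest hbound
  refine Runs.mono (Runs.seq (Runs.straight rfl (Q := fun s' => s'.nat 8 0 = 0)
    (by simp [Prog.eff, NExp.eval])) (R := fun s' => BestCover n cx cy r s' ∧
      ∀ k < N, ∀ R, R ≤ (1 - θ) * (s'.real 20 0 / (1 + η)) → ¬ Split n cx cy r (ux k) (uy k) R)
    (U := (N + M + 1) * (C * ((n + 1) * (T + 1)) + (BExp.natLt (nv 8) (nv 9)).cost + 1)) ?_) ?_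
    fun _ _ h => h
  · intro s₁ hF₁ a8
    have hreal : s₁.real = s.real := funext fun a => hF₁.2 a (by simp [Prog.realWrites])
    refine Runs.loop (B := C * ((n + 1) * (T + 1))) (fun m s' => ∃ c, s'.nat 8 0 ≤ N ∧
      N + M ≤ m + s'.nat 8 0 + c ∧ c ≤ M ∧ s'.real 20 0 * (1 + η) ^ c = s.real 20 0 ∧
      BestCover n cx cy r s' ∧
      ∀ k < s'.nat 8 0, ∀ R, R ≤ (1 - θ) * (s'.real 20 0 / (1 + η)) →
        ¬ Split n cx cy r (ux k) (uy k) R) (N + M) ?_ ?_ ?_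
    · refine ⟨0, by omega, by omega, by omega, by simp [hreal], ?_, by simp [a8]⟩
      rw [BestCover, hreal]
      exact hbest
    · rintro m s₂ hF₂ ⟨c, hk, hm, hcM, hpow, hb₂, hno⟩ hg
      have b9 : s₂.nat 9 0 = N := by rw [hF₂.1 9 (by decide), hF₁.1 9 (by decide), h9]
      simp only [BExp.eval, NExp.eval, b9] at hg
      refine ⟨m - 1, by omega, ?_⟩
      refine Runs.mono (hC s₂ n T cx cy r (ux (s₂.nat 8 0)) (uy (s₂.nat 8 0)) (s₂.real 20 0) η θ
        hb₂.1 hη hθ hT hr (by rw [hF₂.1 0 (by decide), hF₁.1 0 (by decide), h0])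
        (by rw [hF₂.1 6 (by decide), hF₁.1 6 (by decide), h6])
        (by rw [hF₂.2 1 (by decide), hreal, h1]) (by rw [hF₂.2 2 (by decide), hreal, h2])
        (by rw [hF₂.2 3 (by decide), hreal, h3]) rfl (by rw [hF₂.2 26 (by decide), hreal, h26])
        (by rw [hF₂.2 28 (by decide), hreal, h28]) (by rw [hF₂.2 29 (by decide), hreal, h29]))
        le_rfl ?_
      rintro s₃ - (⟨k8, k20, k22, k23, k24, k25, hfail⟩ | ⟨k8, k20, hb₃⟩)
      · refine ⟨c, by omega, by omega, hcM, by rw [k20]; exact hpow, ?_, ?_⟩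
        · rw [BestCover, k20, k22, k23, k24, k25]
          exact hb₂
        · rw [k8, k20]
          intro k hk' R hR
          rcases Nat.lt_succ_iff_lt_or_eq.1 hk' with h | rfl
          · exact hno k h R hR
          · exact hfail R hR
      · have hη1 : 0 < 1 + η := by linarith
        have hpow' : s₃.real 20 0 * (1 + η) ^ (c + 1) = s.real 20 0 := by
          rw [k20, ← hpow, pow_succ]
          field_simp
        -- The improved cover itself bounds the initial radius from above, while Bernoulli's
        -- inequality bounds the accumulated factor `(1 + η) ^ (c + 1)` from below.
        have hc : c + 1 ≤ M := by
          have h4 := hbound _ _ _ _ _ hb₃.2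
          rw [← hpow', mul_comm] at h4
          have h5 := le_of_mul_le_mul_right h4 hb₃.1
          have h6 := one_add_mul_le_pow (show (-2 : ℝ) ≤ η by linarith) (c + 1)
          have h7 : ((c + 1 : ℕ) : ℝ) * η ≤ M * η := by linarith
          exact_mod_cast le_of_mul_le_mul_right h7 hη
        refine ⟨c + 1, by omega, by omega, hc, hpow', hb₃, ?_⟩
        rw [k8]
        intro k hk' R hR
        -- The excluded threshold only shrinks when the radius does, so directions already discarded
        -- need not be revisited.
        refine hno k hk' R (hR.trans ?_)
        rw [k20]
        have h8 : s₂.real 20 0 / (1 + η) ≤ s₂.real 20 0 :=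
          div_le_self hb₂.1.le (by linarith)
        have h9 : s₂.real 20 0 / (1 + η) / (1 + η) ≤ s₂.real 20 0 / (1 + η) :=
          div_le_div_of_nonneg_right h8 hη1.le
        exact mul_le_mul_of_nonneg_left h9 (by linarith)
    · rintro m s₂ hF₂ ⟨c, hk, hm, hcM, hpow, hb₂, hno⟩ hg
      have b9 : s₂.nat 9 0 = N := by rw [hF₂.1 9 (by decide), hF₁.1 9 (by decide), h9]
      simp only [BExp.eval, NExp.eval, b9] at hg
      obtain hN : s₂.nat 8 0 = N := by omega
      rw [hN] at hno
      exact ⟨hb₂, hno⟩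
  · generalize (setN 8 (.lit 0)).maxCost = u₁, (BExp.natLt (nv 8) (nv 9)).cost = u₂
    have g0 : 1 ≤ (n + 1) * (T + 1) := Nat.mul_pos (by omega) (by omega)
    generalize (n + 1) * (T + 1) = Z at *
    have g1 : 1 ≤ (N + M + 1) * Z := Nat.mul_pos (by omega) g0
    have g2 := Nat.mul_le_mul_left (N + M + 1) g0
    have g3 := Nat.mul_le_mul_left u₁ g1
    have g4 := Nat.mul_le_mul_left (u₂ + 1) g2
    nlinarith

/-! ### Refinement of the step size. -/

theorem Split.mono {n : ℕ} {cx cy r : ℕ → ℝ} {ux uy R R' : ℝ} (h : Split n cx cy r ux uy R)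
    (hR : R ≤ R') : Split n cx cy r ux uy R' := by
  obtain ⟨S, x₁, y₁, x₂, y₂, h1, h2, h3⟩ := h
  exact ⟨S, x₁, y₁, x₂, y₂, h1, fun i hi hS => (h2 i hi hS).trans hR,
    fun i hi hS => (h3 i hi hS).trans hR⟩

theorem Cover.nonneg {n : ℕ} {cx cy r : ℕ → ℝ} {x₁ y₁ x₂ y₂ R : ℝ} (hn : 1 ≤ n)
    (hr : ∀ i < n, 0 ≤ r i) (h : Cover n cx cy r x₁ y₁ x₂ y₂ R) : 0 ≤ R := by
  have h0 := hr 0 hn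
  rcases h 0 hn with h | h
  · linarith [dd_nonneg x₁ y₁ (cx 0) (cy 0)]
  · linarith [dd_nonneg x₂ y₂ (cx 0) (cy 0)]

/-- Halve the step size until it is below the precision. -/
def levels : Prog :=
  .loop (.not (.realLt (rv 26) (rv 27))) (pass ;; setR 26 (.div (rv 26) (.lit 2)))

/-- After a pass with step `η` the radius is within `(1 + η) * (1 + θ) / (1 - θ)` of the optimum.
This is at most `1 + 6 * η`, that is `1 + 12 * (η / 2)`: with `M ≥ 12` the next pass, with half the
step, again needs at most `M` improvements. -/
theorem levels_runs : ∃ C, ∀ (s : State) (n T N M L : ℕ) (cx cy r ux uy : ℕ → ℝ) (η θ ε : ℝ),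
    0 < θ → θ ≤ η → η ≤ 1 → 8 * θ ≤ ε → ε ≤ 1 → η < θ * 2 ^ L → 12 ≤ M →
    (7 / 9 : ℝ) ^ T < θ ^ 2 → 1 ≤ n →
    (∀ i < n, 0 ≤ r i) → s.nat 0 0 = n → s.nat 6 0 = T → s.nat 9 0 = N → s.real 1 = cx →
    s.real 2 = cy → s.real 3 = r → s.real 26 0 = η → s.real 27 0 = θ → s.real 28 = ux →
    s.real 29 = uy → BestCover n cx cy r s →
    (∀ x₁ y₁ x₂ y₂ R, Cover n cx cy r x₁ y₁ x₂ y₂ R → s.real 20 0 ≤ (1 + M * η) * R) →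
    (∀ x₁ y₁ x₂ y₂ R, Cover n cx cy r x₁ y₁ x₂ y₂ R →
      ∃ k < N, Split n cx cy r (ux k) (uy k) ((1 + θ) * R)) →
    Runs levels s (C * ((L + 1) * ((N + M + 1) * ((n + 1) * (T + 1))))) fun s' =>
      BestCover n cx cy r s' ∧ ∀ x₁ y₁ x₂ y₂ R, Cover n cx cy r x₁ y₁ x₂ y₂ R →
        s'.real 20 0 ≤ (1 + ε) * R := by
  obtain ⟨C, hC⟩ := pass_runs
  refine ⟨C + (setR 26 (.div (rv 26) (.lit 2))).maxCost +
    (BExp.not (.realLt (rv 26) (rv 27))).cost + 1, ?_⟩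
  intro s n T N M L cx cy r ux uy η θ ε hθ hθη hη1 hε hε1 hηL hM hT hn hr h0 h6 h9 h1 h2 h3 h26 h27
    h28 h29 hbest hbound hdirs
  refine Runs.mono (Runs.loop (B := C * ((N + M + 1) * ((n + 1) * (T + 1))) +
    (setR 26 (.div (rv 26) (.lit 2))).maxCost) (Q := fun s' => BestCover n cx cy r s' ∧
      ∀ x₁ y₁ x₂ y₂ R, Cover n cx cy r x₁ y₁ x₂ y₂ R → s'.real 20 0 ≤ (1 + ε) * R)
    (fun m s' => 0 < s'.real 26 0 ∧ s'.real 26 0 ≤ 1 ∧ s'.real 26 0 < θ * 2 ^ m ∧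
      BestCover n cx cy r s' ∧
      (∀ x₁ y₁ x₂ y₂ R, Cover n cx cy r x₁ y₁ x₂ y₂ R →
        s'.real 20 0 ≤ (1 + M * s'.real 26 0) * R) ∧
      -- Before the first pass no quality is guaranteed, but the loop cannot end there because `θ ≤
      -- η`. Afterwards the step has been halved, whence the factor `2` in the bound.
      (s'.real 26 0 = η ∨ ∀ x₁ y₁ x₂ y₂ R, Cover n cx cy r x₁ y₁ x₂ y₂ R →
        (1 - θ) * s'.real 20 0 ≤ (1 + 2 * s'.real 26 0) * (1 + θ) * R)) L ?_ ?_ ?_) ?_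
    fun _ _ h => h
  · rw [h26]
    exact ⟨by linarith, hη1, hηL, hbest, hbound, Or.inl rfl⟩
  · rintro m s₁ hF ⟨p1, p2, p3, p4, p5, p6⟩ hg
    have a27 : s₁.real 27 0 = θ := by rw [hF.2 27 (by decide), h27]
    simp only [BExp.eval, RExp.eval, NExp.eval, a27, not_lt] at hg
    obtain ⟨m', rfl⟩ : ∃ m', m = m' + 1 := by
      refine ⟨m - 1, ?_⟩
      rcases m with - | m
      · simp at p3; linarith
      · simp
    refine ⟨m', rfl, ?_⟩
    refine Runs.seq (hC s₁ n T N M cx cy r ux uy (s₁.real 26 0) θ p1 hθ (by linarith) hT hr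
      (by rw [hF.1 0 (by decide), h0]) (by rw [hF.1 6 (by decide), h6])
      (by rw [hF.1 9 (by decide), h9]) (by rw [hF.2 1 (by decide), h1])
      (by rw [hF.2 2 (by decide), h2]) (by rw [hF.2 3 (by decide), h3]) rfl
      (by rw [hF.2 28 (by decide), h28]) (by rw [hF.2 29 (by decide), h29]) p4 p5) ?_
    rintro s₂ hF₂ ⟨q1, q2⟩
    have b26 : s₂.real 26 = s₁.real 26 := hF₂.2 26 (by decide)
    have key : ∀ x₁ y₁ x₂ y₂ R, Cover n cx cy r x₁ y₁ x₂ y₂ R →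
        (1 - θ) * s₂.real 20 0 ≤ (1 + s₁.real 26 0) * (1 + θ) * R := by
      intro x₁ y₁ x₂ y₂ R hcov
      obtain ⟨k, hk, hsp⟩ := hdirs _ _ _ _ _ hcov
      by_contra hc
      refine q2 k hk _ ?_ hsp
      rw [not_le] at hc
      rw [← mul_div_assoc, le_div_iff₀ (by linarith)]
      linarith
    refine Runs.straight rfl ?_
    simp only [Prog.eff, NExp.eval, RExp.eval, b26]
    refine ⟨by simp; linarith, by simp; linarith, ?_, ?_, ?_, Or.inr ?_⟩
    · simp
      rw [pow_succ] at p3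
      linarith
    · simpa [BestCover] using q1
    · intro x₁ y₁ x₂ y₂ R hcov
      have hR := hcov.nonneg hn hr
      have h7 := key _ _ _ _ _ hcov
      simp
      have hM' : (12 : ℝ) ≤ M := by exact_mod_cast hM
      have h8 : (1 + s₁.real 26 0) * (1 + θ) ≤ (1 + 6 * s₁.real 26 0) * (1 - θ) := by nlinarith
      have h9 : (1 - θ) * s₂.real 20 0 ≤ (1 - θ) * ((1 + 6 * s₁.real 26 0) * R) := by
        nlinarith [mul_le_mul_of_nonneg_right h8 hR]
      have h10 := le_of_mul_le_mul_left h9 (by linarith)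
      refine h10.trans (mul_le_mul_of_nonneg_right ?_ hR)
      nlinarith
    · intro x₁ y₁ x₂ y₂ R hcov
      have h7 := key _ _ _ _ _ hcov
      simp
      have e : 2 * (s₁.real 26 0 / 2) = s₁.real 26 0 := by ring
      rw [e]
      exact h7
  · rintro m s₁ hF ⟨p1, p2, p3, p4, p5, p6⟩ hg
    have a27 : s₁.real 27 0 = θ := by rw [hF.2 27 (by decide), h27]
    simp only [BExp.eval, RExp.eval, NExp.eval, a27, not_not] at hg
    refine ⟨p4, fun x₁ y₁ x₂ y₂ R hcov => ?_⟩
    have hR := hcov.nonneg hn hr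
    rcases p6 with p6 | p6
    · linarith
    · have h7 := p6 _ _ _ _ _ hcov
      -- The final step is below `θ`, so `(1 + 2 * θ) * (1 + θ)` has to be compared with `(1 - θ) *
      -- (1 + ε)`; `θ ≤ ε / 8 ≤ 1 / 8` suffices.
      have h8 : (1 + 2 * s₁.real 26 0) * (1 + θ) ≤ (1 - θ) * (1 + ε) := by nlinarith
      have h9 : (1 - θ) * s₁.real 20 0 ≤ (1 - θ) * ((1 + ε) * R) := by
        nlinarith [mul_le_mul_of_nonneg_right h8 hR]
      exact le_of_mul_le_mul_left h9 (by linarith)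
  · generalize (setR 26 (.div (rv 26) (.lit 2))).maxCost = u₁,
      (BExp.not (.realLt (rv 26) (rv 27))).cost = u₂
    have g0 : 1 ≤ (N + M + 1) * ((n + 1) * (T + 1)) :=
      Nat.mul_pos (by omega) (Nat.mul_pos (by omega) (by omega))
    generalize (N + M + 1) * ((n + 1) * (T + 1)) = Z at *
    have g1 := Nat.mul_le_mul_left (u₁ + u₂ + 1) (Nat.mul_le_mul_left (L + 1) g0)
    nlinarith

/-! ### Preparation -/

/-- Compute the number of disks as a real number. -/
def countDisks : Prog :=
  (setN 1 (.lit 0) ;; setR 35 (.lit 0)) ;; forLoop 1 0 (setR 35 (.add (rv 35) (.lit 1)) ;; incr 1)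

theorem countDisks_runs : ∃ C, ∀ s : State, Runs countDisks s (C * (s.nat 0 0 + 1)) fun s' =>
    s'.real 35 0 = s.nat 0 0 := by
  refine ⟨(setN 1 (.lit 0) ;; setR 35 (.lit 0)).maxCost +
    ((setR 35 (.add (rv 35) (.lit 1)) ;; incr 1).maxCost + 6), fun s => ?_⟩
  refine Runs.mono (Runs.seq (Runs.straight rfl (Q := fun s' => s'.nat 1 0 = 0 ∧ s'.real 35 0 = 0)
    (by simp [Prog.eff, NExp.eval, RExp.eval])) (R := fun s' => s'.real 35 0 = s.nat 0 0)
    (U := (s.nat 0 0 + 1) * ((setR 35 (.add (rv 35) (.lit 1)) ;; incr 1).maxCost + 6)) ?_) ?_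
    fun _ _ h => h
  · rintro s₁ hF ⟨h1, h35⟩
    refine Runs.forLoop (fun i s' => s'.real 35 0 = i) h1 (by rw [hF.1 0 (by decide)])
      (by decide) (by simp [h35]) ?_
    intro i s₂ hF₂ hi hi1 hJ
    refine Runs.straight rfl ?_
    simp [Prog.eff, NExp.eval, RExp.eval, hi1, hJ]
  · generalize (setN 1 (.lit 0) ;; setR 35 (.lit 0)).maxCost = u₁
    nlinarith

/-- Compute the precision and the number of iterations of the ellipsoid method. -/
def setPrecision : Prog :=
  (setR 27 (.lit 1) ;; setN 6 (.lit 1)) ;;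
  .loop (.realLt (rv 0) (.mul (.lit 8) (rv 27)))
    (setR 27 (.div (rv 27) (.lit 2)) ;; setN 6 (.add (nv 6) (.lit 6)))

/-- The precision is a power of two of order `ε`. Every halving adds six ellipsoid iterations
because `(7 / 9) ^ 6 ≤ 1 / 4`; the one extra iteration makes the inequality in `pow_lt_precision`
strict. -/
theorem setPrecision_runs : ∃ C, ∀ s : State, 0 < s.real 0 0 → s.real 0 0 ≤ 1 →
    ∃ j : ℕ, 8 * (1 / 2 : ℝ) ^ j ≤ s.real 0 0 ∧ s.real 0 0 < 16 * (1 / 2 : ℝ) ^ j ∧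
    Runs setPrecision s (C * (j + 1)) fun s' =>
      s'.real 27 0 = (1 / 2 : ℝ) ^ j ∧ s'.nat 6 0 = 6 * j + 1 := by
  refine ⟨(setR 27 (.lit 1) ;; setN 6 (.lit 1)).maxCost +
    ((setR 27 (.div (rv 27) (.lit 2)) ;; setN 6 (.add (nv 6) (.lit 6))).maxCost +
      (BExp.realLt (rv 0) (.mul (.lit 8) (rv 27))).cost + 1), fun s h0 h1 => ?_⟩
  have hex : ∃ j : ℕ, 8 * (1 / 2 : ℝ) ^ j ≤ s.real 0 0 := by
    obtain ⟨j, hj⟩ := exists_pow_lt_of_lt_one (show 0 < s.real 0 0 / 8 by linarith)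
      (show (1 / 2 : ℝ) < 1 by norm_num)
    exact ⟨j, by linarith⟩
  classical
  obtain ⟨j, hj, hmin⟩ : ∃ j : ℕ, 8 * (1 / 2 : ℝ) ^ j ≤ s.real 0 0 ∧
      ∀ i < j, s.real 0 0 < 8 * (1 / 2 : ℝ) ^ i :=
    ⟨Nat.find hex, Nat.find_spec hex, fun i hi => not_le.1 (Nat.find_min hex hi)⟩
  have hj16 : s.real 0 0 < 16 * (1 / 2 : ℝ) ^ j := by
    rcases j with - | j
    · simp; linarith
    · have := hmin j (by omega)
      rw [pow_succ]
      linarith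
  refine ⟨j, hj, hj16, ?_⟩
  refine Runs.mono (Runs.seq (Runs.straight rfl (Q := fun s' => s'.real 27 0 = 1 ∧ s'.nat 6 0 = 1)
    (by simp [Prog.eff, NExp.eval, RExp.eval])) (R := fun s' =>
      s'.real 27 0 = (1 / 2 : ℝ) ^ j ∧ s'.nat 6 0 = 6 * j + 1)
    (U := (j + 1) * ((setR 27 (.div (rv 27) (.lit 2)) ;; setN 6 (.add (nv 6) (.lit 6))).maxCost +
      (BExp.realLt (rv 0) (.mul (.lit 8) (rv 27))).cost + 1)) ?_) ?_ fun _ _ h => h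
  · rintro s₁ hF ⟨a27, a6⟩
    refine Runs.loop (fun m s' => ∃ i, i + m = j ∧ s'.real 27 0 = (1 / 2 : ℝ) ^ i ∧
      s'.nat 6 0 = 6 * i + 1) j ⟨0, by omega, by simp [a27], by simp [a6]⟩ ?_ ?_
    · rintro m s₂ hF₂ ⟨i, him, b27, b6⟩ hg
      have b0 : s₂.real 0 = s.real 0 := by rw [hF₂.2 0 (by decide), hF.2 0 (by decide)]
      simp only [BExp.eval, RExp.eval, NExp.eval, b0, b27] at hg
      push_cast at hg
      obtain ⟨m', rfl⟩ : ∃ m', m = m' + 1 := by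
        refine ⟨m - 1, ?_⟩
        rcases m with - | m
        · obtain rfl : i = j := by omega
          linarith
        · simp
      refine ⟨m', rfl, Runs.straight rfl ⟨i + 1, by omega, ?_, ?_⟩⟩
      · simp [Prog.eff, NExp.eval, RExp.eval, b27, pow_succ]
        ring
      · simp [Prog.eff, NExp.eval, RExp.eval, b6]
        ring
    · rintro m s₂ hF₂ ⟨i, him, b27, b6⟩ hg
      have b0 : s₂.real 0 = s.real 0 := by rw [hF₂.2 0 (by decide), hF.2 0 (by decide)]
      simp only [BExp.eval, RExp.eval, NExp.eval, b0, b27] at hg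
      push_cast at hg
      obtain rfl : i = j := by
        by_contra hne
        exact hg (hmin i (by omega))
      exact ⟨b27, b6⟩
  · generalize (setR 27 (.lit 1) ;; setN 6 (.lit 1)).maxCost = u₁,
      ((setR 27 (.div (rv 27) (.lit 2)) ;; setN 6 (.add (nv 6) (.lit 6))).maxCost +
      (BExp.realLt (rv 0) (.mul (.lit 8) (rv 27))).cost + 1) = u₂
    nlinarith

/-- Find the disk that is farthest from the center of the first one. -/
def farthest : Prog :=
  (setN 1 (.lit 0) ;; setN 3 (.lit 0) ;; setR 10 (.lit (-1))) ;;
  forLoop 1 0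
    (.cond (.realLt (rv 10) (reachE (rv 1) (rv 2)))
      (setR 10 (reachE (rv 1) (rv 2)) ;; setN 3 (nv 1)) .skip ;; incr 1)

theorem farthest_runs : ∃ C, ∀ (s : State) (n : ℕ) (cx cy r : ℕ → ℝ), 1 ≤ n → (∀ i < n, 0 ≤ r i) →
    s.nat 0 0 = n → s.real 1 = cx → s.real 2 = cy → s.real 3 = r →
    Runs farthest s (C * (n + 1)) fun s' => s'.nat 3 0 < n ∧
      ∀ j < n, dd (cx 0) (cy 0) (cx j) (cy j) + r j ≤
        dd (cx 0) (cy 0) (cx (s'.nat 3 0)) (cy (s'.nat 3 0)) + r (s'.nat 3 0) := by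
  refine ⟨(setN 1 (.lit 0) ;; setN 3 (.lit 0) ;; setR 10 (.lit (-1))).maxCost +
    ((BExp.realLt (rv 10) (reachE (rv 1) (rv 2))).cost + ((setR 10 (reachE (rv 1) (rv 2)) ;;
      setN 3 (nv 1)).maxCost + Prog.skip.maxCost) + 1 + (incr 1).maxCost + 6), ?_⟩
  intro s n cx cy r hn hr h0 h1 h2 h3
  refine Runs.mono (Runs.seq (Runs.straight rfl (Q := fun s' => s'.nat 1 0 = 0 ∧ s'.nat 3 0 = 0 ∧
    s'.real 10 0 = -1) (by simp [Prog.eff, NExp.eval, RExp.eval])) (R := fun s' => s'.nat 3 0 < n ∧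
      ∀ j < n, dd (cx 0) (cy 0) (cx j) (cy j) + r j ≤
        dd (cx 0) (cy 0) (cx (s'.nat 3 0)) (cy (s'.nat 3 0)) + r (s'.nat 3 0))
    (U := (n + 1) * ((BExp.realLt (rv 10) (reachE (rv 1) (rv 2))).cost +
      ((setR 10 (reachE (rv 1) (rv 2)) ;; setN 3 (nv 1)).maxCost + Prog.skip.maxCost) + 1 +
      (incr 1).maxCost + 6)) ?_) ?_ fun _ _ h => h
  · rintro s₁ hF ⟨a1, a3, a10⟩
    refine Runs.mono (Runs.forLoop (fun i s' => s'.nat 3 0 < n ∧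
      (s'.real 10 0 = -1 ∨ s'.real 10 0 =
        dd (cx 0) (cy 0) (cx (s'.nat 3 0)) (cy (s'.nat 3 0)) + r (s'.nat 3 0)) ∧
      ∀ j < i, dd (cx 0) (cy 0) (cx j) (cy j) + r j ≤ s'.real 10 0) a1
      (by rw [hF.1 0 (by decide), h0]) (by decide) ⟨by omega, Or.inl a10, by simp⟩ ?_) le_rfl ?_
    · rintro i s₂ hF₂ hi hi1 ⟨hv, hor, hJ⟩
      have b1 : s₂.real 1 = cx := by rw [hF₂.2 1 (by decide), hF.2 1 (by decide), h1]
      have b2 : s₂.real 2 = cy := by rw [hF₂.2 2 (by decide), hF.2 2 (by decide), h2]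
      have b3 : s₂.real 3 = r := by rw [hF₂.2 3 (by decide), hF.2 3 (by decide), h3]
      refine Runs.seq (Runs.cond (Q := fun s' => s'.nat 1 0 = i ∧ s'.nat 3 0 < n ∧
        (s'.real 10 0 = -1 ∨ s'.real 10 0 =
          dd (cx 0) (cy 0) (cx (s'.nat 3 0)) (cy (s'.nat 3 0)) + r (s'.nat 3 0)) ∧
        ∀ j < i + 1, dd (cx 0) (cy 0) (cx j) (cy j) + r j ≤ s'.real 10 0)
        (fun h => Runs.straight rfl ?_) (fun h => Runs.straight rfl ?_))
        (fun s₃ hF₃ h => Runs.straight (p := incr 1) rfl ?_)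
      · simp only [BExp.eval, NExp.eval, RExp.eval, reachE, distE_eval, b1, b2, b3, hi1] at h
        simp only [Prog.eff, NExp.eval, RExp.eval, reachE, distE_eval, b1, b2, b3, hi1]
        simp [b1, b2, b3, hi1, hi]
        intro j hj
        rcases Nat.lt_or_eq_of_le hj with hj | rfl
        · exact (hJ j hj).trans h.le
        · exact le_rfl
      · simp only [BExp.eval, NExp.eval, RExp.eval, reachE, distE_eval, b1, b2, b3, hi1] at h
        refine ⟨hi1, hv, hor, fun j hj => ?_⟩
        rcases Nat.lt_succ_iff_lt_or_eq.1 hj with hj | rfl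
        · exact hJ j hj
        · exact not_lt.1 h
      · obtain ⟨c1, c2⟩ := h
        simpa [Prog.eff, NExp.eval, c1] using c2
    · rintro s₂ hF₂ ⟨hv, hor, hJ⟩
      refine ⟨hv, fun j hj => ?_⟩
      have h5 := hJ 0 hn
      have h6 := hr 0 hn
      rw [dd_self] at h5
      -- The initial value `-1` cannot survive, as disk `0` has nonnegative reach.
      rcases hor with hor | hor
      · linarith
      · rw [← hor]
        exact hJ j hj
  · generalize (setN 1 (.lit 0) ;; setN 3 (.lit 0) ;; setR 10 (.lit (-1))).maxCost = u₁,
      (BExp.realLt (rv 10) (reachE (rv 1) (rv 2))).cost + ((setR 10 (reachE (rv 1) (rv 2)) ;;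
      setN 3 (nv 1)).maxCost + Prog.skip.maxCost) + 1 + (incr 1).maxCost + 6 = u₂
    nlinarith

def coverInit : Prog :=
  setR 22 (rv 1) ;; setR 23 (rv 2) ;; setR 24 (ra 1 3) ;; setR 25 (ra 2 3) ;; setR 20 (.lit 0) ;;
  setN 1 (.lit 0)

def coverStep : Prog :=
  setR 30 (reachE (rv 22) (rv 23)) ;;
  .cond (.realLt (reachE (rv 24) (rv 25)) (rv 30)) (setR 30 (reachE (rv 24) (rv 25))) .skip ;;
  .cond (.realLt (rv 20) (rv 30)) (setR 20 (rv 30)) .skip ;; incr 1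

/-- Compute the smallest cover with the centers of the first disk and of the farthest disk. -/
def firstCover : Prog := farthest ;; coverInit ;; forLoop 1 0 coverStep

theorem coverStep_runs (s : State) : Runs coverStep s coverStep.maxCost fun s' =>
    s'.nat 1 0 = s.nat 1 0 + 1 ∧ s'.real 20 0 = max (s.real 20 0)
      (min (dd (s.real 22 0) (s.real 23 0) (s.real 1 (s.nat 1 0)) (s.real 2 (s.nat 1 0)))
        (dd (s.real 24 0) (s.real 25 0) (s.real 1 (s.nat 1 0)) (s.real 2 (s.nat 1 0))) +
          s.real 3 (s.nat 1 0)) := by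
  refine Runs.mono (Runs.seq (Runs.straight (p := setR 30 (reachE (rv 22) (rv 23))) rfl
    (Q := fun s' => s'.real 30 0 = dd (s.real 22 0) (s.real 23 0) (s.real 1 (s.nat 1 0))
      (s.real 2 (s.nat 1 0)) + s.real 3 (s.nat 1 0))
    (by simp [Prog.eff, NExp.eval, RExp.eval, reachE])) fun s₁ hF₁ a => Runs.seq (Runs.cond
    (Q := fun s' => s'.real 30 0 = min (dd (s.real 22 0) (s.real 23 0) (s.real 1 (s.nat 1 0))
      (s.real 2 (s.nat 1 0)))
        (dd (s.real 24 0) (s.real 25 0) (s.real 1 (s.nat 1 0)) (s.real 2 (s.nat 1 0))) +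
          s.real 3 (s.nat 1 0))
    (fun h => Runs.straight rfl ?_) (fun h => Runs.straight rfl ?_)) fun s₂ hF₂ b =>
    Runs.seq (Runs.cond (Q := fun s' => s'.real 20 0 = max (s.real 20 0)
      (min (dd (s.real 22 0) (s.real 23 0) (s.real 1 (s.nat 1 0)) (s.real 2 (s.nat 1 0)))
        (dd (s.real 24 0) (s.real 25 0) (s.real 1 (s.nat 1 0)) (s.real 2 (s.nat 1 0))) +
          s.real 3 (s.nat 1 0))) (fun h => Runs.straight rfl ?_) (fun h => Runs.straight rfl ?_))
    fun s₃ hF₃ c => Runs.straight (p := incr 1) rfl (Q := fun s' =>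
      s'.nat 1 0 = s.nat 1 0 + 1 ∧ s'.real 20 0 = max (s.real 20 0)
      (min (dd (s.real 22 0) (s.real 23 0) (s.real 1 (s.nat 1 0)) (s.real 2 (s.nat 1 0)))
        (dd (s.real 24 0) (s.real 25 0) (s.real 1 (s.nat 1 0)) (s.real 2 (s.nat 1 0))) +
          s.real 3 (s.nat 1 0))) ?_) le_rfl fun _ _ h => h
  · have e1 : s₁.real 1 = s.real 1 := hF₁.2 1 (by decide)
    have e2 : s₁.real 2 = s.real 2 := hF₁.2 2 (by decide)
    have e3 : s₁.real 3 = s.real 3 := hF₁.2 3 (by decide)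
    have e24 : s₁.real 24 = s.real 24 := hF₁.2 24 (by decide)
    have e25 : s₁.real 25 = s.real 25 := hF₁.2 25 (by decide)
    have f1 : s₁.nat 1 = s.nat 1 := hF₁.1 1 (by decide)
    simp only [BExp.eval, NExp.eval, RExp.eval, reachE, distE_eval, e1, e2, e3, e24, e25, f1, a]
      at h
    simp only [Prog.eff, NExp.eval, RExp.eval, reachE, distE_eval, e1, e2, e3, e24, e25, f1]
    rw [min_eq_right (by linarith)]
    simp
  · have e1 : s₁.real 1 = s.real 1 := hF₁.2 1 (by decide)
    have e2 : s₁.real 2 = s.real 2 := hF₁.2 2 (by decide)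
    have e3 : s₁.real 3 = s.real 3 := hF₁.2 3 (by decide)
    have e24 : s₁.real 24 = s.real 24 := hF₁.2 24 (by decide)
    have e25 : s₁.real 25 = s.real 25 := hF₁.2 25 (by decide)
    have f1 : s₁.nat 1 = s.nat 1 := hF₁.1 1 (by decide)
    simp only [BExp.eval, NExp.eval, RExp.eval, reachE, distE_eval, e1, e2, e3, e24, e25, f1, a]
      at h
    rw [min_eq_left (by linarith)]
    exact a
  · simp only [BExp.eval, NExp.eval, RExp.eval, b] at h
    have e20 : s₂.real 20 = s.real 20 := by rw [hF₂.2 20 (by decide), hF₁.2 20 (by decide)]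
    rw [e20] at h
    rw [max_eq_right h.le]
    simp [Prog.eff, NExp.eval, RExp.eval, b]
  · simp only [BExp.eval, NExp.eval, RExp.eval, b] at h
    have e20 : s₂.real 20 = s.real 20 := by rw [hF₂.2 20 (by decide), hF₁.2 20 (by decide)]
    rw [e20] at h
    rw [max_eq_left (not_lt.1 h)]
    exact congrFun e20 0
  · have f1 : s₃.nat 1 = s.nat 1 := by
      rw [hF₃.1 1 (by decide), hF₂.1 1 (by decide), hF₁.1 1 (by decide)]
    simp only [Prog.eff, NExp.eval]
    exact ⟨by simp [f1], c⟩

/-- The stored radius is either `0` or the demand of some single disk, so the farthest point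
estimate for one disk bounds it. -/
theorem firstCover_runs : ∃ C, ∀ (s : State) (n : ℕ) (cx cy r : ℕ → ℝ), 1 ≤ n →
    (∀ i < n, 0 ≤ r i) → s.nat 0 0 = n → s.real 1 = cx → s.real 2 = cy → s.real 3 = r →
    Runs firstCover s (C * (n + 1)) fun s' => 0 ≤ s'.real 20 0 ∧
      Cover n cx cy r (s'.real 22 0) (s'.real 23 0) (s'.real 24 0) (s'.real 25 0) (s'.real 20 0) ∧
      ∀ x₁ y₁ x₂ y₂ R, Cover n cx cy r x₁ y₁ x₂ y₂ R → s'.real 20 0 ≤ 2 * R := by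
  obtain ⟨C, hC⟩ := farthest_runs
  refine ⟨C + coverInit.maxCost + (coverStep.maxCost + 6), ?_⟩
  intro s n cx cy r hn hr h0 h1 h2 h3
  refine Runs.mono (Runs.seq (hC s n cx cy r hn hr h0 h1 h2 h3) (R := fun s' => 0 ≤ s'.real 20 0 ∧
      Cover n cx cy r (s'.real 22 0) (s'.real 23 0) (s'.real 24 0) (s'.real 25 0) (s'.real 20 0) ∧
      ∀ x₁ y₁ x₂ y₂ R, Cover n cx cy r x₁ y₁ x₂ y₂ R → s'.real 20 0 ≤ 2 * R)
    (U := coverInit.maxCost + (n + 1) * (coverStep.maxCost + 6)) ?_) ?_ fun _ _ h => h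
  · rintro s₁ hF₁ ⟨hv, hmax⟩
    have a1 : s₁.real 1 = cx := by rw [hF₁.2 1 (by decide), h1]
    have a2 : s₁.real 2 = cy := by rw [hF₁.2 2 (by decide), h2]
    have a3 : s₁.real 3 = r := by rw [hF₁.2 3 (by decide), h3]
    obtain ⟨v, hvdef⟩ : ∃ v, s₁.nat 3 0 = v := ⟨_, rfl⟩
    rw [hvdef] at hv hmax
    refine Runs.seq (Runs.straight rfl (Q := fun s' => s'.real 22 0 = cx 0 ∧ s'.real 23 0 = cy 0 ∧
      s'.real 24 0 = cx v ∧ s'.real 25 0 = cy v ∧ s'.real 20 0 = 0 ∧ s'.nat 1 0 = 0)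
      (by simp [coverInit, Prog.eff, NExp.eval, RExp.eval, a1, a2, hvdef])) ?_
    rintro s₂ hF₂ ⟨b22, b23, b24, b25, b20, b1⟩
    refine Runs.mono (Runs.forLoop (B := coverStep.maxCost) (fun i s' => 0 ≤ s'.real 20 0 ∧
      Cover i cx cy r (cx 0) (cy 0) (cx v) (cy v) (s'.real 20 0) ∧
      (s'.real 20 0 = 0 ∨ ∃ j < n, s'.real 20 0 = min (dd (cx 0) (cy 0) (cx j) (cy j))
        (dd (cx v) (cy v) (cx j) (cy j)) + r j)) b1
      (by rw [hF₂.1 0 (by decide), hF₁.1 0 (by decide), h0]) (by decide)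
      ⟨b20.ge, by simp [Cover], Or.inl b20⟩ ?_) le_rfl ?_
    · rintro i s₃ hF₃ hi hi1 ⟨g1, g2, g3⟩
      refine Runs.mono (coverStep_runs s₃) le_rfl ?_
      rintro s₄ - ⟨k1, k20⟩
      rw [hi1, hF₃.2 22 (by decide), hF₃.2 23 (by decide), hF₃.2 24 (by decide),
        hF₃.2 25 (by decide), hF₃.2 1 (by decide), hF₃.2 2 (by decide), hF₃.2 3 (by decide),
        hF₂.2 1 (by decide), hF₂.2 2 (by decide), hF₂.2 3 (by decide), a1, a2, a3, b22, b23, b24,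
        b25] at k20
      have hle : s₃.real 20 0 ≤ s₄.real 20 0 := by rw [k20]; exact le_max_left _ _
      have hle' : min (dd (cx 0) (cy 0) (cx i) (cy i)) (dd (cx v) (cy v) (cx i) (cy i)) + r i ≤
        s₄.real 20 0 := by rw [k20]; exact le_max_right _ _
      refine ⟨by rw [k1, hi1], g1.trans hle, fun j hj => ?_, ?_⟩
      · rcases Nat.lt_succ_iff_lt_or_eq.1 hj with hj | rfl
        · exact (g2 j hj).imp (fun h => h.trans hle) fun h => h.trans hle
        · rcases min_choice (dd (cx 0) (cy 0) (cx j) (cy j)) (dd (cx v) (cy v) (cx j) (cy j)) with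
            h | h
          · left; rwa [h] at hle'
          · right; rwa [h] at hle'
      · rcases max_choice (s₃.real 20 0) (min (dd (cx 0) (cy 0) (cx i) (cy i))
          (dd (cx v) (cy v) (cx i) (cy i)) + r i) with h | h
        · rw [k20, h]
          exact g3
        · right
          exact ⟨i, hi, by rw [k20, h]⟩
    · rintro s₃ hF₃ ⟨g1, g2, g3⟩
      rw [hF₃.2 22 (by decide), hF₃.2 23 (by decide), hF₃.2 24 (by decide), hF₃.2 25 (by decide),
        b22, b23, b24, b25]
      refine ⟨g1, g2, fun x₁ y₁ x₂ y₂ R hcov => ?_⟩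
      rcases g3 with g3 | ⟨j, hj, g3⟩
      · linarith [hcov.nonneg hn hr]
      · rw [g3, dd_comm (cx 0), dd_comm (cx v)]
        refine two_approx n cx cy r hr v j hn hv hj (fun k hk => ?_) x₁ y₁ x₂ y₂ R hcov
        rw [dd_comm (cx k), dd_comm (cx v)]
        exact hmax k hk
  · generalize coverInit.maxCost = u₁, coverStep.maxCost + 6 = u₂
    nlinarith

/-- The direction `(x, y)` is stored. -/
def HasDir (s : State) (x y : ℝ) : Prop :=
  ∃ m < s.nat 9 0, s.real 28 m = x ∧ s.real 29 m = y

/-- Append a direction. -/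
def pushDir (x y : RExp) : Prog :=
  .setReal 28 (nv 9) x ;; .setReal 29 (nv 9) y ;; incr 9

/-- The list of directions grows by `c` entries, and then contains all of `W`. -/
def Grow (c : ℕ) (W : Set (ℝ × ℝ)) (s s' : State) : Prop :=
  s'.nat 9 0 = s.nat 9 0 + c ∧ (∀ x y, HasDir s x y → HasDir s' x y) ∧
    ∀ w ∈ W, HasDir s' w.1 w.2

theorem pushDir_runs (s : State) (x y : RExp) (a b : ℝ) (ha : x.eval s = a)
    (hb : y.eval (s.setReal 28 (s.nat 9 0) a) = b) :
    Runs (pushDir x y) s (pushDir x y).maxCost (Grow 1 {(a, b)} s) := by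
  refine Runs.straight rfl ?_
  simp only [pushDir, Prog.eff, NExp.eval, ha, hb]
  refine ⟨by simp [NExp.eval], ?_, ?_⟩
  · rintro x y ⟨m, hm, h1, h2⟩
    refine ⟨m, by simp; omega, ?_, ?_⟩
    · simp [hm.ne, h1]
    · simp [hm.ne, h2]
  · rintro w rfl
    exact ⟨s.nat 9 0, by simp, by simp, by simp⟩

/-- Repeat `p` for all values of the counter `a`. -/
def forAll (a : ℕ) (p : Prog) : Prog := setN a (.lit 0) ;; forLoop a 0 (p ;; incr a)

/-- Formulated with `Grow` so that it nests: the conclusion for an inner loop is the hypothesis for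
the body of the outer one, with the counts multiplied and the sets united. -/
theorem forAll_runs {a : ℕ} {p : Prog} {n B c : ℕ} {W : ℕ → Set (ℝ × ℝ)} {s : State}
    (ha0 : a ≠ 0) (ha9 : a ≠ 9) (hpa : a ∉ p.natWrites) (hp0 : 0 ∉ p.natWrites)
    (hn : s.nat 0 0 = n)
    (hp : ∀ i s', Frame (forAll a p) s s' → i < n → s'.nat a 0 = i → Runs p s' B (Grow c (W i) s')) :
    Runs (forAll a p) s ((setN a (.lit 0)).maxCost + (n + 1) * (B + (incr a).maxCost + 6))
      (Grow (n * c) {w | ∃ i < n, w ∈ W i} s) := by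
  have hfr : ∀ s₁ s₂, Frame (setN a (.lit 0)) s s₁ → Frame (p ;; incr a) s₁ s₂ →
      Frame (forAll a p) s s₂ := by
    intro s₁ s₂ h1 h2
    constructor
    · intro b hb
      simp only [forAll, Prog.natWrites, List.mem_append, not_or] at hb
      rw [h2.1 b (by simp only [Prog.natWrites, List.mem_append, not_or]; exact hb.2),
        h1.1 b (by simp only [Prog.natWrites]; exact hb.1)]
    · intro b hb
      simp only [forAll, Prog.realWrites, List.mem_append, not_or] at hb
      rw [h2.2 b (by simp only [Prog.realWrites, List.mem_append, not_or]; exact hb.2),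
        h1.2 b (by simp only [Prog.realWrites]; exact hb.1)]
  refine Runs.seq (Runs.straight rfl (Q := fun s' => s'.nat a 0 = 0 ∧ s'.nat 9 = s.nat 9 ∧
    s'.nat 0 = s.nat 0 ∧ s'.real = s.real) ?_) ?_
  · refine ⟨by simp [Prog.eff, NExp.eval], ?_, ?_, rfl⟩
    · funext i
      simp [Prog.eff, NExp.eval, ha9.symm]
    · funext i
      simp [Prog.eff, NExp.eval, ha0.symm]
  rintro s₁ hF₁ ⟨h1, h2, h3, h4⟩
  have hdir : ∀ x y, HasDir s x y → HasDir s₁ x y := by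
    intro x y h
    simpa only [HasDir, h2, h4] using h
  refine Runs.mono (Runs.forLoop (fun i s' => Grow (i * c) {w | ∃ i' < i, w ∈ W i'} s s') h1
    (by rw [h3, hn]) ?_ ⟨by simp [h2], hdir, by simp⟩ ?_) le_rfl fun _ _ h => h
  · simp only [Prog.natWrites, List.mem_append, not_or, List.mem_singleton]
    exact ⟨hp0, ha0.symm⟩
  · intro i s₂ hF₂ hi hi1 hJ
    refine Runs.seq (hp i s₂ (hfr s₁ s₂ hF₁ hF₂) hi hi1) fun s₃ hF₃ hG =>
      Runs.straight (p := incr a) rfl ?_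
    have e9 : ((incr a).eff s₃).nat 9 0 = s₃.nat 9 0 := by
      simp [Prog.eff, NExp.eval, ha9.symm]
    have hdir' : ∀ x y, HasDir s₃ x y → HasDir ((incr a).eff s₃) x y := by
      rintro x y ⟨m, hm, g⟩
      exact ⟨m, by rw [e9]; exact hm, g⟩
    refine ⟨?_, ?_, ?_, ?_⟩
    · have : s₃.nat a = s₂.nat a := hF₃.1 a hpa
      simp [Prog.eff, NExp.eval, this, hi1]
    · rw [e9, hG.1, hJ.1]
      ring
    · exact fun x y h => hdir' _ _ (hG.2.1 _ _ (hJ.2.1 _ _ h))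
    · rintro w ⟨i', hi', hw⟩
      rcases Nat.lt_succ_iff_lt_or_eq.1 hi' with h | rfl
      · exact hdir' _ _ (hG.2.1 _ _ (hJ.2.2 _ ⟨i', h, hw⟩))
      · exact hdir' _ _ (hG.2.2 _ hw)

/-- A coordinate of the bisector of two differences of centers. -/
def bisectE (a : ℕ) : RExp :=
  .add (.mul (distE (ra 1 12) (ra 2 12) (ra 1 13) (ra 2 13)) (.sub (ra a 10) (ra a 11)))
    (.mul (distE (ra 1 10) (ra 2 10) (ra 1 11) (ra 2 11)) (.sub (ra a 12) (ra a 13)))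

def pushBisector : Prog := pushDir (bisectE 1) (bisectE 2)

/-- The directions for few disks: the bisectors of all pairs of differences of centers. -/
def pairDirs : Prog :=
  setN 9 (.lit 0) ;; forAll 10 (forAll 11 (forAll 12 (forAll 13 pushBisector)))

noncomputable def bisect (cx cy z : ℕ → ℝ) (i j k l : ℕ) : ℝ :=
  dd (cx k) (cy k) (cx l) (cy l) * (z i - z j) + dd (cx i) (cy i) (cx j) (cy j) * (z k - z l)

theorem nest_cost {B C u v n d : ℕ} (h : B ≤ C * (n + 1) ^ d) :
    u + (n + 1) * (B + v + 6) ≤ (u + C + v + 6) * (n + 1) ^ (d + 1) := by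
  have h1 : 1 ≤ (n + 1) ^ d := Nat.one_le_pow _ _ (by omega)
  have h2 : (n + 1) ≤ (n + 1) * (n + 1) ^ d := Nat.le_mul_of_pos_right _ h1
  have h3 : B + v + 6 ≤ (C + v + 6) * (n + 1) ^ d := by nlinarith
  have h4 := Nat.mul_le_mul_left (n + 1) h3
  have h5 : u ≤ u * ((n + 1) * (n + 1) ^ d) := Nat.le_mul_of_pos_right _ (by positivity)
  calc u + (n + 1) * (B + v + 6) ≤ u * ((n + 1) * (n + 1) ^ d) +
        (n + 1) * ((C + v + 6) * (n + 1) ^ d) := by omega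
    _ = _ := by ring

theorem pairDirs_runs : ∃ C, ∀ (s : State) (n : ℕ) (cx cy r : ℕ → ℝ), 1 ≤ n → s.nat 0 0 = n →
    s.real 1 = cx → s.real 2 = cy →
    Runs pairDirs s (C * (n + 1) ^ 4) fun s' => s'.nat 9 0 = n ^ 4 ∧
      ∀ x₁ y₁ x₂ y₂ R, Cover n cx cy r x₁ y₁ x₂ y₂ R →
        ∃ k < s'.nat 9 0, Split n cx cy r (s'.real 28 k) (s'.real 29 k) R := by
  refine ⟨(setN 9 (.lit 0)).maxCost + ((setN 10 (.lit 0)).maxCost + ((setN 11 (.lit 0)).maxCost +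
    ((setN 12 (.lit 0)).maxCost + ((setN 13 (.lit 0)).maxCost +
    pushBisector.maxCost + (incr 13).maxCost + 6) +
    (incr 12).maxCost + 6) + (incr 11).maxCost + 6) + (incr 10).maxCost + 6), ?_⟩
  intro s n cx cy r hn h0 h1 h2
  refine Runs.mono (Runs.seq (Runs.straight rfl (Q := fun s' => s'.nat 9 0 = 0)
    (by simp [Prog.eff, NExp.eval])) (R := fun s' => s'.nat 9 0 = n ^ 4 ∧
      ∀ x₁ y₁ x₂ y₂ R, Cover n cx cy r x₁ y₁ x₂ y₂ R →
        ∃ k < s'.nat 9 0, Split n cx cy r (s'.real 28 k) (s'.real 29 k) R)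
    (fun s₁ hF₁ a9 => Runs.mono (forAll_runs (a := 10)
      (p := forAll 11 (forAll 12 (forAll 13 pushBisector))) (n := n) (c := n * (n * (n * 1)))
      (W := fun i => {w | ∃ j < n, w ∈ {w | ∃ k < n, w ∈ {w | ∃ l < n,
        w ∈ ({(bisect cx cy cx i j k l, bisect cx cy cy i j k l)} : Set (ℝ × ℝ))}}})
      (by decide) (by decide) (by decide) (by decide) (by rw [hF₁.1 0 (by decide), h0])
    fun i s₂ hF₂ hi e10 => forAll_runs (a := 11)
      (p := forAll 12 (forAll 13 pushBisector)) (n := n)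
      (by decide) (by decide) (by decide) (by decide)
      (by rw [hF₂.1 0 (by decide), hF₁.1 0 (by decide), h0])
    fun j s₃ hF₃ hj e11 => forAll_runs (a := 12) (p := forAll 13 pushBisector) (n := n)
      (by decide) (by decide) (by decide) (by decide)
      (by rw [hF₃.1 0 (by decide), hF₂.1 0 (by decide), hF₁.1 0 (by decide), h0])
    fun k s₄ hF₄ hk e12 => forAll_runs (a := 13) (p := pushBisector) (n := n)
      (B := pushBisector.maxCost)
      (by decide) (by decide) (by decide) (by decide)
      (by rw [hF₄.1 0 (by decide), hF₃.1 0 (by decide), hF₂.1 0 (by decide), hF₁.1 0 (by decide),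
        h0])
    fun l s₅ hF₅ hl e13 => ?_) le_rfl ?_)) ?_ fun _ _ h => h
  · have b1 : s₅.real 1 = cx := by
      rw [hF₅.2 1 (by decide), hF₄.2 1 (by decide), hF₃.2 1 (by decide), hF₂.2 1 (by decide),
        hF₁.2 1 (by decide), h1]
    have b2 : s₅.real 2 = cy := by
      rw [hF₅.2 2 (by decide), hF₄.2 2 (by decide), hF₃.2 2 (by decide), hF₂.2 2 (by decide),
        hF₁.2 2 (by decide), h2]
    have c10 : s₅.nat 10 0 = i := by
      rw [hF₅.1 10 (by decide), hF₄.1 10 (by decide), hF₃.1 10 (by decide), e10]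
    have c11 : s₅.nat 11 0 = j := by rw [hF₅.1 11 (by decide), hF₄.1 11 (by decide), e11]
    have c12 : s₅.nat 12 0 = k := by rw [hF₅.1 12 (by decide), e12]
    refine pushDir_runs s₅ _ _ _ _ ?_ ?_
    · simp [bisectE, bisect, RExp.eval, NExp.eval, b1, b2, c10, c11, c12, e13]
    · simp [bisectE, bisect, RExp.eval, NExp.eval, b1, b2, c10, c11, c12, e13]
  · rintro s' - ⟨q1, -, q3⟩
    refine ⟨by rw [q1, a9]; ring, fun x₁ y₁ x₂ y₂ R hcov => ?_⟩
    obtain ⟨i, hi, j, hj, k, hk, l, hl, hsp⟩ :=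
      exists_split_of_pairs n hn cx cy r x₁ y₁ x₂ y₂ R hcov
    obtain ⟨m, hm, hmx, hmy⟩ := q3 (bisect cx cy cx i j k l, bisect cx cy cy i j k l)
      ⟨i, hi, j, hj, k, hk, l, hl, rfl⟩
    refine ⟨m, hm, ?_⟩
    rw [hmx, hmy]
    exact hsp
  · generalize pushBisector.maxCost = u₀
    have g1 := nest_cost (u := (setN 13 (.lit 0)).maxCost) (v := (incr 13).maxCost) (n := n) (d := 0)
      (show u₀ ≤ u₀ * (n + 1) ^ 0 by simp)
    have g2 := nest_cost (u := (setN 12 (.lit 0)).maxCost) (v := (incr 12).maxCost) g1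
    have g3 := nest_cost (u := (setN 11 (.lit 0)).maxCost) (v := (incr 11).maxCost) g2
    have g4 := nest_cost (u := (setN 10 (.lit 0)).maxCost) (v := (incr 10).maxCost) g3
    refine (Nat.add_le_add (Nat.le_mul_of_pos_right _ ?_) g4).trans_eq (add_mul _ _ _).symm
    exact Nat.pow_pos (Nat.succ_pos n)

/-- The directions for many disks: a fine net. -/
def netDirs : Prog :=
  (setN 9 (.lit 0) ;; setR 36 (.lit (-1))) ;;
  .loop (.not (.realLt (.lit 1) (rv 36)))
    (pushDir (.lit 1) (rv 36) ;; pushDir (rv 36) (.lit 1) ;;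
      setR 36 (.add (rv 36) (.div (rv 27) (.lit 8))))

/-- Step `h = (1 / 2) ^ j / 8` makes the loss `6 * h` at most the precision, and divides `[-1, 1]`
into exactly `16 * 2 ^ j` intervals. Both `(1, s)` and `(s, 1)` are stored for each of the grid
points. -/
theorem netDirs_runs : ∃ C, ∀ (s : State) (n j : ℕ) (cx cy r : ℕ → ℝ), (∀ i < n, 0 ≤ r i) →
    s.real 27 0 = (1 / 2 : ℝ) ^ j →
    Runs netDirs s (C * (2 ^ j)) fun s' => s'.nat 9 0 = 2 * (16 * 2 ^ j + 1) ∧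
      ∀ x₁ y₁ x₂ y₂ R, 0 ≤ R → Cover n cx cy r x₁ y₁ x₂ y₂ R →
        ∃ k < s'.nat 9 0, Split n cx cy r (s'.real 28 k) (s'.real 29 k)
          ((1 + (1 / 2 : ℝ) ^ j) * R) := by
  refine ⟨(setN 9 (.lit 0) ;; setR 36 (.lit (-1))).maxCost + 18 * ((pushDir (.lit 1) (rv 36) ;;
    pushDir (rv 36) (.lit 1) ;; setR 36 (.add (rv 36) (.div (rv 27) (.lit 8)))).maxCost +
    (BExp.not (.realLt (.lit 1) (rv 36))).cost + 1), ?_⟩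
  intro s n j cx cy r hr h27
  set h : ℝ := (1 / 2 : ℝ) ^ j / 8 with hh
  have hh0 : 0 < h := by positivity
  have hh1 : h ≤ 1 / 8 := by
    have : (1 / 2 : ℝ) ^ j ≤ 1 := pow_le_one₀ (by norm_num) (by norm_num)
    linarith
  have hhN : (16 * 2 ^ j : ℝ) * h = 2 := by
    rw [hh, one_div, inv_pow]
    field_simp
    norm_num
  refine Runs.mono (Runs.seq (Runs.straight rfl (Q := fun s' => s'.nat 9 0 = 0 ∧ s'.real 36 0 = -1)
    (by simp [Prog.eff, NExp.eval, RExp.eval])) (R := fun s' => s'.nat 9 0 = 2 * (16 * 2 ^ j + 1) ∧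
      ∀ x₁ y₁ x₂ y₂ R, 0 ≤ R → Cover n cx cy r x₁ y₁ x₂ y₂ R →
        ∃ k < s'.nat 9 0, Split n cx cy r (s'.real 28 k) (s'.real 29 k)
          ((1 + (1 / 2 : ℝ) ^ j) * R))
    (U := (16 * 2 ^ j + 1 + 1) * ((pushDir (.lit 1) (rv 36) ;;
    pushDir (rv 36) (.lit 1) ;; setR 36 (.add (rv 36) (.div (rv 27) (.lit 8)))).maxCost +
    (BExp.not (.realLt (.lit 1) (rv 36))).cost + 1)) ?_) ?_ fun _ _ h => h
  · rintro s₁ hF₁ ⟨a9, a36⟩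
    refine Runs.loop (fun m s' => ∃ k, k + m = 16 * 2 ^ j + 1 ∧ s'.nat 9 0 = 2 * k ∧
      s'.real 36 0 = -1 + k * h ∧ ∀ k' < k, HasDir s' 1 (-1 + k' * h) ∧
        HasDir s' (-1 + k' * h) 1) (16 * 2 ^ j + 1)
      ⟨0, by omega, by simp [a9], by simp [a36], by simp⟩ ?_ ?_
    · rintro m s₂ hF₂ ⟨k, hkm, b9, b36, hdir⟩ hg
      simp only [BExp.eval, RExp.eval, NExp.eval, b36, not_lt] at hg
      push_cast at hg
      have hk : k ≤ 16 * 2 ^ j := by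
        have : (k : ℝ) * h ≤ (16 * 2 ^ j : ℝ) * h := by rw [hhN]; linarith
        have := le_of_mul_le_mul_right this hh0
        exact_mod_cast this
      refine ⟨m - 1, by omega, ?_⟩
      refine Runs.seq (pushDir_runs s₂ _ _ 1 (-1 + k * h) (by simp [RExp.eval])
        (by simp [RExp.eval, NExp.eval, b36])) fun s₃ hF₃ hG₃ => ?_
      have c36 : s₃.real 36 0 = -1 + k * h := by rw [hF₃.2 36 (by decide), b36]
      refine Runs.seq (pushDir_runs s₃ _ _ (-1 + k * h) 1 (by simp [RExp.eval, NExp.eval, c36])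
        (by simp [RExp.eval, NExp.eval])) fun s₄ hF₄ hG₄ => ?_
      have d36 : s₄.real 36 0 = -1 + k * h := by rw [hF₄.2 36 (by decide), c36]
      have d27 : s₄.real 27 0 = (1 / 2 : ℝ) ^ j := by
        rw [hF₄.2 27 (by decide), hF₃.2 27 (by decide), hF₂.2 27 (by decide),
          hF₁.2 27 (by decide), h27]
      refine Runs.straight rfl ⟨k + 1, by omega, ?_, ?_, fun k' hk' => ?_⟩
      · simp only [Prog.eff, setReal_nat]
        rw [hG₄.1, hG₃.1, b9]
        ring
      · simp [Prog.eff, RExp.eval, NExp.eval, d36, d27]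
        rw [hh, one_div, inv_pow]
        ring
      · have hset : ∀ x y, HasDir s₄ x y → HasDir ((setR 36 (.add (rv 36)
            (.div (rv 27) (.lit 8)))).eff s₄) x y := by
          rintro x y ⟨m, hm, e1, e2⟩
          exact ⟨m, hm, by simpa [Prog.eff] using e1, by simpa [Prog.eff] using e2⟩
        rcases Nat.lt_succ_iff_lt_or_eq.1 hk' with hlt | rfl
        · exact ⟨hset _ _ (hG₄.2.1 _ _ (hG₃.2.1 _ _ (hdir k' hlt).1)),
            hset _ _ (hG₄.2.1 _ _ (hG₃.2.1 _ _ (hdir k' hlt).2))⟩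
        · exact ⟨hset _ _ (hG₄.2.1 _ _ (hG₃.2.2 _ rfl)), hset _ _ (hG₄.2.2 _ rfl)⟩
    · rintro m s₂ hF₂ ⟨k, hkm, b9, b36, hdir⟩ hg
      simp only [BExp.eval, RExp.eval, NExp.eval, b36, not_lt, not_le] at hg
      push_cast at hg
      have hk : 16 * 2 ^ j < k := by
        have : (16 * 2 ^ j : ℝ) * h < (k : ℝ) * h := by rw [hhN]; linarith
        have := lt_of_mul_lt_mul_right this hh0.le
        exact_mod_cast this
      obtain rfl : k = 16 * 2 ^ j + 1 := by omega
      refine ⟨b9, fun x₁ y₁ x₂ y₂ R hR hcov => ?_⟩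
      have hle : (1 + 6 * h) * R ≤ (1 + (1 / 2 : ℝ) ^ j) * R := by
        refine mul_le_mul_of_nonneg_right ?_ hR
        linarith
      obtain ⟨t, ⟨k, hk', rfl⟩, hsp⟩ := exists_split_of_net n cx cy r hr x₁ y₁ x₂ y₂ R h hcov hh0.le
        (by linarith) {t | ∃ k : ℕ, k < 16 * 2 ^ j + 1 ∧ t = -1 + k * h} (by
          intro t ht1 ht2
          -- Rounding down to the grid occurs only in the proof; the program merely adds the step
          -- repeatedly.
          have h0 : 0 ≤ (t + 1) / h := div_nonneg (by linarith) hh0.le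
          have hf1 := Nat.floor_le h0
          have hf2 := Nat.lt_floor_add_one ((t + 1) / h)
          rw [le_div_iff₀ hh0] at hf1
          rw [div_lt_iff₀ hh0] at hf2
          refine ⟨_, ⟨⌊(t + 1) / h⌋₊, ?_, rfl⟩, ?_⟩
          · have : ((⌊(t + 1) / h⌋₊ : ℕ) : ℝ) * h ≤ (16 * 2 ^ j : ℝ) * h := by
              rw [hhN]; linarith
            have := le_of_mul_le_mul_right this hh0
            have : ⌊(t + 1) / h⌋₊ ≤ 16 * 2 ^ j := by exact_mod_cast this
            omega
          · rw [abs_le]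
            constructor <;> linarith)
      obtain ⟨⟨m₁, hm₁, e1, e2⟩, ⟨m₂, hm₂, e3, e4⟩⟩ := hdir k hk'
      rcases hsp with hsp | hsp
      · exact ⟨m₁, hm₁, by rw [e1, e2]; exact hsp.mono hle⟩
      · exact ⟨m₂, hm₂, by rw [e3, e4]; exact hsp.mono hle⟩
  · generalize (setN 9 (.lit 0) ;; setR 36 (.lit (-1))).maxCost = u₁,
      (pushDir (.lit 1) (rv 36) ;; pushDir (rv 36) (.lit 1) ;;
      setR 36 (.add (rv 36) (.div (rv 27) (.lit 8)))).maxCost +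
      (BExp.not (.realLt (.lit 1) (rv 36))).cost + 1 = u₂
    have hp : 1 ≤ 2 ^ j := Nat.one_le_two_pow
    nlinarith

/-! ### Choice of the directions and assembly of the algorithm. -/

def sqE (e : RExp) : RExp := .mul e e

@[simp] theorem sqE_eval (s : State) (e : RExp) : (sqE e).eval s = e.eval s * e.eval s := rfl

/-- Improve the first cover, with directions that depend on the number of disks. -/
def search : Prog :=
  .cond (.realLt (.lit 1) (.mul (sqE (sqE (sqE (rv 35)))) (rv 0)))
    (netDirs ;; setR 26 (rv 27) ;; levels) (pairDirs ;; setR 26 (.lit 1) ;; levels)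

theorem pow_lt_precision (j : ℕ) : (7 / 9 : ℝ) ^ (6 * j + 1) < ((1 / 2 : ℝ) ^ j) ^ 2 := by
  have h1 : ((7 / 9 : ℝ) ^ 6) ^ j ≤ ((1 / 2 : ℝ) ^ 2) ^ j :=
    pow_le_pow_left₀ (by norm_num) (by norm_num) j
  rw [pow_succ, pow_mul, ← pow_mul (1 / 2 : ℝ), mul_comm j 2, pow_mul (1 / 2 : ℝ)]
  have h2 : 0 < ((1 / 2 : ℝ) ^ 2) ^ j := by positivity
  linarith

/-- The two cases balance the number of directions against the number of levels. The net is too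
large to be traversed on every level, so it gets a single pass with the finest step; the `n ^ 4`
bisectors are traversed on each of `j + 1` levels with boundedly many improvements. -/
theorem search_runs : ∃ C : ℕ, ∀ (s : State) (n j : ℕ) (cx cy r : ℕ → ℝ) (ε : ℝ), 1 ≤ n →
    (∀ i < n, 0 ≤ r i) → 0 < ε → ε ≤ 1 → 8 * (1 / 2 : ℝ) ^ j ≤ ε →
    s.nat 0 0 = n → s.nat 6 0 = 6 * j + 1 → s.real 0 0 = ε → s.real 1 = cx →
    s.real 2 = cy → s.real 3 = r → s.real 27 0 = (1 / 2 : ℝ) ^ j → s.real 35 0 = n →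
    BestCover n cx cy r s →
    (∀ x₁ y₁ x₂ y₂ R, Cover n cx cy r x₁ y₁ x₂ y₂ R → s.real 20 0 ≤ 2 * R) →
    Runs search s (C * if 1 < (n : ℝ) ^ 8 * ε then n * 2 ^ j * (j + 1) else n ^ 5 * (j + 1) ^ 2)
      fun s' => BestCover n cx cy r s' ∧ ∀ x₁ y₁ x₂ y₂ R, Cover n cx cy r x₁ y₁ x₂ y₂ R →
        s'.real 20 0 ≤ (1 + ε) * R := by
  obtain ⟨C₁, hC₁⟩ := netDirs_runs
  obtain ⟨C₂, hC₂⟩ := pairDirs_runs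
  obtain ⟨C₃, hC₃⟩ := levels_runs
  obtain ⟨b, hb⟩ : ∃ b : BExp, b = .realLt (.lit 1) (.mul (sqE (sqE (sqE (rv 35)))) (rv 0)) :=
    ⟨_, rfl⟩
  refine ⟨b.cost + 1 + (setR 26 (rv 27)).maxCost + (setR 26 (.lit 1)).maxCost + C₁ + 16 * C₂ +
    1152 * C₃, ?_⟩
  intro s n j cx cy r ε hn hr hε hε1 hjε h0 h6 h00 h1 h2 h3 h27 h35 hbest htwo
  have hbe : b.eval s ↔ 1 < (n : ℝ) ^ 8 * ε := by
    simp only [hb, BExp.eval, RExp.eval, NExp.eval, sqE_eval, h35, h00]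
    push_cast
    rw [show (n : ℝ) * n * (n * n) * (n * n * (n * n)) = (n : ℝ) ^ 8 by ring]
  set θ : ℝ := (1 / 2 : ℝ) ^ j with hθ
  have hθ0 : 0 < θ := by positivity
  have hθ1 : θ ≤ 1 := by linarith
  have hθ2 : (2 : ℝ) ^ j * θ = 1 := by
    rw [hθ, ← mul_pow]
    norm_num
  have hn1 : 1 ≤ n ^ 4 := Nat.one_le_pow _ _ hn
  have hp : 1 ≤ 2 ^ j := Nat.one_le_two_pow
  generalize hu₀ : b.cost = u₀
  unfold search
  rw [← hb]
  by_cases hbs : b.eval s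
  · rw [if_pos (hbe.1 hbs)]
    refine Runs.mono (Runs.cond (U := 0) (T := C₁ * 2 ^ j + ((setR 26 (rv 27)).maxCost +
      C₃ * ((1 + 1) * ((2 * (16 * 2 ^ j + 1) + (2 ^ j + 12) + 1) * ((n + 1) * (6 * j + 1 + 1))))))
      (fun _ => ?_) fun h => absurd hbs h) ?_ fun _ _ h => h
    · refine Runs.seq (hC₁ s n j cx cy r hr h27) ?_
      rintro s₁ hF₁ ⟨a9, hdirs⟩
      have a27 : s₁.real 27 0 = θ := by rw [hF₁.2 27 (by decide), h27]
      refine Runs.seq (Runs.straight rfl (Q := fun s' => s'.real 26 0 = θ)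
        (by simp [Prog.eff, NExp.eval, RExp.eval, a27])) ?_
      intro s₂ hF₂ b26
      have b20 : s₂.real 20 = s.real 20 := by rw [hF₂.2 20 (by decide), hF₁.2 20 (by decide)]
      have b28 : s₂.real 28 = s₁.real 28 := hF₂.2 28 (by decide)
      have b29 : s₂.real 29 = s₁.real 29 := hF₂.2 29 (by decide)
      -- One level suffices, starting at `η = θ`. Then `M = 2 ^ j + 12` gives `M * θ ≥ 1`, which
      -- turns the 2-approximation into the required initial bound.
      refine hC₃ s₂ n (6 * j + 1) (2 * (16 * 2 ^ j + 1)) (2 ^ j + 12) 1 cx cy r _ _ θ θ ε hθ0 le_rfl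
        hθ1 hjε hε1 (by linarith) (by omega) (pow_lt_precision j) hn hr
        (by rw [hF₂.1 0 (by decide), hF₁.1 0 (by decide), h0])
        (by rw [hF₂.1 6 (by decide), hF₁.1 6 (by decide), h6])
        (by rw [hF₂.1 9 (by decide), a9])
        (by rw [hF₂.2 1 (by decide), hF₁.2 1 (by decide), h1])
        (by rw [hF₂.2 2 (by decide), hF₁.2 2 (by decide), h2])
        (by rw [hF₂.2 3 (by decide), hF₁.2 3 (by decide), h3])
        b26 (by rw [hF₂.2 27 (by decide), a27]) b28 b29 ?_ ?_ ?_
      · rw [BestCover, b20, hF₂.2 22 (by decide), hF₂.2 23 (by decide), hF₂.2 24 (by decide),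
          hF₂.2 25 (by decide), hF₁.2 22 (by decide), hF₁.2 23 (by decide), hF₁.2 24 (by decide),
          hF₁.2 25 (by decide)]
        exact hbest
      · intro x₁ y₁ x₂ y₂ R hcov
        have hR := hcov.nonneg hn hr
        rw [b20]
        refine (htwo _ _ _ _ _ hcov).trans (mul_le_mul_of_nonneg_right ?_ hR)
        push_cast
        rw [add_mul, hθ2]
        linarith
      · intro x₁ y₁ x₂ y₂ R hcov
        rw [a9] at hdirs
        exact hdirs _ _ _ _ _ (hcov.nonneg hn hr) hcov
    · rw [hu₀]
      generalize (setR 26 (rv 27)).maxCost = u₁, (setR 26 (.lit 1)).maxCost = u₂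
      have hW1 : 1 ≤ n * 2 ^ j * (j + 1) := Nat.mul_pos (Nat.mul_pos hn hp) (by omega)
      have hW2 : 2 ^ j ≤ n * 2 ^ j * (j + 1) :=
        (Nat.le_mul_of_pos_left _ hn).trans (Nat.le_mul_of_pos_right _ (by omega))
      have hW3 : (1 + 1) * ((2 * (16 * 2 ^ j + 1) + (2 ^ j + 12) + 1) *
          ((n + 1) * (6 * j + 1 + 1))) ≤ 1152 * (n * 2 ^ j * (j + 1)) := by
        calc (1 + 1) * ((2 * (16 * 2 ^ j + 1) + (2 ^ j + 12) + 1) * ((n + 1) * (6 * j + 1 + 1)))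
            ≤ 2 * ((48 * 2 ^ j) * ((2 * n) * (6 * (j + 1)))) := by
              refine Nat.mul_le_mul le_rfl (Nat.mul_le_mul (by omega)
                (Nat.mul_le_mul (by omega) (by omega)))
          _ = _ := by ring
      generalize n * 2 ^ j * (j + 1) = W at *
      have k1 := Nat.mul_le_mul_left C₁ hW2
      have k3 := Nat.mul_le_mul_left C₃ hW3
      have k4 := Nat.mul_le_mul_left (u₀ + 1 + u₁) hW1
      calc _ ≤ (u₀ + 1 + u₁) * W + C₁ * W + C₃ * (1152 * W) := by omega
        _ ≤ (u₀ + 1 + u₁) * W + C₁ * W + C₃ * (1152 * W) + (u₂ + 16 * C₂) * W := by omega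
        _ = _ := by ring
  · rw [if_neg fun h => hbs (hbe.2 h)]
    refine Runs.mono (Runs.cond (T := 0) (U := C₂ * (n + 1) ^ 4 + ((setR 26 (.lit 1)).maxCost +
      C₃ * ((j + 1 + 1) * ((n ^ 4 + 12 + 1) * ((n + 1) * (6 * j + 1 + 1))))))
      (fun h => absurd h hbs) fun _ => ?_) ?_ fun _ _ h => h
    · refine Runs.seq (hC₂ s n cx cy r hn h0 h1 h2) ?_
      rintro s₁ hF₁ ⟨a9, hdirs⟩
      refine Runs.seq (Runs.straight rfl (Q := fun s' => s'.real 26 0 = 1)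
        (by simp [Prog.eff, NExp.eval, RExp.eval])) ?_
      intro s₂ hF₂ b26
      have b20 : s₂.real 20 = s.real 20 := by rw [hF₂.2 20 (by decide), hF₁.2 20 (by decide)]
      have b28 : s₂.real 28 = s₁.real 28 := hF₂.2 28 (by decide)
      have b29 : s₂.real 29 = s₁.real 29 := hF₂.2 29 (by decide)
      -- Starting at `η = 1`, the 2-approximation is within `1 + 12 * η`, and `1 < θ * 2 ^ (j + 1)`
      -- bounds the number of levels.
      refine hC₃ s₂ n (6 * j + 1) (n ^ 4) 12 (j + 1) cx cy r _ _ 1 θ ε hθ0 hθ1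
        le_rfl hjε hε1 ?_ (by omega) (pow_lt_precision j) hn hr
        (by rw [hF₂.1 0 (by decide), hF₁.1 0 (by decide), h0])
        (by rw [hF₂.1 6 (by decide), hF₁.1 6 (by decide), h6])
        (by rw [hF₂.1 9 (by decide), a9])
        (by rw [hF₂.2 1 (by decide), hF₁.2 1 (by decide), h1])
        (by rw [hF₂.2 2 (by decide), hF₁.2 2 (by decide), h2])
        (by rw [hF₂.2 3 (by decide), hF₁.2 3 (by decide), h3])
        b26 (by rw [hF₂.2 27 (by decide), hF₁.2 27 (by decide), h27]) b28 b29 ?_ ?_ ?_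
      · rw [pow_succ]
        linarith
      · rw [BestCover, b20, hF₂.2 22 (by decide), hF₂.2 23 (by decide), hF₂.2 24 (by decide),
          hF₂.2 25 (by decide), hF₁.2 22 (by decide), hF₁.2 23 (by decide), hF₁.2 24 (by decide),
          hF₁.2 25 (by decide)]
        exact hbest
      · intro x₁ y₁ x₂ y₂ R hcov
        have hR := hcov.nonneg hn hr
        rw [b20]
        refine (htwo _ _ _ _ _ hcov).trans (mul_le_mul_of_nonneg_right ?_ hR)
        norm_num
      · intro x₁ y₁ x₂ y₂ R hcov
        rw [a9] at hdirs
        obtain ⟨k, hk, hsp⟩ := hdirs _ _ _ _ _ hcov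
        refine ⟨k, hk, hsp.mono ?_⟩
        nlinarith [hcov.nonneg hn hr]
    · rw [hu₀]
      generalize (setR 26 (rv 27)).maxCost = u₁, (setR 26 (.lit 1)).maxCost = u₂
      have hW1 : 1 ≤ n ^ 5 * (j + 1) ^ 2 :=
        Nat.mul_pos (Nat.pow_pos hn) (Nat.pow_pos (by omega))
      have hW2 : (n + 1) ^ 4 ≤ 16 * (n ^ 5 * (j + 1) ^ 2) := by
        calc (n + 1) ^ 4 ≤ (2 * n) ^ 4 := Nat.pow_le_pow_left (by omega) 4
          _ = 16 * n ^ 4 := by ring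
          _ ≤ 16 * (n ^ 4 * (n * (j + 1) ^ 2)) := Nat.mul_le_mul le_rfl
            (Nat.le_mul_of_pos_right _ (Nat.mul_pos hn (Nat.pow_pos (by omega))))
          _ = _ := by ring
      have hW3 : (j + 1 + 1) * ((n ^ 4 + 12 + 1) * ((n + 1) * (6 * j + 1 + 1))) ≤
          1152 * (n ^ 5 * (j + 1) ^ 2) := by
        calc (j + 1 + 1) * ((n ^ 4 + 12 + 1) * ((n + 1) * (6 * j + 1 + 1)))
            ≤ (2 * (j + 1)) * ((48 * n ^ 4) * ((2 * n) * (6 * (j + 1)))) := by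
              refine Nat.mul_le_mul (by omega) (Nat.mul_le_mul (by omega)
                (Nat.mul_le_mul (by omega) (by omega)))
          _ = _ := by ring
      generalize n ^ 5 * (j + 1) ^ 2 = W at *
      have k1 := Nat.mul_le_mul_left C₂ hW2
      have k3 := Nat.mul_le_mul_left C₃ hW3
      have k4 := Nat.mul_le_mul_left (u₀ + 1 + u₂) hW1
      calc _ ≤ (u₀ + 1 + u₂) * W + C₂ * (16 * W) + C₃ * (1152 * W) := by omega
        _ ≤ (u₀ + 1 + u₂) * W + C₂ * (16 * W) + C₃ * (1152 * W) + (u₁ + C₁) * W := by omega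
        _ = _ := by ring

def writeOutput : Prog :=
  .setReal 4 (.lit 0) (rv 22) ;; .setReal 4 (.lit 1) (rv 23) ;; .setReal 4 (.lit 2) (rv 20) ;;
  .setReal 4 (.lit 3) (rv 24) ;; .setReal 4 (.lit 4) (rv 25) ;; .setReal 4 (.lit 5) (rv 20)

/-- The approximation algorithm. -/
def approxProg : Prog :=
  countDisks ;; setPrecision ;; firstCover ;; .cond (.realLt (.lit 0) (rv 20)) search .skip ;;
  writeOutput

theorem approxProg_runs : ∃ C : ℕ, ∀ (s : State) (n : ℕ) (cx cy r : ℕ → ℝ) (ε : ℝ), 1 ≤ n →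
    (∀ i < n, 0 ≤ r i) → 0 < ε → ε ≤ 1 → s.nat 0 0 = n → s.real 0 0 = ε → s.real 1 = cx →
    s.real 2 = cy → s.real 3 = r →
    ∃ j : ℕ, ε < 16 * (1 / 2 : ℝ) ^ j ∧ Runs approxProg s
      (C * if 1 < (n : ℝ) ^ 8 * ε then n * 2 ^ j * (j + 1) else n ^ 5 * (j + 1) ^ 2)
      fun s' => 0 ≤ s'.real 4 2 ∧ s'.real 4 5 = s'.real 4 2 ∧
        Cover n cx cy r (s'.real 4 0) (s'.real 4 1) (s'.real 4 3) (s'.real 4 4) (s'.real 4 2) ∧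
        ∀ x₁ y₁ x₂ y₂ R, Cover n cx cy r x₁ y₁ x₂ y₂ R → s'.real 4 2 ≤ (1 + ε) * R := by
  obtain ⟨C₁, hC₁⟩ := countDisks_runs
  obtain ⟨C₂, hC₂⟩ := setPrecision_runs
  obtain ⟨C₃, hC₃⟩ := firstCover_runs
  obtain ⟨C₄, hC₄⟩ := search_runs
  refine ⟨2 * C₁ + C₂ + 2 * C₃ + C₄ + (BExp.realLt (.lit 0) (rv 20)).cost + Prog.skip.maxCost + 1 +
    writeOutput.maxCost, ?_⟩
  intro s n cx cy r ε hn hr hε hε1 h0 h00 h1 h2 h3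
  -- The first run is opened up because `j` is chosen from the state after it, and has to be fixed
  -- before the running time of the whole program is stated.
  obtain ⟨t₁, s₁, hex₁, ht₁, a35⟩ := hC₁ s
  have hF₁ := hex₁.frame
  have a00 : s₁.real 0 0 = ε := by rw [hF₁.2 0 (by decide), h00]
  obtain ⟨j, hj1, hj2, hprec⟩ := hC₂ s₁ (by rw [a00]; exact hε) (by rw [a00]; exact hε1)
  rw [a00] at hj1 hj2
  refine ⟨j, hj2, ?_⟩
  rw [h0] at ht₁ a35
  obtain ⟨W, hW⟩ : ∃ W, W = if 1 < (n : ℝ) ^ 8 * ε then n * 2 ^ j * (j + 1)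
    else n ^ 5 * (j + 1) ^ 2 := ⟨_, rfl⟩
  set Q : State → Prop := fun s' => 0 ≤ s'.real 20 0 ∧
      Cover n cx cy r (s'.real 22 0) (s'.real 23 0) (s'.real 24 0) (s'.real 25 0) (s'.real 20 0) ∧
      ∀ x₁ y₁ x₂ y₂ R, Cover n cx cy r x₁ y₁ x₂ y₂ R → s'.real 20 0 ≤ (1 + ε) * R with hQ
  have hrun : Runs approxProg s (C₁ * (n + 1) + (C₂ * (j + 1) + (C₃ * (n + 1) +
      (((BExp.realLt (.lit 0) (rv 20)).cost + (C₄ * W + Prog.skip.maxCost) + 1) +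
      writeOutput.maxCost)))) fun s' => 0 ≤ s'.real 4 2 ∧ s'.real 4 5 = s'.real 4 2 ∧
        Cover n cx cy r (s'.real 4 0) (s'.real 4 1) (s'.real 4 3) (s'.real 4 4) (s'.real 4 2) ∧
        ∀ x₁ y₁ x₂ y₂ R, Cover n cx cy r x₁ y₁ x₂ y₂ R → s'.real 4 2 ≤ (1 + ε) * R := by
    refine Runs.seq (Q := fun s' => s' = s₁) ⟨t₁, s₁, hex₁, ht₁, rfl⟩ ?_
    rintro _ - rfl
    refine Runs.seq hprec ?_
    rintro s₂ hF₂ ⟨b27, b6⟩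
    have b0 : s₂.nat 0 0 = n := by rw [hF₂.1 0 (by decide), hF₁.1 0 (by decide), h0]
    have b1 : s₂.real 1 = cx := by rw [hF₂.2 1 (by decide), hF₁.2 1 (by decide), h1]
    have b2 : s₂.real 2 = cy := by rw [hF₂.2 2 (by decide), hF₁.2 2 (by decide), h2]
    have b3 : s₂.real 3 = r := by rw [hF₂.2 3 (by decide), hF₁.2 3 (by decide), h3]
    refine Runs.seq (hC₃ s₂ n cx cy r hn hr b0 b1 b2 b3) ?_
    rintro s₃ hF₃ ⟨c20, ccov, ctwo⟩
    refine Runs.seq (Runs.cond (Q := Q) (fun hg => ?_) fun hg => Runs.straight rfl ?_) ?_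
    · simp only [BExp.eval, RExp.eval, NExp.eval, Rat.cast_zero] at hg
      rw [hW]
      refine Runs.mono (hC₄ s₃ n j cx cy r ε hn hr hε hε1 hj1 (by rw [hF₃.1 0 (by decide), b0])
        (by rw [hF₃.1 6 (by decide), b6])
        (by rw [hF₃.2 0 (by decide), hF₂.2 0 (by decide), a00])
        (by rw [hF₃.2 1 (by decide), b1]) (by rw [hF₃.2 2 (by decide), b2])
        (by rw [hF₃.2 3 (by decide), b3]) (by rw [hF₃.2 27 (by decide), b27])
        (by rw [hF₃.2 35 (by decide), hF₂.2 35 (by decide), a35]) ⟨hg, ccov⟩ ctwo) le_rfl ?_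
      rintro s₄ - ⟨d1, d2⟩
      exact ⟨d1.1.le, d1.2, d2⟩
    · simp only [BExp.eval, RExp.eval, NExp.eval, Rat.cast_zero] at hg
      -- A first cover of radius `0` is optimal, and the search, which needs a positive radius, is
      -- skipped.
      have hz : s₃.real 20 0 = 0 := by linarith
      refine ⟨c20, ccov, fun x₁ y₁ x₂ y₂ R hcov => ?_⟩
      simp only [Prog.eff]
      rw [hz]
      exact mul_nonneg (by linarith) (hcov.nonneg hn hr)
    · rintro s₄ hF₄ ⟨d1, d2, d3⟩
      refine Runs.straight rfl ?_
      simp only [writeOutput, Prog.eff, RExp.eval, NExp.eval]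
      simp
      exact ⟨d1, d2, d3⟩
  rw [← hW]
  refine Runs.mono hrun ?_ fun _ _ h => h
  have hWn : n ≤ W ∧ j + 1 ≤ W := by
    have hp : 1 ≤ 2 ^ j := Nat.one_le_two_pow
    rw [hW]
    split_ifs
    · exact ⟨by rw [mul_assoc]; exact Nat.le_mul_of_pos_right _ (Nat.mul_pos hp (by omega)),
        Nat.le_mul_of_pos_left _ (Nat.mul_pos hn hp)⟩
    · refine ⟨?_, ?_⟩
      · rw [show n ^ 5 * (j + 1) ^ 2 = n * (n ^ 4 * (j + 1) ^ 2) by ring]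
        exact Nat.le_mul_of_pos_right _ (Nat.mul_pos (Nat.pow_pos hn) (Nat.pow_pos (by omega)))
      · rw [show n ^ 5 * (j + 1) ^ 2 = (n ^ 5 * (j + 1)) * (j + 1) by ring]
        exact Nat.le_mul_of_pos_left _ (Nat.mul_pos (Nat.pow_pos hn) (by omega))
  clear hW
  obtain ⟨hW1, hW2⟩ := hWn
  generalize (BExp.realLt (.lit 0) (rv 20)).cost = u₁, Prog.skip.maxCost = u₂,
    writeOutput.maxCost = u₃
  have k1 := Nat.mul_le_mul_left C₁ (show n + 1 ≤ 2 * W by omega)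
  have k2 := Nat.mul_le_mul_left C₂ hW2
  have k3 := Nat.mul_le_mul_left C₃ (show n + 1 ≤ 2 * W by omega)
  have k4 := Nat.mul_le_mul_left (u₁ + u₂ + 1 + u₃) (show 1 ≤ W by omega)
  calc _ ≤ C₁ * (2 * W) + C₂ * W + C₃ * (2 * W) + C₄ * W + (u₁ + u₂ + 1 + u₃) * W := by omega
    _ = _ := by ring

/-- Since `2 ^ j ≤ 16 / ε`, what remains is to absorb the powers of `j + 1`: into `log (n + 1)` if
`1 / ε < n ^ 8`, and into `1 / ε` together with `n ^ 4` otherwise. The case `n = 1` is covered by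
`log 2 ≥ 1 / 2`. -/
theorem time_bound (n j : ℕ) (hn : 1 ≤ n) (ε : ℝ) (hε : 0 < ε)
    (hj : ε < 16 * (1 / 2 : ℝ) ^ j) :
    ((if 1 < (n : ℝ) ^ 8 * ε then n * 2 ^ j * (j + 1) else n ^ 5 * (j + 1) ^ 2 : ℕ) : ℝ) ≤
      1000 * ((n : ℝ) / ε * Real.log ((n : ℝ) + 1)) := by
  have hn' : (1 : ℝ) ≤ n := by exact_mod_cast hn
  have hj2 : (2 : ℝ) ^ j * ε ≤ 16 := by
    have e : (2 : ℝ) ^ j * (1 / 2 : ℝ) ^ j = 1 := by rw [← mul_pow]; norm_num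
    have := mul_le_mul_of_nonneg_left hj.le (show (0 : ℝ) ≤ 2 ^ j by positivity)
    nlinarith
  have hl2 : (1 / 2 : ℝ) ≤ Real.log 2 := by linarith [Real.log_two_gt_d9]
  have hln : Real.log 2 ≤ Real.log ((n : ℝ) + 1) := Real.log_le_log (by norm_num) (by linarith)
  set l := Real.log ((n : ℝ) + 1) with hl
  split_ifs with h
  -- Taking logarithms of `2 ^ j ≤ 16 * n ^ 8` gives `j * log 2 ≤ 4 * log 2 + 8 * log n`, at most
  -- `12 * l`.
  · have hpow : (2 : ℝ) ^ j ≤ 16 * (n : ℝ) ^ 8 := by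
      have h1 : (2 : ℝ) ^ j * ε ≤ (16 * (n : ℝ) ^ 8) * ε := by nlinarith
      exact le_of_mul_le_mul_right h1 hε
    have hjl : (j : ℝ) ≤ 24 * l := by
      have h1 := Real.log_le_log (by positivity) hpow
      rw [Real.log_pow, Real.log_mul (by norm_num) (by positivity), Real.log_pow,
        show (16 : ℝ) = 2 ^ 4 by norm_num, Real.log_pow] at h1
      have h2 : Real.log (n : ℝ) ≤ l := Real.log_le_log (by linarith) (by linarith)
      push_cast at h1
      have h3 : (j : ℝ) * Real.log 2 ≤ 12 * l := by linarith
      have h4 : (j : ℝ) * (1 / 2) ≤ j * Real.log 2 :=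
        mul_le_mul_of_nonneg_left hl2 (by positivity)
      linarith
    push_cast
    have h2j : (2 : ℝ) ^ j ≤ 16 / ε := by rwa [le_div_iff₀ hε]
    calc (n : ℝ) * 2 ^ j * (j + 1) ≤ (n * (16 / ε)) * (26 * l) :=
          mul_le_mul (mul_le_mul_of_nonneg_left h2j (by linarith)) (by linarith) (by positivity)
            (by positivity)
      _ = 416 * (n / ε * l) := by ring
      _ ≤ 1000 * (n / ε * l) := by
          refine mul_le_mul_of_nonneg_right (by norm_num) (mul_nonneg (by positivity) (by linarith))
  -- Bernoulli's inequality for `9 / 8`, together with `(9 / 8) ^ 4 ≤ 2`, shows that `(j + 1) ^ 4`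
  -- is at most `8 ^ 4 * 2 ^ j`, hence of order `1 / ε`; combined with `n ^ 8 ≤ 1 / ε` it yields the
  -- bound after a square root.
  · have hb := one_add_mul_le_pow (show (-2 : ℝ) ≤ 1 / 8 by norm_num) j
    have h4 : ((j : ℝ) + 1) ^ 4 ≤ 4096 * 2 ^ j := by
      have h1 : ((1 : ℝ) + j * (1 / 8)) ^ 4 ≤ 2 ^ j := by
        calc ((1 : ℝ) + j * (1 / 8)) ^ 4 ≤ ((1 + 1 / 8 : ℝ) ^ j) ^ 4 :=
              pow_le_pow_left₀ (by positivity) hb 4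
          _ = ((1 + 1 / 8 : ℝ) ^ 4) ^ j := by rw [← pow_mul, ← pow_mul, mul_comm]
          _ ≤ 2 ^ j := pow_le_pow_left₀ (by norm_num) (by norm_num) j
      have h2 : ((j : ℝ) + 1) ^ 4 ≤ (8 * (1 + j * (1 / 8))) ^ 4 :=
        pow_le_pow_left₀ (by positivity) (by linarith) 4
      rw [mul_pow] at h2
      linarith
    have h5 : (n : ℝ) ^ 4 * (j + 1) ^ 2 ≤ 256 / ε := by
      rw [le_div_iff₀ hε]
      refine le_of_sq_le_sq ?_ (by norm_num)
      have h6 : ((j : ℝ) + 1) ^ 4 * ε ≤ 65536 := by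
        have := mul_le_mul_of_nonneg_right h4 hε.le
        linarith
      calc ((n : ℝ) ^ 4 * (j + 1) ^ 2 * ε) ^ 2 = ((n : ℝ) ^ 8 * ε) * (((j : ℝ) + 1) ^ 4 * ε) := by
            ring
        _ ≤ 1 * 65536 := mul_le_mul (not_lt.1 h) h6 (by positivity) (by norm_num)
        _ = 256 ^ 2 := by norm_num
    push_cast
    calc (n : ℝ) ^ 5 * (j + 1) ^ 2 = n * ((n : ℝ) ^ 4 * (j + 1) ^ 2) := by ring
      _ ≤ n * (256 / ε) := mul_le_mul_of_nonneg_left h5 (by linarith)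
      _ = 256 * (n / ε) := by ring
      _ ≤ (1000 * l) * (n / ε) := mul_le_mul_of_nonneg_right (by linarith) (by positivity)
      _ = _ := by ring

/-! ### Disks -/

/-- The point of the small ball farthest from `p` lies at distance `dist p c + r`, on the ray from
`p` through `c`; if `c = p` any unit vector gives such a point. This turns containment into the
numerical condition that the program tests. -/
theorem closedBall_subset_iff (c p : Plane) (r R : ℝ) (hr : 0 ≤ r) :
    Metric.closedBall c r ⊆ Metric.closedBall p R ↔ dist p c + r ≤ R := by
  constructor
  · intro h
    obtain ⟨v, hv, hcv⟩ : ∃ v : Plane, ‖v‖ = 1 ∧ c - p = ‖c - p‖ • v := by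
      rcases eq_or_ne c p with rfl | hne
      · exact ⟨EuclideanSpace.single 0 1, by simp, by simp⟩
      · have h0 : ‖c - p‖ ≠ 0 := norm_ne_zero_iff.2 (sub_ne_zero.2 hne)
        refine ⟨‖c - p‖⁻¹ • (c - p), ?_, ?_⟩
        · rw [norm_smul, norm_inv, norm_norm, inv_mul_cancel₀ h0]
        · rw [smul_smul, mul_inv_cancel₀ h0, one_smul]
    have hm : c + r • v ∈ Metric.closedBall c r := by
      rw [Metric.mem_closedBall, dist_eq_norm, add_sub_cancel_left, norm_smul, hv, mul_one,
        Real.norm_of_nonneg hr]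
    have h1 := h hm
    rw [Metric.mem_closedBall, dist_eq_norm] at h1
    have e : c + r • v - p = (‖c - p‖ + r) • v := by
      rw [add_smul, ← hcv]
      abel
    rw [e, norm_smul, hv, mul_one, Real.norm_of_nonneg (by positivity)] at h1
    rwa [dist_comm, dist_eq_norm]
  · intro h
    refine Metric.closedBall_subset_closedBall' ?_
    rw [dist_comm]
    linarith

theorem pt_eta (p : Plane) : pt (p 0) (p 1) = p := by
  ext i
  fin_cases i <;> simp [pt]

theorem isRestrictedCover_iff {n : ℕ} (ε : ℝ) (D : Fin n → Disk) (C₁ C₂ : Disk)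
    (h : C₁.radius = C₂.radius) :
    IsRestrictedCover D C₁ C₂ ↔ Cover n ((input ε D).real 1) ((input ε D).real 2)
      ((input ε D).real 3) (C₁.center 0) (C₁.center 1) (C₂.center 0) (C₂.center 1) C₁.radius := by
  have key : ∀ (i : ℕ) (hi : i < n) (C : Disk), (D ⟨i, hi⟩).carrier ⊆ C.carrier ↔
      dd (C.center 0) (C.center 1) ((input ε D).real 1 i) ((input ε D).real 2 i) +
        (input ε D).real 3 i ≤ C.radius := by
    intro i hi C
    rw [Disk.carrier, Disk.carrier, closedBall_subset_iff _ _ _ _ (D ⟨i, hi⟩).radius_nonneg,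
      dd_eq_dist]
    simp [input, hi, pt_eta]
  constructor
  · rintro ⟨-, hc⟩ i hi
    have := hc ⟨i, hi⟩
    rwa [key i hi, key i hi, ← h] at this
  · intro hc
    refine ⟨h, fun i => ?_⟩
    exact (hc i i.2).imp (key i i.2 C₁).2 fun h' => (key i i.2 C₂).2 (h'.trans_eq h)

end TwoCenter

theorem mainTheorem6 :
    ∃ (P : RealRAM.Prog) (K : ℝ), ∀ (ε : ℝ), 0 < ε → ε ≤ 1 →
      ∀ (n : ℕ), 1 ≤ n → ∀ (D : Fin n → TwoCenter.Disk),
        ∃ (t : ℕ) (s : RealRAM.State) (C₁ C₂ : TwoCenter.Disk),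
          RealRAM.Exec P (TwoCenter.input ε D) t s ∧
          (t : ℝ) ≤ K * ((n : ℝ) / ε * Real.log ((n : ℝ) + 1)) ∧
          TwoCenter.IsOutput s C₁ C₂ ∧
          TwoCenter.IsApproxRestrictedCover (1 + ε) D C₁ C₂ := by
  obtain ⟨C, hC⟩ := TwoCenter.approxProg_runs
  refine ⟨TwoCenter.approxProg, C * 1000, fun ε hε hε1 n hn D => ?_⟩
  obtain ⟨j, hj, t, s, hex, ht, hR, h5, hcov, happ⟩ := hC (TwoCenter.input ε D) n _ _ _ ε hn
    (fun i hi => by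
      simpa [TwoCenter.input, hi] using (D ⟨i, hi⟩).radius_nonneg) hε hε1
    (by simp [TwoCenter.input]) (by simp [TwoCenter.input]) rfl rfl rfl
  refine ⟨t, s, ⟨TwoCenter.pt (s.real 4 0) (s.real 4 1), s.real 4 2, hR⟩,
    ⟨TwoCenter.pt (s.real 4 3) (s.real 4 4), s.real 4 2, hR⟩, hex, ?_, ?_, ?_, ?_⟩
  · refine (Nat.cast_le.2 ht).trans ?_
    rw [Nat.cast_mul, mul_assoc (C : ℝ) 1000]
    exact mul_le_mul_of_nonneg_left (TwoCenter.time_bound n j hn ε hε hj) (Nat.cast_nonneg _)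
  · simp [TwoCenter.IsOutput, TwoCenter.pt, h5]
  · refine (TwoCenter.isRestrictedCover_iff ε D _ _ ?_).2 ?_
    · rfl
    · simpa [TwoCenter.pt] using hcov
  · intro C₁' C₂' h'
    exact happ _ _ _ _ _ ((TwoCenter.isRestrictedCover_iff ε D _ _ h'.1).1 h')
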